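/- **Formulas and modules.** MELL formulas are $A,B ::= X\mid X^\perp\mid \mathbf 1\mid\bot\mid A\otimes B\mid A\parr B\mid {!}A\mid{?}A$ ($X$ in a countably infinite set), with the usual involutive linear negation $A^\perp$. A *module* is a finite directed graph in which every edge has a source and is labelled by a formula (its type), edges without target are called *conclusions*, and every vertex (*cell*) has one of the following types: $\mathtt{ax}$ (no input; two outputs, of types $X,X^\perp$ with $X$ a variable), $\mathtt{cut}$ (two inputs, of types $A,A^\perp$; no output), $\mathbf 1$, $\bot$ (no input; one output, of that type), $\otimes$, $\parr$ (two ordered inputs of types $A,B$; one output, of type $A\otimes B$, resp. $A\parr B$), ${?}$, ${!}$ (any finite number of unordered inputs of type $A$; one output, of type ${?}A$, resp. ${!}A$), or daimon $\maltese_p$, $p\in\mathbb N$ (no input; $p$ outputs of arbitrary types). The conclusions of a module are totally ordered. **Proof-structures.** A *component* is a module with a finite rooted tree (its box-tree, edges directed to the root) and a box-function, which is a morphism of directed graphs from the module to the reflexive-transitive closure of the tree; conclusions start at cells lying over the root; if an edge from $v'$ to $v$ has $\mathsf{box}(v)\ne\mathsf{box}(v')$ then $v$ is a ${!}$- or a ${?}$-cell;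 and the box-function induces a partial injection from the inputs of ${!}$-cells to the edges of the tree. A *quasi-proof-structure* is a finite list of components (the roots of their trees being the roots of its box-forest); its *type* is the list of the lists of the types of the conclusions of its components. The empty list is $\varepsilon$. A *proof-structure* is a quasi-proof-structure with at most one component. It is *MELL* if every ${!}$-cell has exactly one input, the box-function induces a bijection from the inputs of ${!}$-cells to the edges of the box-trees, and every daimon $v$ is the only cell over $\mathsf{box}(v)$, which is not a root (so boxes filled by just one daimon are allowed). It is $\mathrm{DiLL}_0^{\maltese}$ if every box-tree is a single root, and $\mathrm{DiLL}_0$ (or *resource*) if moreover it has no daimon. Quasi-proof-structures are considered up to isomorphism. **Taylor expansion.** A *thick subtree* of a rooted tree $\tau$ is a finite rooted tree $\sigma$ with a graph morphism $h:\sigma\to\tau$ sending the root to the root. The *Taylor expansion* $\mathcal T(R)$ of a quasi-proof-structure $R$ is the set of the $\mathrm{DiLL}_0^{\maltese}$ quasi-proof-structures obtained by choosing a thick subtree $(\sigma,h)$ of the box-tree of each component of $R$ and replacing that component by the pullback, in directed graphs, of its box-function along the morphism induced by $h$ between the reflexive-transitive closures, with the inherited labels and orders (and with the box-tree reduced to its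 root). **Paths.** Paths are finite sequences of elementary paths, which act on lists of lists of formulas by rewriting one list (zone), the other zones being unchanged; zones are separated by semicolons and $\Gamma,\Gamma'$ stand for lists of formulas: $\mathtt{exc}:\Gamma,A,B,\Gamma'\to\Gamma,B,A,\Gamma'$; $\mathtt{mix}:\Gamma,A,B,\Gamma'\to\Gamma,A\,;\,B,\Gamma'$; $\mathtt{ax}:A,A^\perp\to$ no zone; $\mathtt{cut}:\Gamma\to\Gamma,A,A^\perp$; $\maltese:\Gamma,A\to$ no zone; $\mathbf 1:\mathbf 1\to$ no zone; $\bot:\bot\to$ no zone; $\otimes:\Gamma,A\otimes B\to\Gamma,A,B$; $\parr:\Gamma,A\parr B\to\Gamma,A,B$; ${?}_{\mathsf c}:\Gamma,{?}A\to\Gamma,{?}A,{?}A$; ${?}_{\mathsf d}:\Gamma,{?}A\to\Gamma,A$; ${?}_{\mathsf w}:{?}A\to$ no zone; $\mathsf{Box}:{?}\Gamma,{!}A\to{?}\Gamma,A$. An elementary path $a:\Delta\to\Delta'$ relates a $\mathrm{DiLL}_0^{\maltese}$ quasi-proof-structure $\rho$ of type $\Delta$ to a set of $\mathrm{DiLL}_0^{\maltese}$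 quasi-proof-structures of type $\Delta'$. Only the component $c$ of $\rho$ at the rewritten zone changes; except in the last case of $\mathsf{Box}$, the set is a singleton. * $\mathtt{exc}$ exchanges the two conclusions. * $\mathtt{mix}$ splits $c$, if it is the disjoint union of two modules with the prescribed conclusions, into these two components. * $\mathtt{ax},\mathbf 1,\bot,{?}_{\mathsf w},\maltese$ delete $c$, if $c$ is a single cell without inputs, of type $\mathtt{ax}$, $\mathbf 1$, $\bot$, ${?}$, $\maltese_p$ respectively. * $\mathtt{cut}$ deletes a $\mathtt{cut}$-cell, whose inputs become the last two conclusions. * $\otimes,\parr$ delete the $\otimes$-, $\parr$-cell at the last conclusion, whose inputs become conclusions in order; ${?}_{\mathsf d}$ deletes the ${?}$-cell at the last conclusion if it has exactly one input, which becomes a conclusion. * ${?}_{\mathsf c}$ splits the ${?}$-cell at the last conclusion, with $h+k$ inputs, into two ${?}$-cells with $h$ and $k$ inputs ($h,k\ge 0$). * Daimons: if $c$ is a single daimon cell, then $\mathtt{mix}$ replaces it by two components that are single daimon cells, $\mathtt{ax},\mathbf 1,\bot,{?}_{\mathsf w}$ delete it, and $\mathtt{cut},\otimes,\parr,{?}_{\mathsf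 c},{?}_{\mathsf d},\mathsf{Box}$ replace it by a single daimon cell with the new types of conclusions. * $\mathsf{Box}$, empty case: if $c$ consists only of a ${!}$-cell at the last conclusion and of ${?}$-cells at the other conclusions, all without inputs, then $c$ is replaced by a single daimon cell with conclusions of types ${?}\Gamma,A$. * $\mathsf{Box}$, non-empty case: suppose that the last conclusion of $c$ is the output of a ${!}$-cell with $n>0$ inputs, that the other conclusions are outputs of ${?}$-cells, and that the rest of $c$ is the union of $n$ parts $\rho_1,\dots,\rho_n$ that are connected to each other only through this ${!}$-cell and these ${?}$-cells, each $\rho_j$ containing the source of exactly one input of the ${!}$-cell. Then $\rho$ is related to the set of the $n$ structures obtained by replacing $c$ by $\rho_j$ together with these ${?}$-cells (keeping only their inputs from $\rho_j$), the input of the ${!}$-cell in $\rho_j$ becoming the last conclusion. For sets, $\Pi\to\Pi'$ by an elementary path if each $\rho\in\Pi$ can be related to a set $S_\rho$ so that $\Pi'=\bigcup_{\rho\in\Pi}S_\rho$; paths act by composition (the empty path on $\Delta$ acts as the identity on sets of structures of type $\Delta$). A set $\Pi$ is *glueable* if some path rewrites $\Pi$ to $\{\varepsilon\}$. **Theorem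 (glueability criterion).** Let $\Pi$ be a non-empty (finite or infinite) set of $\mathrm{DiLL}_0$ proof-structures, none of which consists of a root without any cell. Then $\Pi$ is glueable if and only if $\Pi\subseteq\mathcal T(R)$ for some MELL proof-structure $R$. -/

import Mathlib

namespace Glue

/-! ## MELL formulas and cells -/

/-- MELL formulas over the countably infinite set of propositional variables `ℕ`. -/
inductive Formula : Type
  | var (X : ℕ)
  | nvar (X : ℕ)
  | one
  | bot
  | tensor (A B : Formula)
  | par (A B : Formula)
  | bang (A : Formula)
  | whynot (A : Formula)

/-- Linear negation. -/
def Formula.dual : Formula → Formula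
  | .var X => .nvar X
  | .nvar X => .var X
  | .one => .bot
  | .bot => .one
  | .tensor A B => .par A.dual B.dual
  | .par A B => .tensor A.dual B.dual
  | .bang A => .whynot A.dual
  | .whynot A => .bang A.dual

/-- The types (labels) of cells. -/
inductive CellType : Type
  | ax | cut | one | bot | tensor | par | whynot | bang
  | daimon (p : ℕ)

/-- The cells with two ordered inputs. -/
def CellType.IsBinary (t : CellType) : Prop := t = .tensor ∨ t = .par

/-! ## Modules without input tails -/

/-- The typing conditions on one cell with label `t`, set of inputs `ins`, set of outputs `outs`,
where `typ` gives the types of the edges and `first` marks the first input of a binary cell.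
Axioms are atomic; a daimon puts no condition on the types of its outputs. -/
def CellOK {E : Type} (typ : E → Formula) (first : E → Prop) (t : CellType) (ins outs : Set E) :
    Prop :=
  match t with
  | .ax => ins = ∅ ∧ ∃ a b X, outs = {a, b} ∧ typ a = .var X ∧ typ b = .nvar X
  | .cut => outs = ∅ ∧ ∃ a b, ins = {a, b} ∧ typ b = (typ a).dual
  | .one => ins = ∅ ∧ ∃ o, outs = {o} ∧ typ o = .one
  | .bot => ins = ∅ ∧ ∃ o, outs = {o} ∧ typ o = .bot
  | .tensor => ∃ a b o, ins = {a, b} ∧ first a ∧ ¬ first b ∧ outs = {o} ∧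
      typ o = .tensor (typ a) (typ b)
  | .par => ∃ a b o, ins = {a, b} ∧ first a ∧ ¬ first b ∧ outs = {o} ∧
      typ o = .par (typ a) (typ b)
  | .whynot => ∃ o A, outs = {o} ∧ typ o = .whynot A ∧ ∀ e ∈ ins, typ e = A
  | .bang => ∃ o A, outs = {o} ∧ typ o = .bang A ∧ ∀ e ∈ ins, typ e = A
  | .daimon p => ins = ∅ ∧ outs.ncard = p

/-- A module without input tails: a finite directed graph whose vertices (cells) are labelled by
cell types and whose edges are labelled by formulas; every edge has a source, and an edge `e` with
`tgt e = none` is an output tail, also called a conclusion.  The conclusions are totally ordered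
(they are listed in `concl`), and so are the two inputs of every tensor or par cell (`first e` says
that `e` is the first of the two; it is meaningless on the other edges). -/
structure Net : Type 1 where
  V : Type
  E : Type
  finite_V : Finite V
  finite_E : Finite E
  label : V → CellType
  typ : E → Formula
  src : E → V
  tgt : E → Option V
  first : E → Prop
  concl : List E
  concl_nodup : concl.Nodup
  mem_concl : ∀ e, e ∈ concl ↔ tgt e = none
  cell_ok : ∀ v, CellOK typ first (label v) {e | tgt e = some v} {e | src e = v}

/-- The list of the types of the conclusions. -/
def Net.type (c : Net) : List Formula := c.concl.map c.typ

/-- Label preserving morphisms of graphs.  A tail of `M` may be sent to any edge of `N`. -/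
structure Net.Hom (M N : Net) where
  v : M.V → N.V
  e : M.E → N.E
  label_v : ∀ x, N.label (v x) = M.label x
  typ_e : ∀ x, N.typ (e x) = M.typ x
  src_e : ∀ x, N.src (e x) = v (M.src x)
  tgt_e : ∀ x y, M.tgt x = some y → N.tgt (e x) = some (v y)
  first_e : ∀ x y, M.tgt x = some y → (M.label y).IsBinary → (N.first (e x) ↔ M.first x)

/-! ## Rooted trees and proof-structures with boxes -/

/-- Finite rooted trees as directed graphs; each node other than the root has one edge, directed to its parent. -/
structure BoxTree : Type 1 where
  Node : Type
  finite_Node : Finite Node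
  root : Node
  parent : Node → Option Node
  parent_eq_none : ∀ b, parent b = none ↔ b = root
  reaches_root : ∀ b, Relation.ReflTransGen (fun x y => parent x = some y) b root

/-- `T.Below b a`: there is a directed path from `b` down to `a`, that is, an edge from `b` to `a`
in the reflexive-transitive closure of `T` (this edge is unique). -/
def BoxTree.Below (T : BoxTree) : T.Node → T.Node → Prop :=
  Relation.ReflTransGen (fun x y => T.parent x = some y)

/-- A component: a module without input tails, a box-tree, and a box-function, which is a morphism
from the module to the reflexive-transitive closure of the box-tree.  An edge of the tree is named
by the node it starts from.  This is a quasi-proof-structure whose box-forest is one tree. -/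
structure Component : Type 1 where
  net : Net
  tree : BoxTree
  box : net.V → tree.Node
  /-- the box-function is a morphism of directed graphs -/
  box_edge : ∀ e v, net.tgt e = some v → tree.Below (box (net.src e)) (box v)
  /-- conclusions are outside all boxes -/
  box_concl : ∀ e, net.tgt e = none → box (net.src e) = tree.root
  /-- the border of a box consists of inputs of `!`-cells and `?`-cells -/
  box_border : ∀ e v, net.tgt e = some v → box (net.src e) ≠ box v →
    net.label v = .bang ∨ net.label v = .whynot
  /-- the partial map from inputs of `!`-cells to edges of the tree is injective -/
  box_inj : ∀ e e' v v', net.tgt e = some v → net.tgt e' = some v' →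
    net.label v = .bang → net.label v' = .bang →
    tree.parent (box (net.src e)) = some (box v) → tree.parent (box (net.src e')) = some (box v') →
    box (net.src e) = box (net.src e') → e = e'

/-- MELL with daimons: every `!`-cell has exactly one input, and the box-function gives a (total)
bijection from the inputs of the `!`-cells to the edges of the box-tree. -/
def Component.IsMELLDaimon (R : Component) : Prop :=
  (∀ v, R.net.label v = .bang → ∃! e, R.net.tgt e = some v) ∧
  (∀ e v, R.net.tgt e = some v → R.net.label v = .bang →
    R.tree.parent (R.box (R.net.src e)) = some (R.box v)) ∧
  (∀ b, b ≠ R.tree.root → ∃ e v, R.net.tgt e = some v ∧ R.net.label v = .bang ∧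
    R.box (R.net.src e) = b)

/-- MELL: moreover every daimon is inside a box and is the only cell of the innermost box that
contains it. -/
def Component.IsMELL (R : Component) : Prop :=
  R.IsMELLDaimon ∧
  ∀ v p, R.net.label v = .daimon p → (∀ w, R.box w = R.box v → w = v) ∧ R.box v ≠ R.tree.root

/-- A quasi-proof-structure, as the list of its components, one for each root of its box-forest
(no edge of the module joins two components, and the conclusions of a component are consecutive).
The empty list is the empty proof-structure `ε`. -/
abbrev QuasiProofStructure : Type 1 := List Component

/-- Proof-structures: the box-forest is a tree, possibly empty. -/
def QuasiProofStructure.IsProofStructure (R : QuasiProofStructure) : Prop := R.length ≤ 1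

def QuasiProofStructure.IsMELL (R : QuasiProofStructure) : Prop := ∀ C ∈ R, C.IsMELL

/-- A `DiLL₀` quasi-proof-structure that may contain daimons.  Its box-forest consists of roots
only, so that the box-function carries no more information than the list of the components, and
each component is a module.  The empty list is `ε`. -/
abbrev ResourceQPS : Type 1 := List Net

/-- `DiLL₀` proof-structures: the box-forest is one root (or is empty), and there is no daimon. -/
def ResourceQPS.IsResourceProofStructure (ρ : ResourceQPS) : Prop :=
  ρ.length ≤ 1 ∧ ∀ c ∈ ρ, ∀ v p, c.label v ≠ .daimon p

/-- Lists of lists of formulas: the types of quasi-proof-structures. -/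
abbrev Sequent : Type := List (List Formula)

def ResourceQPS.type (ρ : ResourceQPS) : Sequent := ρ.map Net.type

/-! ## The Taylor expansion -/

/-- Thick subtrees: a tree with a graph morphism sending the root to the root. -/
structure ThickSubtree (τ : BoxTree) : Type 1 where
  tree : BoxTree
  h : tree.Node → τ.Node
  h_root : h tree.root = τ.root
  h_parent : ∀ s s', tree.parent s = some s' → τ.parent (h s) = some (h s')

/-- `ρ`, with the projections `pV`, `pE` to the module of `R` and `pT` to the reflexive-transitive
closure of `t.tree`, is the pullback of the box-function of `R` along `t.h`; labels, types and
orders are inherited through `pV` and `pE`.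
In the pullback, an edge lies over an edge `e` of `R` and over an edge `s ⟶ s'` of the closure of
`t.tree` with the same image; as `t.h` is a morphism of trees, `s'` is determined by `s` and the
target of `e`, so that such pairs are the pairs `(e, s)` of `edge_bij`. -/
structure Expansion (R : Component) (t : ThickSubtree R.tree) (ρ : Net) where
  pV : ρ.V → R.net.V
  pE : ρ.E → R.net.E
  pT : ρ.V → t.tree.Node
  comm : ∀ x, R.box (pV x) = t.h (pT x)
  vertex_bij : ∀ v s, R.box v = t.h s → ∃! x, pV x = v ∧ pT x = s
  edge_bij : ∀ e s, R.box (R.net.src e) = t.h s → ∃! x, pE x = e ∧ pT (ρ.src x) = s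
  src_comm : ∀ x, R.net.src (pE x) = pV (ρ.src x)
  tgt_comm : ∀ x, R.net.tgt (pE x) = (ρ.tgt x).map pV
  tgt_below : ∀ x y, ρ.tgt x = some y → t.tree.Below (pT (ρ.src x)) (pT y)
  label_comm : ∀ x, ρ.label x = R.net.label (pV x)
  typ_comm : ∀ x, ρ.typ x = R.net.typ (pE x)
  concl_comm : ρ.concl.map pE = R.net.concl
  first_comm : ∀ x y, ρ.tgt x = some y → (ρ.label y).IsBinary →
    (ρ.first x ↔ R.net.first (pE x))

/-- The Taylor expansion, closed under isomorphism: a thick subforest of a forest is a thick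
subtree of each of its trees. -/
def taylor (R : QuasiProofStructure) : Set ResourceQPS :=
  {ρ | List.Forall₂ (fun C c => ∃ t, Nonempty (Expansion C t c)) R ρ}

/-! ## Elementary paths -/

/-- The elementary paths, restricted to the zone on which they act: `Rule L M` replaces the zone
`L` by the zones in `M`. -/
inductive Rule : List Formula → Sequent → Type
  | exc (L : List Formula) (A B : Formula) (L' : List Formula) :
      Rule (L ++ A :: B :: L') [L ++ B :: A :: L']
  | mix (L : List Formula) (A B : Formula) (L' : List Formula) :
      Rule (L ++ A :: B :: L') [L ++ [A], B :: L']
  | ax (A : Formula) : Rule [A, A.dual] []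
  | cut (L : List Formula) (A : Formula) : Rule L [L ++ [A, A.dual]]
  | daimon (L : List Formula) (A : Formula) : Rule (L ++ [A]) []
  | one : Rule [.one] []
  | bot : Rule [.bot] []
  | tensor (L : List Formula) (A B : Formula) : Rule (L ++ [.tensor A B]) [L ++ [A, B]]
  | par (L : List Formula) (A B : Formula) : Rule (L ++ [.par A B]) [L ++ [A, B]]
  | contr (L : List Formula) (A : Formula) :
      Rule (L ++ [.whynot A]) [L ++ [.whynot A, .whynot A]]
  | der (L : List Formula) (A : Formula) : Rule (L ++ [.whynot A]) [L ++ [A]]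
  | weak (A : Formula) : Rule [.whynot A] []
  | box (L : List Formula) (A : Formula) :
      Rule (L.map .whynot ++ [.bang A]) [L.map .whynot ++ [A]]

/-- Elementary paths: a rule applied to one zone of a list of lists of formulas. -/
inductive Elementary : Sequent → Sequent → Type
  | mk (Δ : Sequent) {L : List Formula} {M : Sequent} (r : Rule L M) (Δ' : Sequent) :
      Elementary (Δ ++ L :: Δ') (Δ ++ M ++ Δ')

/-- Paths are the morphisms `Quiver.Path Γ Γ'` of the free category on this quiver. -/
instance : Quiver Sequent := ⟨Elementary⟩

/-! ## The action of rules on one component -/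

/-- The component is a single cell, of type `t` and without inputs. -/
def IsLone (c : Net) (t : CellType) : Prop :=
  ∃ v, (∀ x, x = v) ∧ c.label v = t ∧ ∀ e, c.tgt e = none

/-- The component is a single daimon, whose outputs are its conclusions. -/
def IsDaimon (c : Net) : Prop := ∃ p, IsLone c (.daimon p)

/-- `c` is `c'` with the conclusions at positions `n` and `n + 1` exchanged. -/
def Exchange (n : ℕ) (c c' : Net) : Prop :=
  ∃ f : Net.Hom c' c, f.v.Bijective ∧ f.e.Bijective ∧ ∃ l x y l', l.length = n ∧
    c'.concl = l ++ y :: x :: l' ∧ c.concl = l.map f.e ++ f.e x :: f.e y :: l'.map f.e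

/-- `c` is the disjoint union of `c₁` and `c₂`. -/
def Juxtapose (c c₁ c₂ : Net) : Prop :=
  ∃ (f : Net.Hom c₁ c) (g : Net.Hom c₂ c),
    (Sum.elim f.v g.v).Bijective ∧ (Sum.elim f.e g.e).Bijective ∧
    c.concl = c₁.concl.map f.e ++ c₂.concl.map g.e

/-- `c` is `c'` with its last two conclusions cut by a new cut-cell `w`. -/
def RemoveCut (c c' : Net) : Prop :=
  ∃ (f : Net.Hom c' c) (w : c.V), c.label w = .cut ∧
    f.v.Injective ∧ Set.range f.v = {w}ᶜ ∧ f.e.Bijective ∧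
    ∃ l a b, c'.concl = l ++ [a, b] ∧ c.concl = l.map f.e ∧
      c.tgt (f.e a) = some w ∧ c.tgt (f.e b) = some w

/-- `c` is `c'` with its last two conclusions joined, in this order, by a new binary cell of
type `t`, whose output is the last conclusion of `c`. -/
def RemoveBinary (t : CellType) (c c' : Net) : Prop :=
  ∃ (f : Net.Hom c' c) (l : List c'.E) (a b : c'.E) (o : c.E), c.label (c.src o) = t ∧
    f.v.Injective ∧ Set.range f.v = {c.src o}ᶜ ∧ f.e.Injective ∧ Set.range f.e = {o}ᶜ ∧
    c'.concl = l ++ [a, b] ∧ c.concl = l.map f.e ++ [o] ∧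
    c.tgt (f.e a) = some (c.src o) ∧ c.tgt (f.e b) = some (c.src o) ∧
    c.first (f.e a) ∧ ¬ c.first (f.e b)

/-- `c` is `c'` with a new `?`-cell added below its last conclusion. -/
def RemoveDereliction (c c' : Net) : Prop :=
  ∃ (f : Net.Hom c' c) (l : List c'.E) (a : c'.E) (o : c.E), c.label (c.src o) = .whynot ∧
    f.v.Injective ∧ Set.range f.v = {c.src o}ᶜ ∧ f.e.Injective ∧ Set.range f.e = {o}ᶜ ∧
    c'.concl = l ++ [a] ∧ c.concl = l.map f.e ++ [o] ∧ c.tgt (f.e a) = some (c.src o)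

/-- `c` is `c'` where the `?`-cells of the last two conclusions are merged: the `?`-cell of the last
conclusion of `c`, with `h + k` inputs, is split into two `?`-cells with `h` and `k` inputs, where
`h = 0` and `k = 0` are allowed: a `?`-cell may lose inputs when boxes are copied zero times. -/
def SplitContraction (c c' : Net) : Prop :=
  ∃ (f : Net.Hom c' c) (l : List c'.E) (a b : c'.E) (o : c.E),
    c'.label (c'.src a) = .whynot ∧ c'.label (c'.src b) = .whynot ∧
    c'.concl = l ++ [a, b] ∧ c.concl = l.map f.e ++ [o] ∧ f.e a = o ∧ f.e b = o ∧
    f.v.Surjective ∧ f.e.Surjective ∧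
    (∀ x y, f.v x = f.v y → x = y ∨ (x = c'.src a ∧ y = c'.src b) ∨
      (x = c'.src b ∧ y = c'.src a)) ∧
    (∀ x y, f.e x = f.e y → x = y ∨ (x = a ∧ y = b) ∨ (x = b ∧ y = a))

/-- `c` consists of a `!`-cell, whose output is the last conclusion, and of `?`-cells, all of them
without inputs and with their outputs as conclusions. -/
def IsEmptyBox (c : Net) : Prop :=
  (∀ e, c.tgt e = none) ∧ (∀ v, ∃ e, c.src e = v) ∧
  ∃ q o, c.concl = q ++ [o] ∧ c.label (c.src o) = .bang ∧ ∀ e ∈ q, c.label (c.src e) = .whynot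

/-- `c` is the merging of `c' 0, …, c' (n - 1)`: it consists of a `!`-cell, whose output `o` is the
last conclusion and whose `n` inputs are the last conclusions of the `c' j`, and of the `c' j`,
which are pairwise disjoint but for the `?`-cells whose outputs `q` are the other conclusions;
these `?`-cells are shared. -/
def MergeBox {n : ℕ} (c : Net) (c' : Fin n → Net) : Prop :=
  ∃ (f : ∀ j, Net.Hom (c' j) c) (q : List c.E) (o : c.E) (q' : ∀ j, List (c' j).E)
    (a : ∀ j, (c' j).E),
    c.concl = q ++ [o] ∧ c.label (c.src o) = .bang ∧ (∀ e ∈ q, c.label (c.src e) = .whynot) ∧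
    (∀ j, (c' j).concl = q' j ++ [a j] ∧ (q' j).map (f j).e = q ∧
      c.tgt ((f j).e (a j)) = some (c.src o)) ∧
    (∀ j, (f j).v.Injective) ∧ (∀ j, (f j).e.Injective) ∧
    (⋃ j, Set.range (f j).v) = {c.src o}ᶜ ∧ (⋃ j, Set.range (f j).e) = {o}ᶜ ∧
    (∀ i j, i ≠ j → ∀ x y, (f i).v x = (f j).v y → ∃ e ∈ q, c.src e = (f i).v x) ∧
    (∀ i j, i ≠ j → ∀ x y, (f i).e x = (f j).e y → (f i).e x ∈ q)

/-- The action of a rule on a component `c`, rewritten to a set `X` of lists of components. -/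
def Rule.Act {L : List Formula} {M : Sequent} (r : Rule L M) (c : Net) (X : Set ResourceQPS) :
    Prop :=
  match r with
  | .exc K _ _ _ => ∃ c', X = {[c']} ∧ Exchange K.length c c'
  | .mix _ _ _ _ => ∃ c₁ c₂, X = {[c₁, c₂]} ∧
      (Juxtapose c c₁ c₂ ∨ (IsDaimon c ∧ IsDaimon c₁ ∧ IsDaimon c₂))
  | .ax _ => X = {[]} ∧ (IsLone c .ax ∨ IsDaimon c)
  | .cut _ _ => ∃ c', X = {[c']} ∧ (RemoveCut c c' ∨ (IsDaimon c ∧ IsDaimon c'))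
  | .daimon _ _ => X = {[]} ∧ IsDaimon c
  | .one => X = {[]} ∧ (IsLone c .one ∨ IsDaimon c)
  | .bot => X = {[]} ∧ (IsLone c .bot ∨ IsDaimon c)
  | .tensor _ _ _ => ∃ c', X = {[c']} ∧ (RemoveBinary .tensor c c' ∨ (IsDaimon c ∧ IsDaimon c'))
  | .par _ _ _ => ∃ c', X = {[c']} ∧ (RemoveBinary .par c c' ∨ (IsDaimon c ∧ IsDaimon c'))
  | .contr _ _ => ∃ c', X = {[c']} ∧ (SplitContraction c c' ∨ (IsDaimon c ∧ IsDaimon c'))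
  | .der _ _ => ∃ c', X = {[c']} ∧ (RemoveDereliction c c' ∨ (IsDaimon c ∧ IsDaimon c'))
  | .weak _ => X = {[]} ∧ (IsLone c .whynot ∨ IsDaimon c)
  | .box _ _ =>
      (∃ c', X = {[c']} ∧ IsDaimon c' ∧ (IsDaimon c ∨ IsEmptyBox c)) ∨
      (∃ (n : ℕ) (c' : Fin n → Net), 0 < n ∧ MergeBox c c' ∧ X = Set.range fun j => [c' j])

/-! ## The action of paths and glueability -/

/-- The action of an elementary path `Γ ⟶ Γ'`, a relation between quasi-proof-structures of
type `Γ` and sets of quasi-proof-structures of type `Γ'`: one component is rewritten. -/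
def Elementary.Act {Γ Γ' : Sequent} (a : Elementary Γ Γ') (ρ : ResourceQPS)
    (S : Set ResourceQPS) : Prop :=
  match a with
  | .mk Δ (L := L) (M := M) r Δ' => ∃ (P : ResourceQPS) (c : Net) (Q : ResourceQPS)
      (X : Set ResourceQPS), ρ = P ++ c :: Q ∧ S = (fun x => P ++ x ++ Q) '' X ∧
      P.type = Δ ∧ c.type = L ∧ Q.type = Δ' ∧ (∀ x ∈ X, ResourceQPS.type x = M) ∧ r.Act c X

/-- The extension to sets: every element of `Φ` is rewritten, and the results are united. -/
def Elementary.SetAct {Γ Γ' : Sequent} (a : Elementary Γ Γ') (Φ Φ' : Set ResourceQPS) : Prop :=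
  ∃ F : ResourceQPS → Set ResourceQPS, (∀ ρ ∈ Φ, a.Act ρ (F ρ)) ∧ Φ' = ⋃ ρ ∈ Φ, F ρ

/-- The action of a path from `Γ` on sets of quasi-proof-structures of type `Γ`. -/
def PathAct {Γ : Sequent} : {Γ' : Sequent} → Quiver.Path Γ Γ' →
    Set ResourceQPS → Set ResourceQPS → Prop
  | _, .nil, Φ, Φ' => (∀ ρ ∈ Φ, ResourceQPS.type ρ = Γ) ∧ Φ' = Φ
  | _, .cons ξ a, Φ, Φ'' => ∃ Φ', PathAct ξ Φ Φ' ∧ Elementary.SetAct a Φ' Φ''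

/-- A set is glueable if some path rewrites it to `{ε}`. -/
def Glueable (Φ : Set ResourceQPS) : Prop :=
  ∃ (Γ : Sequent) (ξ : Quiver.Path Γ ([] : Sequent)), PathAct ξ Φ {[]}

end Glue

/-! Each elementary path is the trace of an operation on components with boxes, read backwards:
adding a cell over the root, juxtaposing two components, merging two `?`-cells, putting a box around
a component. The Taylor expansion is compatible with these operations in two ways. If `C` arises
from `C'` by an operation, then the elementary path rewrites the expansions of `C` to expansions of
`C'` (`Expansion.addCell`, `Expansion.juxtapose`, `Expansion.splitContraction`,
`Expansion.mergeBox`, `Expansion.isEmptyBox`). Moreover what is rewritten is determined up to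
isomorphism by the result, together with the types of the conclusions where these are lost
(`AddCell.iso`, `Juxtapose.iso`, `SplitContraction.iso`, `MergeBox.iso`, `IsEmptyBox.iso`). Hence a
net that is rewritten to expansions of `C'` is itself an expansion of `C`. For a box the reason is
that a thick subtree of a tree with one edge into its root amounts to a finite family of thick
subtrees of the part above that edge, one for each copy; the empty family gives the empty box.

From glueable to MELL, the path is read from `ε` backwards. Every zone on the way carries a MELL
component of its type, or `none`, which stands for a zone that contributes only nets with daimons.
`Rule.exists_zone` builds the component before a rule out of those after it. The choice depends on
the rule alone and not on the nets, so infinite sets cause no difficulty. The invariant `InZone`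
says that the daimon-free nets of the zone are expansions of its component; nets with daimons are
not constrained. Boxing a zone that carries `none` gives a box filled by a daimon, whose only
daimon-free expansion is the empty box. At the start of the path there is at most one zone and no
daimon, so the given set lies in one expansion.

From MELL to glueable, strong induction on `Net.size` shows that one path eliminates the whole zone
of a MELL component with at least one cell (`Component.IsMELL.elim`). Besides the daimon-free
expansions the zone contains all daimons: `Box` turns an empty box into a daimon while the other
members still have to be rewritten, and the daimon must follow them along the same path. The path is
dictated by the cells over the root. Cuts, binary cells at conclusions, `?`-cells with two inputs
and `?`-cells whose input lies over the root are treated first. When none of these is left, cells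
over the root have no input except from boxes (`Component.IsMELL.tgt_eq_none`), so what remains is a
juxtaposition of single cells and of single boxes with `?`-cells on their border. The pieces are
separated by `mix`, a single box is opened (`Component.IsMELL.exists_unbox`), a single cell is
deleted. Opening a box filled by a daimon leaves MELL, but then nothing but daimons is left in the
zone. -/

namespace Glue

/-! ## Trees -/

namespace BoxTree
variable (T : BoxTree)

theorem parent_root : T.parent T.root = none := (T.parent_eq_none _).2 rfl

variable {T}

theorem exists_parent {b : T.Node} (h : b ≠ T.root) : ∃ p, T.parent b = some p :=
  Option.ne_none_iff_exists'.1 fun h' => h ((T.parent_eq_none b).1 h')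

theorem ne_root_of_parent {b p : T.Node} (h : T.parent b = some p) : b ≠ T.root := by
  rintro rfl; rw [T.parent_root] at h; cases h

theorem Below.refl (b : T.Node) : T.Below b b := Relation.ReflTransGen.refl

theorem Below.trans {a b c : T.Node} (h : T.Below a b) (h' : T.Below b c) : T.Below a c :=
  Relation.ReflTransGen.trans h h'

theorem below_root (b : T.Node) : T.Below b T.root := T.reaches_root b

theorem Below.cases {a b : T.Node} (h : T.Below a b) :
    a = b ∨ ∃ p, T.parent a = some p ∧ T.Below p b :=
  Relation.ReflTransGen.cases_head h

theorem Below.eq_root {b : T.Node} (h : T.Below T.root b) : b = T.root := by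
  rcases h.cases with h | ⟨p, h, -⟩
  · exact h.symm
  · rw [T.parent_root] at h; cases h

/-- Induction along the path to the root: a loop at `a` starts with the only edge that leaves `a`,
so it can be rotated into a loop at the parent of `a`, and no edge leaves the root. -/
theorem not_transGen_self (a : T.Node) :
    ¬ Relation.TransGen (fun x y => T.parent x = some y) a a := by
  induction T.reaches_root a using Relation.ReflTransGen.head_induction_on with
  | refl =>
    intro h
    obtain ⟨b, h, -⟩ := Relation.TransGen.head'_iff.1 h
    rw [T.parent_root] at h; cases h
  | head h _ ih =>
    intro h'
    obtain ⟨b, hb, hb'⟩ := Relation.TransGen.head'_iff.1 h'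
    rw [h] at hb; cases hb
    exact ih (Relation.TransGen.tail' hb' h)

theorem not_below_of_parent {a p : T.Node} (h : T.parent a = some p) : ¬ T.Below p a :=
  fun h' => not_transGen_self a (Relation.TransGen.head' h h')

theorem Below.total {s a b : T.Node} (h : T.Below s a) (h' : T.Below s b) :
    T.Below a b ∨ T.Below b a :=
  Relation.ReflTransGen.total_of_right_unique
    (fun x y z hy hz => by rw [hy] at hz; exact Option.some.inj hz) h h'

/-- The last node before the root on the path from `x`; it names the outermost box around `x`. -/
theorem exists_child {x : T.Node} (hx : x ≠ T.root) :
    ∃ y, T.Below x y ∧ T.parent y = some T.root := by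
  induction T.reaches_root x using Relation.ReflTransGen.head_induction_on with
  | refl => exact absurd rfl hx
  | @head a c h _ ih =>
    by_cases hc : c = T.root
    · subst hc
      exact ⟨a, .refl _, h⟩
    · obtain ⟨u, hu, hu'⟩ := ih hc
      exact ⟨u, .head h hu, hu'⟩

/-- The part of a tree that lies on a set of nodes, closed downwards up to its root. -/
noncomputable def restrict (T : BoxTree) (N : T.Node → Prop) (r : T.Node) (hr : N r)
    (hN : ∀ b, N b → b ≠ r → ∃ p, T.parent b = some p ∧ N p) : BoxTree where
  Node := {b // N b}
  finite_Node := by have := T.finite_Node; infer_instance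
  root := ⟨r, hr⟩
  parent b := open Classical in
    if h : b.1 = r then none else some ⟨(hN b.1 b.2 h).choose, (hN b.1 b.2 h).choose_spec.2⟩
  parent_eq_none b := by
    split
    · rename_i h; simp [Subtype.ext_iff, h]
    · rename_i h; simp [Subtype.ext_iff, h]
  reaches_root := by
    rintro ⟨b, hb⟩
    induction T.reaches_root b using Relation.ReflTransGen.head_induction_on with
    | refl =>
      by_cases h : T.root = r
      · subst h; exact .refl
      · obtain ⟨p, hp, -⟩ := hN _ hb h
        rw [T.parent_root] at hp; cases hp
    | @head a c h _ ih =>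
      by_cases h' : a = r
      · subst h'; exact .refl
      · obtain ⟨p, hp, hp'⟩ := hN _ hb h'
        have hpc : p = c := by rw [hp] at h; exact Option.some.inj h
        subst hpc
        refine .head ?_ (ih hp')
        have hs : some p = some (hN a hb h').choose := hp.symm.trans (hN a hb h').choose_spec.1
        rw [dif_neg (show ¬ (⟨a, hb⟩ : {b // N b}).1 = r from h')]
        exact congrArg some (Subtype.ext (Option.some.inj hs).symm)

section
variable {N : T.Node → Prop} {r : T.Node} {hr : N r}
  {hN : ∀ b, N b → b ≠ r → ∃ p, T.parent b = some p ∧ N p}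

theorem restrict_parent {b p : (T.restrict N r hr hN).Node} :
    (T.restrict N r hr hN).parent b = some p ↔ b.1 ≠ r ∧ T.parent b.1 = some p.1 := by
  by_cases h : b.1 = r
  · simp [restrict, h]
  · have hs := (hN b.1 b.2 h).choose_spec.1
    have hp : (T.restrict N r hr hN).parent b =
        some ⟨(hN b.1 b.2 h).choose, (hN b.1 b.2 h).choose_spec.2⟩ := by
      simp only [restrict]
      rw [dif_neg h]
    rw [hp]
    constructor
    · intro h'
      have h'' := Option.some.inj h'
      subst h''
      exact ⟨h, hs⟩
    · rintro ⟨-, h'⟩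
      exact congrArg some (Subtype.ext (Option.some.inj (hs.symm.trans h')))

/-- Only `r` can lose its parent in the restriction. A path to `b` that goes on beyond `r` would
close a cycle, since `b` lies above `r`. -/
theorem restrict_below {a b : (T.restrict N r hr hN).Node} (hbr : T.Below b.1 r) :
    (T.restrict N r hr hN).Below a b ↔ T.Below a.1 b.1 := by
  constructor
  · intro h
    exact Relation.ReflTransGen.lift Subtype.val (fun x y h => (restrict_parent.1 h).2) _ _ h
  · obtain ⟨a, ha⟩ := a
    intro h
    dsimp only at h
    induction h using Relation.ReflTransGen.head_induction_on with
    | refl => exact .refl _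
    | @head a c h hcb ih =>
      have har : a ≠ r := by
        rintro rfl
        exact not_below_of_parent h (Below.trans hcb hbr)
      obtain ⟨p, hp, hp'⟩ := hN _ ha har
      have hpc : p = c := by rw [hp] at h; exact Option.some.inj h
      subst hpc
      exact .head (restrict_parent.2 ⟨har, hp⟩) (ih hp')

end

end BoxTree

/-! ### Thick subtrees and lifting of paths -/

namespace ThickSubtree
variable {τ : BoxTree} (t : ThickSubtree τ)

/-- The image of a parent is a parent, and the root of `τ` has none. Hence whatever lies over the
root has exactly one copy in an expansion. -/
theorem eq_root {s : t.tree.Node} (h : t.h s = τ.root) : s = t.tree.root := by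
  by_contra hs
  obtain ⟨p, hp⟩ := BoxTree.exists_parent hs
  have := t.h_parent _ _ hp
  rw [h, τ.parent_root] at this; cases this

theorem map_below {s s' : t.tree.Node} (h : t.tree.Below s s') : τ.Below (t.h s) (t.h s') :=
  Relation.ReflTransGen.lift t.h t.h_parent _ _ h

theorem eq_of_below {a b : t.tree.Node} (h : t.tree.Below a b) (hab : t.h a = t.h b) : a = b := by
  rcases h.cases with h | ⟨p, hp, h⟩
  · exact h
  · have := t.map_below h
    rw [← hab] at this
    exact absurd this (BoxTree.not_below_of_parent (t.h_parent _ _ hp))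

/-- Nodes on one descending path are comparable, and comparable nodes with the same image are equal
because `τ` has no cycle. In a pullback this makes the target of a copied edge unique. -/
theorem below_unique {s a b : t.tree.Node} (ha : t.tree.Below s a) (hb : t.tree.Below s b)
    (hab : t.h a = t.h b) : a = b := by
  rcases ha.total hb with h | h
  · exact t.eq_of_below h hab
  · exact (t.eq_of_below h hab.symm).symm

/-- A node that is not over the root has a parent, and the image of this parent is forced, so paths
lift step by step. In a pullback this provides the target of a copied edge. -/
theorem lift_below {s : t.tree.Node} {b : τ.Node} (h : τ.Below (t.h s) b) :
    ∃ s', t.tree.Below s s' ∧ t.h s' = b := by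
  generalize hs : t.h s = a at h
  induction h using Relation.ReflTransGen.head_induction_on generalizing s with
  | refl => exact ⟨s, .refl _, hs⟩
  | head h _ ih =>
    have hne : s ≠ t.tree.root := by
      rintro rfl
      rw [t.h_root] at hs
      rw [← hs, τ.parent_root] at h; cases h
    obtain ⟨p, hp⟩ := BoxTree.exists_parent hne
    have h2 := t.h_parent _ _ hp
    rw [hs, h] at h2
    obtain ⟨s', h3, h4⟩ := ih (Option.some.inj h2).symm
    exact ⟨s', .head hp h3, h4⟩

end ThickSubtree

/-! ## Transport of the typing conditions -/

theorem bijOn_pair {E E' : Type} {g : E' → E} {s : Set E'} {a b : E}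
    (h : Set.BijOn g s {a, b}) : ∃ a' b', s = {a', b'} ∧ g a' = a ∧ g b' = b := by
  obtain ⟨a', ha, rfl⟩ := h.surjOn (show a ∈ ({a, b} : Set E) by simp)
  obtain ⟨b', hb, rfl⟩ := h.surjOn (show b ∈ ({g a', b} : Set E) by simp)
  refine ⟨a', b', ?_, rfl, rfl⟩
  ext x
  constructor
  · intro hx
    rcases h.mapsTo hx with h' | h'
    · exact .inl (h.injOn hx ha h')
    · exact .inr (h.injOn hx hb h')
  · rintro (rfl | rfl) <;> assumption

theorem bijOn_singleton {E E' : Type} {g : E' → E} {s : Set E'} {a : E}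
    (h : Set.BijOn g s {a}) : ∃ a', s = {a'} ∧ g a' = a := by
  obtain ⟨a', ha, rfl⟩ := h.surjOn (show a ∈ ({a} : Set E) by simp)
  refine ⟨a', ?_, rfl⟩
  ext x
  constructor
  · intro hx
    exact h.injOn hx ha (h.mapsTo hx)
  · rintro rfl; exact ha

theorem bijOn_empty {E E' : Type} {g : E' → E} {s : Set E'}
    (h : Set.BijOn g s ∅) : s = ∅ :=
  Set.eq_empty_of_forall_notMem fun _ hx => h.mapsTo hx

/-- The conditions on `?`- and `!`-cells do not count inputs, so any map between the inputs will do
there; elsewhere a bijection is needed. This is what allows a box to be copied any number of times.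
-/
theorem CellOK.pull {E E' : Type} {typ : E → Formula} {first : E → Prop} {typ' : E' → Formula}
    {first' : E' → Prop} {t : CellType} {ins outs : Set E} {ins' outs' : Set E'}
    (g : E' → E) (htyp : ∀ e, typ' e = typ (g e)) (hout : Set.BijOn g outs' outs)
    (hin : Set.BijOn g ins' ins ∨ ((t = .whynot ∨ t = .bang) ∧ Set.MapsTo g ins' ins))
    (hf : ∀ e ∈ ins', t.IsBinary → (first' e ↔ first (g e)))
    (h : CellOK typ first t ins outs) : CellOK typ' first' t ins' outs' := by
  have hm : Set.MapsTo g ins' ins := hin.elim (fun h => h.mapsTo) (fun h => h.2)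
  cases t with
  | ax =>
    obtain ⟨rfl, a, b, X, rfl, ha, hb⟩ := h
    obtain ⟨a', b', rfl, rfl, rfl⟩ := bijOn_pair hout
    exact ⟨bijOn_empty (hin.resolve_right (by simp)), a', b', X, rfl, by rw [htyp, ha],
      by rw [htyp, hb]⟩
  | cut =>
    obtain ⟨rfl, a, b, rfl, hb⟩ := h
    obtain ⟨a', b', rfl, rfl, rfl⟩ := bijOn_pair (hin.resolve_right (by simp))
    exact ⟨bijOn_empty hout, a', b', rfl, by rw [htyp, hb, htyp]⟩
  | one =>
    obtain ⟨rfl, o, rfl, ho⟩ := h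
    obtain ⟨o', rfl, rfl⟩ := bijOn_singleton hout
    exact ⟨bijOn_empty (hin.resolve_right (by simp)), o', rfl, by rw [htyp, ho]⟩
  | bot =>
    obtain ⟨rfl, o, rfl, ho⟩ := h
    obtain ⟨o', rfl, rfl⟩ := bijOn_singleton hout
    exact ⟨bijOn_empty (hin.resolve_right (by simp)), o', rfl, by rw [htyp, ho]⟩
  | tensor =>
    obtain ⟨a, b, o, rfl, ha, hb, rfl, ho⟩ := h
    obtain ⟨o', rfl, rfl⟩ := bijOn_singleton hout
    obtain ⟨a', b', rfl, rfl, rfl⟩ := bijOn_pair (hin.resolve_right (by simp))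
    refine ⟨a', b', o', rfl, (hf _ (by simp) (.inl rfl)).2 ha, fun h => hb ?_, rfl, ?_⟩
    · exact (hf _ (by simp) (.inl rfl)).1 h
    · rw [htyp, ho, htyp, htyp]
  | par =>
    obtain ⟨a, b, o, rfl, ha, hb, rfl, ho⟩ := h
    obtain ⟨o', rfl, rfl⟩ := bijOn_singleton hout
    obtain ⟨a', b', rfl, rfl, rfl⟩ := bijOn_pair (hin.resolve_right (by simp))
    refine ⟨a', b', o', rfl, (hf _ (by simp) (.inr rfl)).2 ha, fun h => hb ?_, rfl, ?_⟩
    · exact (hf _ (by simp) (.inr rfl)).1 h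
    · rw [htyp, ho, htyp, htyp]
  | whynot =>
    obtain ⟨o, A, rfl, ho, h⟩ := h
    obtain ⟨o', rfl, rfl⟩ := bijOn_singleton hout
    exact ⟨o', A, rfl, by rw [htyp, ho], fun e he => by rw [htyp, h _ (hm he)]⟩
  | bang =>
    obtain ⟨o, A, rfl, ho, h⟩ := h
    obtain ⟨o', rfl, rfl⟩ := bijOn_singleton hout
    exact ⟨o', A, rfl, by rw [htyp, ho], fun e he => by rw [htyp, h _ (hm he)]⟩
  | daimon p =>
    obtain ⟨rfl, h⟩ := h
    refine ⟨bijOn_empty (hin.resolve_right (by simp)), ?_⟩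
    rw [← h, ← hout.image_eq, hout.injOn.ncard_image]

/-- Injectivity matters only on the outputs, because a daimon counts them; no condition counts the
inputs of a cell by cardinality. -/
theorem CellOK.push {E E' : Type} {typ : E → Formula} {first : E → Prop} {typ' : E' → Formula}
    {first' : E' → Prop} {t : CellType} {ins outs : Set E} {ins' outs' : Set E'}
    (g : E' → E) (htyp : ∀ e, typ (g e) = typ' e) (hinj : Set.InjOn g outs')
    (hout : outs = g '' outs') (hin : ins = g '' ins')
    (hf : ∀ e ∈ ins', t.IsBinary → (first (g e) ↔ first' e))
    (h : CellOK typ' first' t ins' outs') : CellOK typ first t ins outs := by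
  subst hout hin
  cases t with
  | ax =>
    obtain ⟨rfl, a, b, X, rfl, ha, hb⟩ := h
    exact ⟨by simp, g a, g b, X, by simp [Set.image_pair], by rw [htyp, ha], by rw [htyp, hb]⟩
  | cut =>
    obtain ⟨rfl, a, b, rfl, hb⟩ := h
    exact ⟨by simp, g a, g b, by simp [Set.image_pair], by rw [htyp, hb, htyp]⟩
  | one =>
    obtain ⟨rfl, o, rfl, ho⟩ := h
    exact ⟨by simp, g o, by simp, by rw [htyp, ho]⟩
  | bot =>
    obtain ⟨rfl, o, rfl, ho⟩ := h
    exact ⟨by simp, g o, by simp, by rw [htyp, ho]⟩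
  | tensor =>
    obtain ⟨a, b, o, rfl, ha, hb, rfl, ho⟩ := h
    exact ⟨g a, g b, g o, by simp [Set.image_pair], (hf _ (by simp) (.inl rfl)).2 ha,
      fun h => hb ((hf _ (by simp) (.inl rfl)).1 h), by simp, by rw [htyp, ho, htyp, htyp]⟩
  | par =>
    obtain ⟨a, b, o, rfl, ha, hb, rfl, ho⟩ := h
    exact ⟨g a, g b, g o, by simp [Set.image_pair], (hf _ (by simp) (.inr rfl)).2 ha,
      fun h => hb ((hf _ (by simp) (.inr rfl)).1 h), by simp, by rw [htyp, ho, htyp, htyp]⟩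
  | whynot =>
    obtain ⟨o, A, rfl, ho, h⟩ := h
    exact ⟨g o, A, by simp, by rw [htyp, ho], by rintro _ ⟨e, he, rfl⟩; rw [htyp, h _ he]⟩
  | bang =>
    obtain ⟨o, A, rfl, ho, h⟩ := h
    exact ⟨g o, A, by simp, by rw [htyp, ho], by rintro _ ⟨e, he, rfl⟩; rw [htyp, h _ he]⟩
  | daimon p =>
    obtain ⟨rfl, h⟩ := h
    exact ⟨by simp, by rw [← h, hinj.ncard_image]⟩

end Glue

namespace Glue

/-- It makes the two inputs of a `cut`-cell distinct edges, which `CellOK` does not demand. -/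
theorem Formula.dual_ne (A : Formula) : A.dual ≠ A := by cases A <;> simp [Formula.dual]

/-! ## Isomorphisms of nets -/

/-- The net has no daimon. -/
def Net.NoDaimon (c : Net) : Prop := ∀ v p, c.label v ≠ .daimon p

theorem Net.Hom.noDaimon {c d : Net} (f : Net.Hom c d) (h : d.NoDaimon) : c.NoDaimon :=
  fun v p hv => h (f.v v) p (by rw [f.label_v, hv])

theorem IsDaimon.not_noDaimon {c : Net} (h : IsDaimon c) : ¬ c.NoDaimon := by
  obtain ⟨p, v, -, hv, -⟩ := h
  exact fun h => h v p hv

/-- Isomorphisms of nets, respecting the order of the conclusions. -/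
def Net.Iso (c d : Net) : Prop :=
  ∃ φ : Net.Hom c d, φ.v.Bijective ∧ φ.e.Bijective ∧ d.concl = c.concl.map φ.e

theorem Net.Hom.tgt_none {c d : Net} (φ : Net.Hom c d) (hc : d.concl = c.concl.map φ.e) {x : c.E}
    (hx : c.tgt x = none) : d.tgt (φ.e x) = none := by
  rw [← d.mem_concl, hc]
  exact List.mem_map_of_mem ((c.mem_concl x).2 hx)

/-- Both targets are the quotient of `A` by the same equivalence relation. -/
theorem exists_factor {A X Y : Type} {f : A → X} {g : A → Y} (hf : f.Surjective)
    (hg : g.Surjective) (hk : ∀ a b, f a = f b ↔ g a = g b) :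
    ∃ φ : X → Y, φ.Bijective ∧ ∀ a, φ (f a) = g a := by
  have key : ∀ a, g (Function.surjInv hf (f a)) = g a :=
    fun a => (hk _ _).1 (Function.surjInv_eq hf (f a))
  refine ⟨fun x => g (Function.surjInv hf x), ⟨fun x y hxy => ?_, fun y => ?_⟩, key⟩
  · have := (hk _ _).2 hxy
    rwa [Function.surjInv_eq hf x, Function.surjInv_eq hf y] at this
  · obtain ⟨a, rfl⟩ := hg y
    exact ⟨f a, key a⟩

/-- Two nets that are covered in the same way are isomorphic. -/
theorem Net.iso_of_cover {c d : Net} {α β : Type} {fV : α → c.V} {gV : α → d.V} {fE : β → c.E}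
    {gE : β → d.E} (hfV : fV.Surjective) (hgV : gV.Surjective) (hfE : fE.Surjective)
    (hgE : gE.Surjective) (hkV : ∀ a b, fV a = fV b ↔ gV a = gV b)
    (hkE : ∀ a b, fE a = fE b ↔ gE a = gE b)
    (hlabel : ∀ a, d.label (gV a) = c.label (fV a))
    (htyp : ∀ e, d.typ (gE e) = c.typ (fE e))
    (hsrc : ∀ e a, c.src (fE e) = fV a → d.src (gE e) = gV a)
    (htgt : ∀ e a, c.tgt (fE e) = some (fV a) → d.tgt (gE e) = some (gV a))
    (hfirst : ∀ e a, c.tgt (fE e) = some (fV a) → (c.label (fV a)).IsBinary →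
      (d.first (gE e) ↔ c.first (fE e)))
    (hconcl : ∃ l : List β, c.concl = l.map fE ∧ d.concl = l.map gE) : Net.Iso c d := by
  obtain ⟨φ, hφ, hφ'⟩ := exists_factor hfV hgV hkV
  obtain ⟨ψ, hψ, hψ'⟩ := exists_factor hfE hgE hkE
  refine ⟨⟨φ, ψ, ?_, ?_, ?_, ?_, ?_⟩, hφ, hψ, ?_⟩
  · intro x
    obtain ⟨a, rfl⟩ := hfV x
    rw [hφ', hlabel]
  · intro x
    obtain ⟨a, rfl⟩ := hfE x
    rw [hψ', htyp]
  · intro x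
    obtain ⟨e, rfl⟩ := hfE x
    obtain ⟨a, ha⟩ := hfV (c.src (fE e))
    rw [hψ', ← ha, hφ', hsrc e a ha.symm]
  · intro x y hxy
    obtain ⟨e, rfl⟩ := hfE x
    obtain ⟨a, rfl⟩ := hfV y
    rw [hψ', hφ', htgt e a hxy]
  · intro x y hxy hb
    obtain ⟨e, rfl⟩ := hfE x
    obtain ⟨a, rfl⟩ := hfV y
    rw [hψ', hfirst e a hxy hb]
  · obtain ⟨l, hl, hl'⟩ := hconcl
    rw [hl, hl', List.map_map]
    exact List.map_congr_left fun e _ => (hψ' e).symm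

/-! ## Expansions -/

theorem Net.tgt_of_mem {c : Net} {e : c.E} (h : e ∈ c.concl) : c.tgt e = none := (c.mem_concl e).1 h

theorem Component.box_of_mem (C : Component) {e : C.net.E} (h : e ∈ C.net.concl) :
    C.box (C.net.src e) = C.tree.root := C.box_concl e (Net.tgt_of_mem h)

namespace Expansion
variable {C : Component} {t : ThickSubtree C.tree} {c : Net} (x : Expansion C t c)

theorem type_eq {C : Component} {t : ThickSubtree C.tree} {c : Net} (x : Expansion C t c) :
    c.type = C.net.type := by
  unfold Net.type
  rw [← x.concl_comm, List.map_map]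
  exact List.map_congr_left fun e _ => x.typ_comm e

/-- By `vertex_bij`, the cells of an expansion amount to pairs of a cell of `C` and a node over its
box. -/
theorem vertex_ext {a b : c.V} (h : x.pV a = x.pV b) (h' : x.pT a = x.pT b) : a = b :=
  (x.vertex_bij _ _ (x.comm b)).unique ⟨h, h'⟩ ⟨rfl, rfl⟩

theorem box_src (e : c.E) : C.box (C.net.src (x.pE e)) = t.h (x.pT (c.src e)) := by
  rw [x.src_comm, x.comm]

theorem edge_ext {a b : c.E} (h : x.pE a = x.pE b) (h' : x.pT (c.src a) = x.pT (c.src b)) :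
    a = b :=
  (x.edge_bij _ _ (x.box_src b)).unique ⟨h, h'⟩ ⟨rfl, rfl⟩

theorem pT_of_root {a : c.V} (h : C.box (x.pV a) = C.tree.root) : x.pT a = t.tree.root :=
  t.eq_root (by rw [← x.comm, h])

theorem pT_src_of_root {e : c.E} (h : C.box (C.net.src (x.pE e)) = C.tree.root) :
    x.pT (c.src e) = t.tree.root :=
  t.eq_root (by rw [← x.box_src, h])

theorem vertex_ext_root {a b : c.V} (h : x.pV a = x.pV b)
    (hr : C.box (x.pV b) = C.tree.root) : a = b :=
  x.vertex_ext h (by rw [x.pT_of_root hr, x.pT_of_root (by rw [h, hr])])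

theorem edge_ext_root {a b : c.E} (h : x.pE a = x.pE b)
    (hr : C.box (C.net.src (x.pE b)) = C.tree.root) : a = b :=
  x.edge_ext h (by rw [x.pT_src_of_root hr, x.pT_src_of_root (by rw [h, hr])])

theorem exists_vertex {v : C.net.V} {s : t.tree.Node} (h : C.box v = t.h s) :
    ∃ a, x.pV a = v ∧ x.pT a = s := (x.vertex_bij v s h).exists

theorem exists_root_vertex {v : C.net.V} (h : C.box v = C.tree.root) : ∃ a, x.pV a = v :=
  (x.exists_vertex (s := t.tree.root) (by rw [h, t.h_root])).imp fun _ h => h.1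

theorem exists_edge {e : C.net.E} {s : t.tree.Node} (h : C.box (C.net.src e) = t.h s) :
    ∃ a, x.pE a = e ∧ x.pT (c.src a) = s := (x.edge_bij e s h).exists

theorem exists_root_edge {e : C.net.E} (h : C.box (C.net.src e) = C.tree.root) :
    ∃ a, x.pE a = e :=
  (x.exists_edge (s := t.tree.root) (by rw [h, t.h_root])).imp fun _ h => h.1

theorem mem_of_map {l : List c.E} {e : c.E} (h : x.pE e ∈ l.map x.pE)
    (hr : C.box (C.net.src (x.pE e)) = C.tree.root) : e ∈ l := by
  obtain ⟨e', he', h'⟩ := List.mem_map.1 h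
  rwa [← x.edge_ext_root h' hr]

theorem list_ext {l l' : List c.E} (h : l.map x.pE = l'.map x.pE)
    (hr : ∀ e ∈ l'.map x.pE, C.box (C.net.src e) = C.tree.root) : l = l' := by
  induction l generalizing l' with
  | nil => cases l' with
    | nil => rfl
    | cons => cases h
  | cons a l ih => cases l' with
    | nil => cases h
    | cons b l' =>
      simp only [List.map_cons, List.cons.injEq] at h
      rw [x.edge_ext_root h.1 (hr _ (by simp)), ih h.2 fun e he => hr e (by simp [he])]

theorem tgt_some {e : c.E} {a : c.V} (h : c.tgt e = some a) :
    C.net.tgt (x.pE e) = some (x.pV a) := by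
  rw [x.tgt_comm, h]; rfl

theorem tgt_of_root {e : c.E} {a : c.V} (h : C.net.tgt (x.pE e) = some (x.pV a))
    (hr : C.box (x.pV a) = C.tree.root) : c.tgt e = some a := by
  rw [x.tgt_comm] at h
  obtain ⟨b, hb, hba⟩ := Option.map_eq_some_iff.1 h
  rw [hb, x.vertex_ext_root hba hr]

theorem tgt_none {e : c.E} : c.tgt e = none ↔ C.net.tgt (x.pE e) = none := by
  rw [x.tgt_comm, Option.map_eq_none_iff]

/-- Cells over the root are copied into every expansion, so a daimon there is never lost. This
settles boxes filled by a daimon in `elim_of_box`. -/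
theorem noDaimon_root {C : Component} {t : ThickSubtree C.tree} {c : Net} (x : Expansion C t c)
    (h : c.NoDaimon) {v : C.net.V} {p : ℕ} (hv : C.net.label v = .daimon p) :
    C.box v ≠ C.tree.root := by
  intro hr
  obtain ⟨a, rfl⟩ := x.exists_root_vertex hr
  exact h a p (by rw [x.label_comm, hv])

/-- Expansions can be transported along isomorphisms. -/
theorem of_iso {C : Component} {t : ThickSubtree C.tree} {c : Net} (x : Expansion C t c)
    {d : Net} (h : Net.Iso d c) : Nonempty (Expansion C t d) := by
  obtain ⟨φ, hv, he, hc⟩ := h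
  refine ⟨⟨x.pV ∘ φ.v, x.pE ∘ φ.e, x.pT ∘ φ.v, fun a => x.comm _, ?_, ?_, ?_, ?_, ?_, ?_, ?_, ?_,
    ?_⟩⟩
  · intro v s h
    obtain ⟨a, ⟨h1, h2⟩, -⟩ := x.vertex_bij v s h
    obtain ⟨a, rfl⟩ := hv.2 a
    refine ⟨a, ⟨h1, h2⟩, fun b hb => hv.1 (x.vertex_ext (hb.1.trans h1.symm) (hb.2.trans h2.symm))⟩
  · intro e s h
    obtain ⟨a, ⟨h1, h2⟩, -⟩ := x.edge_bij e s h
    obtain ⟨a, rfl⟩ := he.2 a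
    rw [φ.src_e] at h2
    refine ⟨a, ⟨h1, h2⟩, fun b hb => he.1 (x.edge_ext (hb.1.trans h1.symm) ?_)⟩
    rw [φ.src_e, φ.src_e]
    exact hb.2.trans h2.symm
  · intro a
    simp [x.src_comm, φ.src_e]
  · intro a
    simp only [Function.comp]
    rw [x.tgt_comm]
    rcases h : d.tgt a with _ | b
    · rw [φ.tgt_none hc h]; rfl
    · rw [φ.tgt_e _ _ h]; rfl
  · intro a b h
    have := x.tgt_below _ _ (φ.tgt_e _ _ h)
    rwa [φ.src_e] at this
  · intro a
    simp [← x.label_comm, φ.label_v]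
  · intro a
    simp [← x.typ_comm, φ.typ_e]
  · rw [← List.map_map, ← hc, x.concl_comm]
  · intro a b h hb
    rw [Function.comp, ← x.first_comm _ _ (φ.tgt_e _ _ h) (by rwa [φ.label_v]), φ.first_e _ _ h hb]

/-- Functoriality of expansions. -/
theorem lift {C' : Component} {t' : ThickSubtree C'.tree} {c' : Net} (x' : Expansion C' t' c')
    (F : Net.Hom C'.net C.net) (J : C'.net.V → t'.tree.Node → t.tree.Node)
    (hJ : ∀ v s, C'.box v = t'.h s → C.box (F.v v) = t.h (J v s))
    (hJ' : ∀ e v s s', C'.net.tgt e = some v → C'.box (C'.net.src e) = t'.h s → C'.box v = t'.h s' →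
      t'.tree.Below s s' → t.tree.Below (J (C'.net.src e) s) (J v s')) :
    ∃ f : Net.Hom c' c, (∀ a, x.pV (f.v a) = F.v (x'.pV a)) ∧
      (∀ a, x.pT (f.v a) = J (x'.pV a) (x'.pT a)) ∧ ∀ e, x.pE (f.e e) = F.e (x'.pE e) := by
  choose v hv hv' using fun a => x.exists_vertex (hJ (x'.pV a) (x'.pT a) (x'.comm a))
  choose e he he' using fun a => x.exists_edge (e := F.e (x'.pE a))
    (s := J (C'.net.src (x'.pE a)) (x'.pT (c'.src a)))
    (by rw [F.src_e, hJ _ _ (x'.box_src a)])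
  have hsrc : ∀ a, c.src (e a) = v (c'.src a) := by
    intro a
    apply x.vertex_ext
    · rw [← x.src_comm, he, F.src_e, hv, x'.src_comm]
    · rw [he', hv', x'.src_comm]
  refine ⟨⟨v, e, ?_, ?_, hsrc, ?_, ?_⟩, hv, hv', he⟩
  · intro a
    rw [x.label_comm, hv, F.label_v, x'.label_comm]
  · intro a
    rw [x.typ_comm, he, F.typ_e, x'.typ_comm]
  · intro a b hab
    have h1 := F.tgt_e _ _ (x'.tgt_some hab)
    rw [← he, x.tgt_comm] at h1
    obtain ⟨z, hz, hz'⟩ := Option.map_eq_some_iff.1 h1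
    rw [hz]
    congr 1
    apply x.vertex_ext
    · rw [hz', hv]
    -- Both candidates for the node of the target lie below the node of the source and over the same
    -- node of `C`.
    · apply t.below_unique (x.tgt_below _ _ hz)
      · rw [he', hv']
        exact hJ' _ _ _ _ (x'.tgt_some hab) (x'.box_src a) (x'.comm b) (x'.tgt_below _ _ hab)
      · rw [← x.comm, ← x.comm, hz', hv]
  · intro a b hab hb
    have h1 := F.tgt_e _ _ (x'.tgt_some hab)
    rw [← he, x.tgt_comm] at h1
    obtain ⟨z, hz, hz'⟩ := Option.map_eq_some_iff.1 h1
    rw [x.first_comm _ _ hz, he, x'.first_comm _ _ hab hb, F.first_e _ _ (x'.tgt_some hab)]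
    · rwa [← x'.label_comm]
    · rwa [x.label_comm, hz', F.label_v, ← x'.label_comm]

end Expansion

/-- The pullback of the box-function exists. -/
theorem exists_expansion (C : Component) (t : ThickSubtree C.tree) :
    ∃ c, Nonempty (Expansion C t c) := by
  -- The target of a copy `(e, s)` is found by going down from `s` to the node over the box of the
  -- target of `e`.
  have key : ∀ p : {p : C.net.E × t.tree.Node // C.box (C.net.src p.1) = t.h p.2},
      ∃ o : Option {p : C.net.V × t.tree.Node // C.box p.1 = t.h p.2},
        C.net.tgt p.1.1 = o.map (fun q => q.1.1) ∧ ∀ q, o = some q → t.tree.Below p.1.2 q.1.2 := by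
    rintro ⟨⟨e, s⟩, hs⟩
    rcases h : C.net.tgt e with _ | v
    · exact ⟨none, rfl, by simp⟩
    · have hb := C.box_edge e v h
      rw [hs] at hb
      obtain ⟨s', h1, h2⟩ := t.lift_below hb
      exact ⟨some ⟨(v, s'), h2.symm⟩, rfl, by rintro _ ⟨⟩; exact h1⟩
  choose tgt htgt htgt' using key
  have hroot : ∀ e ∈ C.net.concl, C.box (C.net.src e) = t.h t.tree.root := fun e he => by
    rw [C.box_of_mem he, t.h_root]
  refine ⟨⟨{p : C.net.V × t.tree.Node // C.box p.1 = t.h p.2},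
    {p : C.net.E × t.tree.Node // C.box (C.net.src p.1) = t.h p.2}, ?_, ?_,
    fun p => C.net.label p.1.1, fun p => C.net.typ p.1.1,
    fun p => ⟨(C.net.src p.1.1, p.1.2), p.2⟩, tgt, fun p => C.net.first p.1.1,
    C.net.concl.pmap (fun e he => ⟨(e, t.tree.root), he⟩) hroot, ?_, ?_, ?_⟩,
    ⟨⟨fun p => p.1.1, fun p => p.1.1, fun p => p.1.2, fun p => p.2, ?_, ?_, fun p => rfl, htgt,
      htgt', fun p => rfl, fun p => rfl, ?_, fun p q _ _ => Iff.rfl⟩⟩⟩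
  · have := C.net.finite_V; have := t.tree.finite_Node; infer_instance
  · have := C.net.finite_E; have := t.tree.finite_Node; infer_instance
  · exact C.net.concl_nodup.pmap (by simp)
  · rintro ⟨⟨e, s⟩, hs⟩
    have h1 := htgt ⟨⟨e, s⟩, hs⟩
    rw [← Option.map_eq_none_iff, ← h1, ← C.net.mem_concl]
    simp only [List.mem_pmap, Subtype.mk.injEq, Prod.mk.injEq]
    constructor
    · rintro ⟨a, ha, rfl, rfl⟩; exact ha
    · intro he
      refine ⟨e, he, rfl, ?_⟩
      exact (t.eq_root (by rw [← hs, C.box_of_mem he])).symm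
  · rintro ⟨⟨v, s⟩, hs⟩
    refine (C.net.cell_ok v).pull (fun p => p.1.1) (fun _ => rfl) ⟨?_, ?_, ?_⟩ ?_ (fun _ _ _ => Iff.rfl)
    · rintro p hp
      exact congrArg (fun q => q.1.1) hp
    · rintro ⟨p, hp⟩ h1 ⟨q, hq⟩ h2 h
      have h3 := congrArg (fun q => q.1.2) (h1.trans h2.symm)
      exact Subtype.ext (Prod.ext h h3)
    · rintro e rfl
      exact ⟨⟨(e, s), hs⟩, rfl, rfl⟩
    · have hm : Set.MapsTo (fun p => p.1.1) {e | tgt e = some ⟨(v, s), hs⟩}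
          {e | C.net.tgt e = some v} := by
        intro p hp
        have := htgt p
        rw [hp] at this
        exact this
      -- Only `?`- and `!`-cells may have inputs from other boxes, and for these it is enough that
      -- copies of inputs lie over inputs. For any other cell the inputs have the node of the cell
      -- itself, and the correspondence is bijective.
      by_cases hl : C.net.label v = .whynot ∨ C.net.label v = .bang
      · exact .inr ⟨hl, hm⟩
      · have hbox : ∀ e, C.net.tgt e = some v → C.box (C.net.src e) = C.box v := by
          intro e he
          by_contra h
          exact hl (C.box_border e v he h).symm
        have hnode : ∀ p, tgt p = some ⟨(v, s), hs⟩ → p.1.2 = s := by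
          intro p hp
          apply t.eq_of_below (htgt' _ _ hp)
          rw [← p.2, ← hs, hbox _ (hm hp)]
        refine .inl ⟨hm, ?_, ?_⟩
        · rintro p h1 q h2 h
          exact Subtype.ext (Prod.ext h ((hnode _ h1).trans (hnode _ h2).symm))
        · intro e he
          have hes : C.box (C.net.src e) = t.h s := (hbox e he).trans hs
          refine ⟨⟨(e, s), hes⟩, ?_, rfl⟩
          have h1 := htgt ⟨(e, s), hes⟩
          have h2 : C.net.tgt e = some v := he
          rw [h2] at h1
          obtain ⟨⟨⟨v', s'⟩, hv'⟩, h3, h4⟩ := Option.map_eq_some_iff.1 h1.symm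
          dsimp only at h4
          subst h4
          have h5 := t.eq_of_below (htgt' _ _ h3) (by rw [← hes, ← hv', hbox e he])
          dsimp only at h5
          subst h5
          exact h3
  · intro v s h
    exact ⟨⟨(v, s), h⟩, ⟨rfl, rfl⟩, fun p hp => Subtype.ext (Prod.ext hp.1 hp.2)⟩
  · intro v s h
    exact ⟨⟨(v, s), h⟩, ⟨rfl, rfl⟩, fun p hp => Subtype.ext (Prod.ext hp.1 hp.2)⟩
  · rw [List.map_pmap]
    simp

end Glue

namespace Glue

/-! ## Adding a cell below the last conclusions -/

theorem Net.nodup_of_append {c : Net} {l l' : List c.E} (h : c.concl = l ++ l') :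
    l.Nodup ∧ l'.Nodup ∧ l.Disjoint l' := by
  have := c.concl_nodup
  rw [h] at this
  exact List.nodup_append'.1 this

/-- `c` is `c'` with a new cell of type `t`, whose inputs are the last conclusions `as` of `c'` and
whose outputs are the last conclusions `os` of `c`. -/
structure AddCell (t : CellType) (c c' : Net) where
  f : Net.Hom c' c
  w : c.V
  l : List c'.E
  as : List c'.E
  os : List c.E
  label_w : c.label w = t
  inj_v : f.v.Injective
  range_v : Set.range f.v = {w}ᶜ
  inj_e : f.e.Injective
  range_e : Set.range f.e = {e | c.src e ≠ w}
  concl' : c'.concl = l ++ as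
  concl : c.concl = l.map f.e ++ os
  tgt_as : ∀ a ∈ as, c.tgt (f.e a) = some w
  mem_os : ∀ e, e ∈ os ↔ c.src e = w
  first : t.IsBinary → ∃ a b, as = [a, b] ∧ c.first (f.e a) ∧ ¬ c.first (f.e b)

namespace AddCell
variable {t : CellType} {c c' : Net} (D : AddCell t c c')

theorem f_ne_w (v : c'.V) : D.f.v v ≠ D.w := by
  have : D.f.v v ∈ Set.range D.f.v := ⟨v, rfl⟩
  rwa [D.range_v] at this

theorem eq_or (v : c.V) : v = D.w ∨ ∃ v', D.f.v v' = v := by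
  by_cases h : v = D.w
  · exact .inl h
  · exact .inr (by rwa [← Set.mem_range, D.range_v])

theorem src_ne_w (e : c'.E) : c.src (D.f.e e) ≠ D.w := by
  have : D.f.e e ∈ Set.range D.f.e := ⟨e, rfl⟩
  rwa [D.range_e] at this

theorem eq_or_e (e : c.E) : e ∈ D.os ∨ ∃ e', D.f.e e' = e := by
  by_cases h : c.src e = D.w
  · exact .inl ((D.mem_os e).2 h)
  · exact .inr (by rwa [← Set.mem_range, D.range_e])

theorem not_mem_os (e : c'.E) : D.f.e e ∉ D.os := fun h => D.src_ne_w e ((D.mem_os _).1 h)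

theorem tgt_os {e : c.E} (h : e ∈ D.os) : c.tgt e = none :=
  Net.tgt_of_mem (by rw [D.concl]; exact List.mem_append_right _ h)

theorem tgt_l {e : c'.E} (h : e ∈ D.l) : c.tgt (D.f.e e) = none :=
  Net.tgt_of_mem (by rw [D.concl]; exact List.mem_append_left _ (List.mem_map_of_mem h))

/-- The targets of the old edges. -/
theorem tgt_cases (e : c'.E) : (∃ u, c'.tgt e = some u ∧ c.tgt (D.f.e e) = some (D.f.v u)) ∨
    (e ∈ D.as ∧ c.tgt (D.f.e e) = some D.w) ∨ (e ∈ D.l ∧ c.tgt (D.f.e e) = none) := by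
  rcases h : c'.tgt e with _ | u
  · rw [← c'.mem_concl, D.concl', List.mem_append] at h
    rcases h with h | h
    · exact .inr (.inr ⟨h, D.tgt_l h⟩)
    · exact .inr (.inl ⟨h, D.tgt_as _ h⟩)
  · exact .inl ⟨u, rfl, D.f.tgt_e _ _ h⟩

theorem tgt_eq_w {e : c.E} (h : c.tgt e = some D.w) : ∃ a ∈ D.as, D.f.e a = e := by
  rcases D.eq_or_e e with h' | ⟨e, rfl⟩
  · rw [D.tgt_os h'] at h; cases h
  · rcases D.tgt_cases e with ⟨u, -, h'⟩ | ⟨h', -⟩ | ⟨-, h'⟩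
    · rw [h'] at h; exact absurd (Option.some.inj h) (D.f_ne_w u)
    · exact ⟨e, h', rfl⟩
    · rw [h'] at h; cases h

theorem tgt_eq_f {e : c.E} {v : c'.V} (h : c.tgt e = some (D.f.v v)) :
    ∃ e', D.f.e e' = e ∧ c'.tgt e' = some v := by
  rcases D.eq_or_e e with h' | ⟨e, rfl⟩
  · rw [D.tgt_os h'] at h; cases h
  · rcases D.tgt_cases e with ⟨u, hu, h'⟩ | ⟨-, h'⟩ | ⟨-, h'⟩
    · rw [h'] at h
      rw [D.inj_v (Option.some.inj h)] at hu
      exact ⟨e, rfl, hu⟩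
    · rw [h'] at h; exact absurd (Option.some.inj h).symm (D.f_ne_w v)
    · rw [h'] at h; cases h

/-- The new net is determined by the old one and by the types of the new conclusions. -/
theorem iso {d : Net} (D' : AddCell t d c') (has : D.as.length = D'.as.length)
    (hos : D.os.map c.typ = D'.os.map d.typ) : Net.Iso c d := by
  have hl : D.l = D'.l ∧ D.as = D'.as := List.append_inj' (D.concl'.symm.trans D'.concl') has
  have hlen : D.os.length = D'.os.length := by simpa using congrArg List.length hos
  have hnd := (Net.nodup_of_append D.concl).2.1
  have hnd' := (Net.nodup_of_append D'.concl).2.1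
  -- Both nets are covered by `c'` together with one point for the new cell and one index for each
  -- of its outputs.
  let fV : Option c'.V → c.V := fun o => o.elim D.w D.f.v
  let gV : Option c'.V → d.V := fun o => o.elim D'.w D'.f.v
  let fE : c'.E ⊕ Fin D.os.length → c.E := Sum.elim D.f.e fun i => D.os[i]
  let gE : c'.E ⊕ Fin D.os.length → d.E := Sum.elim D'.f.e fun i => D'.os[i]
  refine Net.iso_of_cover (fV := fV) (gV := gV) (fE := fE) (gE := gE) ?_ ?_ ?_ ?_ ?_ ?_ ?_ ?_ ?_ ?_
    ?_ ?_
  · intro v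
    rcases D.eq_or v with rfl | ⟨v, rfl⟩
    · exact ⟨none, rfl⟩
    · exact ⟨some v, rfl⟩
  · intro v
    rcases D'.eq_or v with rfl | ⟨v, rfl⟩
    · exact ⟨none, rfl⟩
    · exact ⟨some v, rfl⟩
  · intro e
    rcases D.eq_or_e e with h | ⟨v, rfl⟩
    · obtain ⟨i, hi, rfl⟩ := List.mem_iff_getElem.1 h
      exact ⟨.inr ⟨i, hi⟩, rfl⟩
    · exact ⟨.inl v, rfl⟩
  · intro e
    rcases D'.eq_or_e e with h | ⟨v, rfl⟩
    · obtain ⟨i, hi, rfl⟩ := List.mem_iff_getElem.1 h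
      exact ⟨.inr ⟨i, hlen ▸ hi⟩, rfl⟩
    · exact ⟨.inl v, rfl⟩
  · rintro (_ | a) (_ | b)
    · simp [fV, gV]
    · simp [fV, gV, (D.f_ne_w b).symm, (D'.f_ne_w b).symm]
    · simp [fV, gV, D.f_ne_w a, D'.f_ne_w a]
    · simp [fV, gV, D.inj_v.eq_iff, D'.inj_v.eq_iff]
  · rintro (a | a) (b | b)
    · simp [fE, gE, D.inj_e.eq_iff, D'.inj_e.eq_iff]
    · simp only [fE, gE, Sum.elim_inl, Sum.elim_inr]
      constructor <;> intro h
      · exact absurd (h ▸ List.getElem_mem _) (D.not_mem_os a)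
      · exact absurd (h ▸ List.getElem_mem _) (D'.not_mem_os a)
    · simp only [fE, gE, Sum.elim_inl, Sum.elim_inr]
      constructor <;> intro h
      · exact absurd (h ▸ List.getElem_mem _) (D.not_mem_os b)
      · exact absurd (h ▸ List.getElem_mem _) (D'.not_mem_os b)
    · simp only [fE, gE, Sum.elim_inr, Fin.getElem_fin]
      rw [hnd.getElem_inj_iff, hnd'.getElem_inj_iff]
  · rintro (_ | a)
    · simp [fV, gV, D.label_w, D'.label_w]
    · simp [fV, gV, D.f.label_v, D'.f.label_v]
  · rintro (e | ⟨i, hi⟩)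
    · simp [fE, gE, D.f.typ_e, D'.f.typ_e]
    · have := List.getElem_of_eq hos (i := i) (by simpa using hi)
      simpa [fE, gE] using this.symm
  · rintro (e | i) (_ | a)
    · intro h; exact absurd h (D.src_ne_w e)
    · simp only [fE, gE, fV, gV, Sum.elim_inl, Option.elim_some]
      rw [D.f.src_e, D'.f.src_e]
      intro h; rw [D.inj_v h]
    · intro _
      exact (D'.mem_os _).1 (List.getElem_mem _)
    · intro h
      exact absurd (((D.mem_os _).1 (List.getElem_mem _)).symm.trans h).symm (D.f_ne_w a)
  · rintro (e | i) (_ | a)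
    · intro h
      obtain ⟨b, hb, hbe⟩ := D.tgt_eq_w h
      rw [D.inj_e hbe, hl.2] at hb
      exact D'.tgt_as _ hb
    · intro h
      obtain ⟨b, hbe, hb⟩ := D.tgt_eq_f h
      rw [D.inj_e hbe] at hb
      exact D'.f.tgt_e _ _ hb
    · intro h
      have := D.tgt_os (List.getElem_mem i.2)
      exact absurd (this.symm.trans h) (by simp)
    · intro h
      have := D.tgt_os (List.getElem_mem i.2)
      exact absurd (this.symm.trans h) (by simp)
  · rintro (e | i) (_ | a)
    · intro h hb
      obtain ⟨x, hx, hxe⟩ := D.tgt_eq_w h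
      rw [D.inj_e hxe] at hx
      rw [show fV none = D.w from rfl, D.label_w] at hb
      obtain ⟨y, z, h1, h2, h3⟩ := D.first hb
      obtain ⟨y', z', h1', h2', h3'⟩ := D'.first hb
      have h4 := h1.symm.trans (hl.2.trans h1')
      simp only [List.cons.injEq, and_true] at h4
      obtain ⟨rfl, rfl⟩ := h4
      rw [h1] at hx
      simp only [List.mem_cons, List.not_mem_nil, or_false] at hx
      rcases hx with rfl | rfl
      · exact iff_of_true h2' h2
      · exact iff_of_false h3' h3
    · intro h hb
      obtain ⟨b, hbe, hb'⟩ := D.tgt_eq_f h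
      rw [D.inj_e hbe] at hb'
      have hbin : (c'.label a).IsBinary := by rwa [← D.f.label_v]
      exact (D'.f.first_e _ _ hb' hbin).trans (D.f.first_e _ _ hb' hbin).symm
    · intro h
      have := D.tgt_os (List.getElem_mem i.2)
      exact absurd (this.symm.trans h) (by simp)
    · intro h
      have := D.tgt_os (List.getElem_mem i.2)
      exact absurd (this.symm.trans h) (by simp)
  · refine ⟨D.l.map .inl ++ (List.finRange D.os.length).map .inr, ?_, ?_⟩
    · rw [D.concl, List.map_append, List.map_map, List.map_map]
      congr 1
      apply List.ext_getElem <;> simp [fE]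
    · rw [D'.concl, List.map_append, List.map_map, List.map_map, hl.1]
      congr 1
      apply List.ext_getElem <;> simp [gE, hlen]

end AddCell

/-- Expansions preserve the addition of a cell at the root. -/
theorem Expansion.addCell {C C' : Component} {t : ThickSubtree C.tree} {t' : ThickSubtree C'.tree}
    {c c' : Net} (x : Expansion C t c) (x' : Expansion C' t' c') {ℓ : CellType}
    (D : AddCell ℓ C.net C'.net) (J : t'.tree.Node → t.tree.Node) (hJ : J.Bijective)
    (hbox : ∀ v s, C'.box v = t'.h s ↔ C.box (D.f.v v) = t.h (J s))
    (hbelow : ∀ s s', t'.tree.Below s s' → t.tree.Below (J s) (J s'))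
    (hw : C.box D.w = C.tree.root) :
    ∃ D' : AddCell ℓ c c', D'.as.map x'.pE = D.as ∧ D'.os.map x.pE = D.os := by
  obtain ⟨f, hfv, hft, hfe⟩ := x.lift x' D.f (fun _ s => J s) (fun v s h => (hbox v s).1 h)
    (fun _ _ s s' _ _ _ h => hbelow s s' h)
  obtain ⟨w, hww⟩ := x.exists_root_vertex hw
  -- The new cell is over the root, so it has a single copy.
  have hw' : ∀ v, x.pV v = D.w → v = w := fun v hv =>
    x.vertex_ext_root (hv.trans hww.symm) (by rw [hww, hw])
  have hsrcw : ∀ e, D.w = C.net.src (x.pE e) ↔ c.src e = w := fun e => by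
    rw [x.src_comm]
    exact ⟨fun h => hw' _ h.symm, fun h => by rw [h, hww]⟩
  have hc' := x'.concl_comm
  rw [D.concl', List.map_eq_append_iff] at hc'
  obtain ⟨l, as, hc', hl, has⟩ := hc'
  have hc := x.concl_comm
  rw [D.concl, List.map_eq_append_iff] at hc
  obtain ⟨l₂, os, hc, hl₂, hos⟩ := hc
  have hl₂' : l₂ = l.map f.e := by
    refine x.list_ext ?_ ?_
    · rw [hl₂, ← hl, List.map_map, List.map_map]
      exact List.map_congr_left fun e _ => (hfe e).symm
    · intro e he
      rw [List.map_map] at he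
      obtain ⟨y, hy, rfl⟩ := List.mem_map.1 he
      apply C.box_of_mem
      rw [D.concl]
      refine List.mem_append_left _ ?_
      rw [Function.comp, hfe, ← hl]
      exact List.mem_map_of_mem (List.mem_map_of_mem hy)
  subst hl₂'
  have htas : ∀ a ∈ as, c.tgt (f.e a) = some w := by
    intro a ha
    apply x.tgt_of_root
    · rw [hfe, hww]
      exact D.tgt_as _ (has ▸ List.mem_map_of_mem ha)
    · rw [hww, hw]
  refine ⟨⟨f, w, l, as, os, ?_, ?_, ?_, ?_, ?_, hc', hc, htas, ?_, ?_⟩, has, hos⟩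
  · rw [x.label_comm, hww, D.label_w]
  · intro a b hab
    refine x'.vertex_ext (D.inj_v ?_) (hJ.1 ?_)
    · rw [← hfv, hab, hfv]
    · rw [← hft, hab, hft]
  · ext v
    constructor
    · rintro ⟨a, rfl⟩ h
      have := hfv a
      rw [show f.v a = w from h, hww] at this
      exact D.f_ne_w _ this.symm
    · intro h
      rcases D.eq_or (x.pV v) with h' | ⟨v', hv'⟩
      · exact absurd (hw' v h') h
      · obtain ⟨s, hs⟩ := hJ.2 (x.pT v)
        have := x.comm v
        rw [← hv', ← hs, ← hbox] at this
        obtain ⟨a, ha, ha'⟩ := x'.exists_vertex this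
        exact ⟨a, x.vertex_ext (by rw [hfv, ha, hv']) (by rw [hft, ha', hs])⟩
  · intro a b hab
    refine x'.edge_ext (D.inj_e ?_) (hJ.1 ?_)
    · rw [← hfe, hab, hfe]
    · rw [← hft, ← hft, ← f.src_e, hab, f.src_e]
  · ext e
    constructor
    · rintro ⟨a, rfl⟩ h
      have := (hsrcw _).2 h
      rw [hfe] at this
      exact D.src_ne_w _ this.symm
    · intro h
      rcases D.eq_or_e (x.pE e) with h' | ⟨e', he'⟩
      · exact absurd ((hsrcw e).1 ((D.mem_os _).1 h').symm) h
      · obtain ⟨s, hs⟩ := hJ.2 (x.pT (c.src e))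
        have := x.box_src e
        rw [← he', ← hs, D.f.src_e, ← hbox] at this
        obtain ⟨a, ha, ha'⟩ := x'.exists_edge this
        exact ⟨a, x.edge_ext (by rw [hfe, ha, he']) (by rw [f.src_e, hft, ha', hs])⟩
  · intro e
    rw [← hsrcw, eq_comm, ← D.mem_os, ← hos]
    refine ⟨fun h => List.mem_map_of_mem h, fun h => x.mem_of_map h ?_⟩
    rw [hos] at h
    rw [(D.mem_os _).1 h, hw]
  · intro hb
    obtain ⟨a, b, h1, h2, h3⟩ := D.first hb
    rw [h1] at has
    rcases as with _ | ⟨a', _ | ⟨b', _ | ⟨_, _⟩⟩⟩ <;> simp at has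
    have hbin : (c.label w).IsBinary := by rwa [x.label_comm, hww, D.label_w]
    refine ⟨a', b', rfl, ?_, ?_⟩
    · rwa [x.first_comm _ _ (htas a' (by simp)) hbin, hfe, has.1]
    · rwa [x.first_comm _ _ (htas b' (by simp)) hbin, hfe, has.2]

end Glue

namespace Glue

/-! ## Exchanges -/

/-- The same net, with its conclusions in another order. -/
def Net.withConcl (c : Net) (l : List c.E) (h : l.Perm c.concl) : Net :=
  { c with concl := l, concl_nodup := h.nodup_iff.2 c.concl_nodup,
           mem_concl := fun e => h.mem_iff.trans (c.mem_concl e) }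

/-- The same component, with its conclusions in another order. -/
def Component.withConcl (C : Component) (l : List C.net.E) (h : l.Perm C.net.concl) : Component :=
  { C with net := C.net.withConcl l h }

theorem Component.IsMELL.withConcl {C : Component} (hC : C.IsMELL) (l : List C.net.E)
    (h : l.Perm C.net.concl) : (C.withConcl l h).IsMELL := hC

theorem Expansion.withConcl {C : Component} {t : ThickSubtree C.tree} {c : Net}
    (x : Expansion C t c) (l : List c.E) (h : l.Perm c.concl) (L : List C.net.E)
    (h' : L.Perm C.net.concl) (hl : l.map x.pE = L) :
    Nonempty (Expansion (C.withConcl L h') t (c.withConcl l h)) :=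
  ⟨⟨x.pV, x.pE, x.pT, x.comm, x.vertex_bij, x.edge_bij, x.src_comm, x.tgt_comm, x.tgt_below,
    x.label_comm, x.typ_comm, hl, x.first_comm⟩⟩

theorem perm_swap {α : Type} (l : List α) (x y : α) (l' : List α) :
    (l ++ y :: x :: l').Perm (l ++ x :: y :: l') :=
  List.Perm.append_left l (List.Perm.swap x y l')

theorem Net.exchange_withConcl (c : Net) {l l' : List c.E} {x y : c.E}
    (hc : c.concl = l ++ x :: y :: l') :
    Exchange l.length c (c.withConcl (l ++ y :: x :: l') (hc ▸ perm_swap l x y l')) :=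
  ⟨⟨id, id, fun _ => rfl, fun _ => rfl, fun _ => rfl, fun _ _ h => h, fun _ _ _ _ => Iff.rfl⟩,
    Function.bijective_id, Function.bijective_id, l, x, y, l', rfl, rfl, by
      change c.concl = l.map id ++ x :: y :: l'.map id
      simpa using hc⟩

theorem Exchange.iso {n : ℕ} {c c' : Net} (h : Exchange n c c') :
    ∃ l x y l', l.length = n ∧ ∃ hc : c'.concl = l ++ y :: x :: l',
      Net.Iso (c'.withConcl (l ++ x :: y :: l') (hc ▸ perm_swap l y x l')) c := by
  obtain ⟨f, hv, he, l, x, y, l', hn, hc', hc⟩ := h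
  exact ⟨l, x, y, l', hn, hc', ⟨f.v, f.e, f.label_v, f.typ_e, f.src_e, f.tgt_e, f.first_e⟩, hv, he,
    by simpa [Net.withConcl] using hc⟩

theorem Net.Iso.symm {c d : Net} (h : Net.Iso c d) : Net.Iso d c := by
  obtain ⟨φ, hv, he, hc⟩ := h
  refine Net.iso_of_cover (fV := φ.v) (gV := id) (fE := φ.e) (gE := id) hv.2
    Function.surjective_id he.2 Function.surjective_id (fun a b => hv.1.eq_iff)
    (fun a b => he.1.eq_iff) (fun a => (φ.label_v a).symm) (fun e => (φ.typ_e e).symm) ?_ ?_ ?_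
    ⟨c.concl, hc, by simp⟩
  · intro e a h
    rw [φ.src_e] at h
    exact hv.1 h
  · intro e a h
    rcases h' : c.tgt e with _ | u
    · rw [φ.tgt_none hc h'] at h; cases h
    · rw [φ.tgt_e _ _ h'] at h
      simp [h', hv.1 (Option.some.inj h)]
  · intro e a h hb
    rcases h' : c.tgt e with _ | u
    · rw [φ.tgt_none hc h'] at h; cases h
    · rw [φ.tgt_e _ _ h'] at h
      refine (φ.first_e _ _ h' ?_).symm
      rw [← φ.label_v]
      rwa [← Option.some.inj h] at hb

/-! ## Juxtaposition -/

/-- Both nets are in bijection with the disjoint union. No edge can run from one summand to the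
other, because a conclusion of a summand remains a conclusion. -/
theorem Juxtapose.iso {c d c₁ c₂ : Net} (h : Juxtapose c c₁ c₂) (h' : Juxtapose d c₁ c₂) :
    Net.Iso c d := by
  obtain ⟨f, g, hv, he, hc⟩ := h
  obtain ⟨f', g', hv', he', hc'⟩ := h'
  have tgt_cases : ∀ (e : c₁.E ⊕ c₂.E) (a : c₁.V ⊕ c₂.V),
      c.tgt (Sum.elim f.e g.e e) = some (Sum.elim f.v g.v a) →
      (∃ e₁ a₁, e = .inl e₁ ∧ a = .inl a₁ ∧ c₁.tgt e₁ = some a₁) ∨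
      (∃ e₂ a₂, e = .inr e₂ ∧ a = .inr a₂ ∧ c₂.tgt e₂ = some a₂) := by
    rintro (e | e) a h
    · rcases h1 : c₁.tgt e with _ | u
      · have := Net.tgt_of_mem (c := c) (e := f.e e) (by
          rw [hc]
          exact List.mem_append_left _ (List.mem_map_of_mem ((c₁.mem_concl e).2 h1)))
        rw [Sum.elim_inl, this] at h; cases h
      · rw [Sum.elim_inl, f.tgt_e _ _ h1] at h
        exact .inl ⟨e, u, rfl, (hv.1 (a₁ := .inl u) (Option.some.inj h)).symm, h1⟩
    · rcases h1 : c₂.tgt e with _ | u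
      · have := Net.tgt_of_mem (c := c) (e := g.e e) (by
          rw [hc]
          exact List.mem_append_right _ (List.mem_map_of_mem ((c₂.mem_concl e).2 h1)))
        rw [Sum.elim_inr, this] at h; cases h
      · rw [Sum.elim_inr, g.tgt_e _ _ h1] at h
        exact .inr ⟨e, u, rfl, (hv.1 (a₁ := .inr u) (Option.some.inj h)).symm, h1⟩
  refine Net.iso_of_cover hv.2 hv'.2 he.2 he'.2 (fun a b => by rw [hv.1.eq_iff, hv'.1.eq_iff])
    (fun a b => by rw [he.1.eq_iff, he'.1.eq_iff]) ?_ ?_ ?_ ?_ ?_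
    ⟨c₁.concl.map .inl ++ c₂.concl.map .inr, ?_, ?_⟩
  · rintro (a | a)
    · simp [f.label_v, f'.label_v]
    · simp [g.label_v, g'.label_v]
  · rintro (a | a)
    · simp [f.typ_e, f'.typ_e]
    · simp [g.typ_e, g'.typ_e]
  · rintro (e | e) a h
    · rw [Sum.elim_inl, f.src_e] at h
      rw [← hv.1 (a₁ := .inl (c₁.src e)) h, Sum.elim_inl, Sum.elim_inl, f'.src_e]
    · rw [Sum.elim_inr, g.src_e] at h
      rw [← hv.1 (a₁ := .inr (c₂.src e)) h, Sum.elim_inr, Sum.elim_inr, g'.src_e]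
  · intro e a h
    rcases tgt_cases e a h with ⟨e, a, rfl, rfl, h₁⟩ | ⟨e, a, rfl, rfl, h₁⟩
    · exact f'.tgt_e _ _ h₁
    · exact g'.tgt_e _ _ h₁
  · intro e a h hb
    rcases tgt_cases e a h with ⟨e, a, rfl, rfl, h₁⟩ | ⟨e, a, rfl, rfl, h₁⟩
    · rw [Sum.elim_inl, f.label_v] at hb
      exact (f'.first_e _ _ h₁ hb).trans (f.first_e _ _ h₁ hb).symm
    · rw [Sum.elim_inr, g.label_v] at hb
      exact (g'.first_e _ _ h₁ hb).trans (g.first_e _ _ h₁ hb).symm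
  · rw [hc]; simp
  · rw [hc']; simp

/-- An embedding of thick subtrees over a map of nodes. -/
structure ThickEmbedding {τ τ' : BoxTree} (i : τ'.Node → τ.Node) (t' : ThickSubtree τ')
    (t : ThickSubtree τ) where
  J : t'.tree.Node → t.tree.Node
  comm : ∀ s, t.h (J s) = i (t'.h s)
  inj : J.Injective
  parent : ∀ s s', t'.tree.parent s = some s' → t.tree.parent (J s) = some (J s')

theorem ThickEmbedding.below {τ τ' : BoxTree} {i : τ'.Node → τ.Node} {t' : ThickSubtree τ'}
    {t : ThickSubtree τ} (e : ThickEmbedding i t' t) {s s' : t'.tree.Node}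
    (h : t'.tree.Below s s') : t.tree.Below (e.J s) (e.J s') :=
  Relation.ReflTransGen.lift e.J e.parent _ _ h

/-- Expansions preserve juxtaposition. -/
theorem Expansion.juxtapose {C C₁ C₂ : Component} {t : ThickSubtree C.tree}
    {t₁ : ThickSubtree C₁.tree} {t₂ : ThickSubtree C₂.tree} {c c₁ c₂ : Net}
    (x : Expansion C t c) (x₁ : Expansion C₁ t₁ c₁) (x₂ : Expansion C₂ t₂ c₂)
    (F : Net.Hom C₁.net C.net) (G : Net.Hom C₂.net C.net)
    (hv : (Sum.elim F.v G.v).Bijective) (he : (Sum.elim F.e G.e).Bijective)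
    (hc : C.net.concl = C₁.net.concl.map F.e ++ C₂.net.concl.map G.e)
    {i₁ : C₁.tree.Node → C.tree.Node} {i₂ : C₂.tree.Node → C.tree.Node}
    (hb₁ : ∀ v, C.box (F.v v) = i₁ (C₁.box v)) (hb₂ : ∀ v, C.box (G.v v) = i₂ (C₂.box v))
    (e₁ : ThickEmbedding i₁ t₁ t) (e₂ : ThickEmbedding i₂ t₂ t)
    (hcov₁ : ∀ s b, i₁ b = t.h s → ∃ s', e₁.J s' = s ∧ b = t₁.h s')
    (hcov₂ : ∀ s b, i₂ b = t.h s → ∃ s', e₂.J s' = s ∧ b = t₂.h s') :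
    Juxtapose c c₁ c₂ := by
  obtain ⟨f, hfv, hft, hfe⟩ := x.lift x₁ F (fun _ s => e₁.J s)
    (fun v s h => by rw [hb₁, h, e₁.comm]) (fun _ _ s s' _ _ _ h => e₁.below h)
  obtain ⟨g, hgv, hgt, hge⟩ := x.lift x₂ G (fun _ s => e₂.J s)
    (fun v s h => by rw [hb₂, h, e₂.comm]) (fun _ _ s s' _ _ _ h => e₂.below h)
  refine ⟨f, g, ⟨?_, ?_⟩, ⟨?_, ?_⟩, ?_⟩
  · have key : ∀ a, x.pV (Sum.elim f.v g.v a) = Sum.elim F.v G.v (a.map x₁.pV x₂.pV) := by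
      rintro (a | a)
      · exact hfv a
      · exact hgv a
    rintro (a | a) (b | b) hab
    -- Copies coming from different summands project to different cells of `C`; within one summand,
    -- the cell and the node separate them.
    all_goals
      have h1 := hv.1 ((key _).symm.trans ((congrArg x.pV hab).trans (key _)))
      have h2 := congrArg x.pT hab
      simp only [Sum.map_inl, Sum.map_inr, reduceCtorEq, Sum.inl.injEq, Sum.inr.injEq,
        Sum.elim_inl, Sum.elim_inr, hft, hgt] at h1 h2
    · rw [x₁.vertex_ext h1 (e₁.inj h2)]
    · rw [x₂.vertex_ext h1 (e₂.inj h2)]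
  · intro a
    obtain ⟨v | v, hv'⟩ := hv.2 (x.pV a)
    · have h := x.comm a
      rw [← hv', Sum.elim_inl, hb₁] at h
      obtain ⟨s, hs, hs'⟩ := hcov₁ _ _ h
      obtain ⟨b, hb, hb'⟩ := x₁.exists_vertex hs'
      exact ⟨.inl b, x.vertex_ext (by rw [← hv', Sum.elim_inl, hfv, hb]; rfl)
        (by rw [Sum.elim_inl, hft, hb', hs])⟩
    · have h := x.comm a
      rw [← hv', Sum.elim_inr, hb₂] at h
      obtain ⟨s, hs, hs'⟩ := hcov₂ _ _ h
      obtain ⟨b, hb, hb'⟩ := x₂.exists_vertex hs'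
      exact ⟨.inr b, x.vertex_ext (by rw [← hv', Sum.elim_inr, hgv, hb]; rfl)
        (by rw [Sum.elim_inr, hgt, hb', hs])⟩
  · have key : ∀ a, x.pE (Sum.elim f.e g.e a) = Sum.elim F.e G.e (a.map x₁.pE x₂.pE) := by
      rintro (a | a)
      · exact hfe a
      · exact hge a
    rintro (a | a) (b | b) hab
    all_goals
      have h1 := he.1 ((key _).symm.trans ((congrArg x.pE hab).trans (key _)))
      have h2 := congrArg (fun e => x.pT (c.src e)) hab
      simp only [Sum.map_inl, Sum.map_inr, reduceCtorEq, Sum.inl.injEq, Sum.inr.injEq,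
        Sum.elim_inl, Sum.elim_inr, f.src_e, g.src_e, hft, hgt] at h1 h2
    · rw [x₁.edge_ext h1 (e₁.inj h2)]
    · rw [x₂.edge_ext h1 (e₂.inj h2)]
  · intro a
    obtain ⟨v | v, hv'⟩ := he.2 (x.pE a)
    · have h := x.box_src a
      rw [← hv', Sum.elim_inl, F.src_e, hb₁] at h
      obtain ⟨s, hs, hs'⟩ := hcov₁ _ _ h
      obtain ⟨b, hb, hb'⟩ := x₁.exists_edge hs'
      exact ⟨.inl b, x.edge_ext (by rw [← hv', Sum.elim_inl, hfe, hb]; rfl)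
        (by rw [Sum.elim_inl, f.src_e, hft, hb', hs])⟩
    · have h := x.box_src a
      rw [← hv', Sum.elim_inr, G.src_e, hb₂] at h
      obtain ⟨s, hs, hs'⟩ := hcov₂ _ _ h
      obtain ⟨b, hb, hb'⟩ := x₂.exists_edge hs'
      exact ⟨.inr b, x.edge_ext (by rw [← hv', Sum.elim_inr, hge, hb]; rfl)
        (by rw [Sum.elim_inr, g.src_e, hgt, hb', hs])⟩
  · have h : (c₁.concl.map f.e ++ c₂.concl.map g.e).map x.pE = C.net.concl := by
      rw [hc, ← x₁.concl_comm, ← x₂.concl_comm]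
      simp [Function.comp_def, hfe, hge]
    refine x.list_ext (x.concl_comm.trans h.symm) fun e he => ?_
    rw [h] at he
    exact C.box_of_mem he

/-! ## Contractions -/

/-- Each of `c` and `d` is the quotient of `c'` that identifies the last two conclusions, together
with their sources, and nothing else. -/
theorem SplitContraction.iso {c d c' : Net} (h : SplitContraction c c')
    (h' : SplitContraction d c') : Net.Iso c d := by
  obtain ⟨f, l, a, b, o, hla, hlb, hc', hc, ha, hb, hv, he, hkv, hke⟩ := h
  obtain ⟨g, l', a', b', o', -, -, hd', hd, ha', hb', hv', he', hkv', hke'⟩ := h'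
  have h1 : l = l' ∧ [a, b] = [a', b'] := List.append_inj' (hc'.symm.trans hd') rfl
  obtain ⟨rfl, h1⟩ := h1
  simp only [List.cons.injEq, and_true] at h1
  obtain ⟨rfl, rfl⟩ := h1
  have hsa : f.v (c'.src a) = f.v (c'.src b) := by rw [← f.src_e, ha, ← f.src_e, hb]
  have hsa' : g.v (c'.src a) = g.v (c'.src b) := by rw [← g.src_e, ha', ← g.src_e, hb']
  have hkv₁ : ∀ x y, f.v x = f.v y → g.v x = g.v y := by
    intro x y h
    rcases hkv x y h with rfl | ⟨rfl, rfl⟩ | ⟨rfl, rfl⟩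
    exacts [rfl, hsa', hsa'.symm]
  have hkv₂ : ∀ x y, g.v x = g.v y → f.v x = f.v y := by
    intro x y h
    rcases hkv' x y h with rfl | ⟨rfl, rfl⟩ | ⟨rfl, rfl⟩
    exacts [rfl, hsa, hsa.symm]
  have tgt : ∀ e v, c.tgt (f.e e) = some (f.v v) → ∃ u, c'.tgt e = some u ∧ f.v u = f.v v := by
    intro e v h
    rcases h1 : c'.tgt e with _ | u
    · have : f.e e ∈ c.concl := by
        rw [← c'.mem_concl, hc'] at h1
        rw [hc]
        simp only [List.mem_append, List.mem_cons, List.not_mem_nil, or_false] at h1 ⊢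
        rcases h1 with h1 | rfl | rfl
        · exact .inl (List.mem_map_of_mem h1)
        · exact .inr ha
        · exact .inr hb
      rw [Net.tgt_of_mem this] at h; cases h
    · rw [f.tgt_e _ _ h1] at h
      exact ⟨u, rfl, Option.some.inj h⟩
  refine Net.iso_of_cover hv hv' he he' (fun x y => ⟨hkv₁ x y, hkv₂ x y⟩) ?_ ?_ ?_ ?_ ?_ ?_
    ⟨l ++ [a], ?_, ?_⟩
  · intro x y
    constructor <;> intro h
    · rcases hke x y h with rfl | ⟨rfl, rfl⟩ | ⟨rfl, rfl⟩
      · rfl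
      · rw [ha', hb']
      · rw [ha', hb']
    · rcases hke' x y h with rfl | ⟨rfl, rfl⟩ | ⟨rfl, rfl⟩
      · rfl
      · rw [ha, hb]
      · rw [ha, hb]
  · intro v; rw [f.label_v, g.label_v]
  · intro v; rw [f.typ_e, g.typ_e]
  · intro e v h
    rw [f.src_e] at h
    rw [g.src_e, hkv₁ _ _ h]
  · intro e v h
    obtain ⟨u, hu, huv⟩ := tgt e v h
    rw [g.tgt_e _ _ hu, hkv₁ _ _ huv]
  · intro e v h hbin
    obtain ⟨u, hu, huv⟩ := tgt e v h
    rw [← huv, f.label_v] at hbin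
    rw [f.first_e _ _ hu hbin, g.first_e _ _ hu hbin]
  · rw [hc]; simp [ha]
  · rw [hd]; simp [ha']

/-- Expansions preserve contraction. -/
theorem Expansion.splitContraction {C C' : Component} {t : ThickSubtree C.tree}
    {t' : ThickSubtree C'.tree} {c c' : Net} (x : Expansion C t c) (x' : Expansion C' t' c')
    (F : Net.Hom C'.net C.net) {L : List C'.net.E} {A B : C'.net.E} {O : C.net.E}
    (hA : C'.net.label (C'.net.src A) = .whynot) (hB : C'.net.label (C'.net.src B) = .whynot)
    (hC' : C'.net.concl = L ++ [A, B]) (hC : C.net.concl = L.map F.e ++ [O])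
    (hFA : F.e A = O) (hFB : F.e B = O) (hv : F.v.Surjective) (he : F.e.Surjective)
    (hkv : ∀ x y, F.v x = F.v y → x = y ∨ (x = C'.net.src A ∧ y = C'.net.src B) ∨
      (x = C'.net.src B ∧ y = C'.net.src A))
    (hke : ∀ x y, F.e x = F.e y → x = y ∨ (x = A ∧ y = B) ∨ (x = B ∧ y = A))
    (J : t'.tree.Node → t.tree.Node) (hJ : J.Bijective)
    (hbox : ∀ v s, C'.box v = t'.h s ↔ C.box (F.v v) = t.h (J s))
    (hbelow : ∀ s s', t'.tree.Below s s' → t.tree.Below (J s) (J s')) :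
    SplitContraction c c' := by
  obtain ⟨f, hfv, hft, hfe⟩ := x.lift x' F (fun _ s => J s) (fun v s h => (hbox v s).1 h)
    (fun _ _ s s' _ _ _ h => hbelow s s' h)
  have hc' := x'.concl_comm
  rw [hC', List.map_eq_append_iff] at hc'
  obtain ⟨l, as, hc', hl, has⟩ := hc'
  rcases as with _ | ⟨a, _ | ⟨b, _ | ⟨_, _⟩⟩⟩ <;> simp at has
  obtain ⟨ha, hb⟩ := has
  have hrA : C'.box (C'.net.src A) = C'.tree.root := C'.box_of_mem (by rw [hC']; simp)
  have hrB : C'.box (C'.net.src B) = C'.tree.root := C'.box_of_mem (by rw [hC']; simp)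
  have hrO : C.box (C.net.src O) = C.tree.root := C.box_of_mem (by rw [hC]; simp)
  obtain ⟨o, ho⟩ := x.exists_root_edge hrO
  have hc : c.concl = l.map f.e ++ [o] := by
    have h : (l.map f.e ++ [o]).map x.pE = C.net.concl := by
      rw [hC, ← hl]
      simp [Function.comp_def, hfe, ho]
    refine x.list_ext (x.concl_comm.trans h.symm) fun e he => ?_
    rw [h] at he
    exact C.box_of_mem he
  have hsa : ∀ v, x'.pV v = C'.net.src A → v = c'.src a := fun v h =>
    x'.vertex_ext_root (by rw [h, ← ha, x'.src_comm]) (by rw [← x'.src_comm, ha, hrA])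
  have hsb : ∀ v, x'.pV v = C'.net.src B → v = c'.src b := fun v h =>
    x'.vertex_ext_root (by rw [h, ← hb, x'.src_comm]) (by rw [← x'.src_comm, hb, hrB])
  refine ⟨f, l, a, b, o, ?_, ?_, hc', hc, ?_, ?_, ?_, ?_, ?_, ?_⟩
  · rw [x'.label_comm, ← x'.src_comm, ha, hA]
  · rw [x'.label_comm, ← x'.src_comm, hb, hB]
  · exact x.edge_ext_root (by rw [hfe, ha, hFA, ho]) (by rw [ho, hrO])
  · exact x.edge_ext_root (by rw [hfe, hb, hFB, ho]) (by rw [ho, hrO])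
  · intro a
    obtain ⟨v, hv'⟩ := hv (x.pV a)
    obtain ⟨s, hs⟩ := hJ.2 (x.pT a)
    have := x.comm a
    rw [← hv', ← hs, ← hbox] at this
    obtain ⟨b, hb, hb'⟩ := x'.exists_vertex this
    exact ⟨b, x.vertex_ext (by rw [hfv, hb, hv']) (by rw [hft, hb', hs])⟩
  · intro a
    obtain ⟨e, he'⟩ := he (x.pE a)
    obtain ⟨s, hs⟩ := hJ.2 (x.pT (c.src a))
    have := x.box_src a
    rw [← he', ← hs, F.src_e, ← hbox] at this
    obtain ⟨b, hb, hb'⟩ := x'.exists_edge this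
    exact ⟨b, x.edge_ext (by rw [hfe, hb, he']) (by rw [f.src_e, hft, hb', hs])⟩
  · intro u v huv
    rcases hkv (x'.pV u) (x'.pV v) (by rw [← hfv, huv, hfv]) with h | ⟨h, h'⟩ | ⟨h, h'⟩
    · exact .inl (x'.vertex_ext h (hJ.1 (by rw [← hft, huv, hft])))
    · exact .inr (.inl ⟨hsa _ h, hsb _ h'⟩)
    · exact .inr (.inr ⟨hsb _ h, hsa _ h'⟩)
  · intro u v huv
    have hA' : ∀ e, x'.pE e = A → e = a := fun e h =>
      x'.edge_ext_root (h.trans ha.symm) (by rw [ha, hrA])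
    have hB' : ∀ e, x'.pE e = B → e = b := fun e h =>
      x'.edge_ext_root (h.trans hb.symm) (by rw [hb, hrB])
    rcases hke (x'.pE u) (x'.pE v) (by rw [← hfe, huv, hfe]) with h | ⟨h, h'⟩ | ⟨h, h'⟩
    · exact .inl (x'.edge_ext h (hJ.1 (by rw [← hft, ← hft, ← f.src_e, huv, f.src_e])))
    · exact .inr (.inl ⟨hA' _ h, hB' _ h'⟩)
    · exact .inr (.inr ⟨hB' _ h, hA' _ h'⟩)

end Glue

namespace Glue

/-! ## Boxes -/

/-- A `?`-cell has only one output. -/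
theorem Net.out_unique {c : Net} {e e' : c.E}
    (h : c.label (c.src e) = .whynot ∨ c.label (c.src e) = .bang)
    (he : c.src e' = c.src e) : e' = e := by
  have hok := c.cell_ok (c.src e)
  have : ∃ o, {e' | c.src e' = c.src e} = {o} := by
    rcases h with h | h <;> rw [h] at hok <;> obtain ⟨o, A, ho, -⟩ := hok <;> exact ⟨o, ho⟩
  obtain ⟨o, ho⟩ := this
  have h1 : e ∈ ({o} : Set c.E) := ho ▸ rfl
  have h2 : e' ∈ ({o} : Set c.E) := ho ▸ he
  exact h2.trans h1.symm

/-- Apart from the `!`-cell and its output, `c` is the disjoint union of the `c' j` with the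
conclusions at equal positions, and their sources, identified; this can be read off the `c' j`. The
type of the output of the `!`-cell cannot, hence `ht`. The list of shared conclusions is read off
the first part, hence `hn`. -/
theorem MergeBox.iso {n : ℕ} (hn : 0 < n) {c d : Net} {c' : Fin n → Net} (h : MergeBox c c')
    (h' : MergeBox d c') (ht : c.type = d.type) : Net.Iso c d := by
  obtain ⟨f, q, o, q', a, hc, ho, hq, hc', hiv, hie, hrv, hre, hkv, hke⟩ := h
  obtain ⟨g, p, o', p', a', hd, ho', hp, hd', hiv', hie', hrv', hre', hkv', hke'⟩ := h'
  have hqp : ∀ j, q' j = p' j ∧ a j = a' j := by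
    intro j
    have := List.append_inj' ((hc' j).1.symm.trans (hd' j).1) rfl
    simpa using this
  have hto : d.typ o' = c.typ o := by
    have : q.map c.typ ++ [c.typ o] = p.map d.typ ++ [d.typ o'] := by
      simpa only [Net.type, hc, hd, List.map_append, List.map_cons, List.map_nil] using ht
    simpa using (List.append_inj' this rfl).2.symm
  have hco : c.tgt o = none := Net.tgt_of_mem (by rw [hc]; simp)
  have hdo : d.tgt o' = none := Net.tgt_of_mem (by rw [hd]; simp)
  have hcq : ∀ e ∈ q, c.tgt e = none := fun e he => Net.tgt_of_mem (by rw [hc]; simp [he])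
  have fne : ∀ j v, (f j).v v ≠ c.src o := fun j v hv => by
    have : (f j).v v ∈ ⋃ j, Set.range (f j).v := Set.mem_iUnion.2 ⟨j, v, rfl⟩
    rw [hrv] at this; exact this hv
  have gne : ∀ j v, (g j).v v ≠ d.src o' := fun j v hv => by
    have : (g j).v v ∈ ⋃ j, Set.range (g j).v := Set.mem_iUnion.2 ⟨j, v, rfl⟩
    rw [hrv'] at this; exact this hv
  have fneE : ∀ j v, (f j).e v ≠ o := fun j v hv => by
    have : (f j).e v ∈ ⋃ j, Set.range (f j).e := Set.mem_iUnion.2 ⟨j, v, rfl⟩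
    rw [hre] at this; exact this hv
  have gneE : ∀ j v, (g j).e v ≠ o' := fun j v hv => by
    have : (g j).e v ∈ ⋃ j, Set.range (g j).e := Set.mem_iUnion.2 ⟨j, v, rfl⟩
    rw [hre'] at this; exact this hv
  -- the shared edges
  have share : ∀ {c d : Net} {q : List c.E} {p : List d.E} (f : ∀ j, Net.Hom (c' j) c)
      (g : ∀ j, Net.Hom (c' j) d), (∀ j, (f j).e.Injective) →
      (∀ j, (q' j).map (f j).e = q) → (∀ j, (q' j).map (g j).e = p) → ∀ i j x y,
      (f i).e x ∈ q → (f i).e x = (f j).e y → (g i).e x = (g j).e y := by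
    intro c d q p f g hie hfq hgp i j x y hx hxy
    obtain ⟨k, hk, hkx⟩ := List.mem_iff_getElem.1 hx
    have hki : k < (q' i).length := by have := hk; rw [← hfq i] at this; simpa using this
    have hkj : k < (q' j).length := by have := hk; rw [← hfq j] at this; simpa using this
    have h1 : (f i).e (q' i)[k] = q[k] := by
      have := List.getElem_of_eq (hfq i) (i := k) (by simpa using hki); simpa using this
    have h2 : (f j).e (q' j)[k] = q[k] := by
      have := List.getElem_of_eq (hfq j) (i := k) (by simpa using hkj); simpa using this
    have h3 := hie i (h1.trans hkx)
    have h4 := hie j (h2.trans (hkx.trans hxy))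
    rw [← h3, ← h4]
    have h5 := List.getElem_of_eq ((hgp i).trans (hgp j).symm) (i := k) (by simpa using hki)
    simpa using h5
  have kE : ∀ i j x y, (f i).e x = (f j).e y → (g i).e x = (g j).e y := by
    intro i j x y h
    by_cases hij : i = j
    · subst hij; rw [hie i h]
    · exact share f g hie (fun j => (hc' j).2.1) (fun j => (hqp j).1 ▸ (hd' j).2.1) i j x y
        (hke i j hij x y h) h
  have kE' : ∀ i j x y, (g i).e x = (g j).e y → (f i).e x = (f j).e y := by
    intro i j x y h
    by_cases hij : i = j
    · subst hij; rw [hie' i h]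
    · exact share g f hie' (fun j => (hqp j).1 ▸ (hd' j).2.1) (fun j => (hc' j).2.1) i j x y
        (hke' i j hij x y h) h
  -- A shared cell is the source of a shared conclusion, so the identification of cells follows from
  -- that of edges.
  have shareV : ∀ {c d : Net} {q : List c.E} (f : ∀ j, Net.Hom (c' j) c)
      (g : ∀ j, Net.Hom (c' j) d), (∀ j, (f j).v.Injective) →
      (∀ j, (q' j).map (f j).e = q) →
      (∀ i j x y, (f i).e x = (f j).e y → (g i).e x = (g j).e y) → ∀ i j x y,
      (∃ e ∈ q, c.src e = (f i).v x) → (f i).v x = (f j).v y → (g i).v x = (g j).v y := by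
    intro c d q f g hiv hfq kE i j x y ⟨e, heq, hex⟩ hxy
    obtain ⟨e₁, -, he₁⟩ := List.mem_map.1 ((hfq i).symm ▸ heq)
    obtain ⟨e₂, -, he₂⟩ := List.mem_map.1 ((hfq j).symm ▸ heq)
    have h1 : (c' i).src e₁ = x := hiv i (by rw [← (f i).src_e, he₁, hex])
    have h2 : (c' j).src e₂ = y := hiv j (by rw [← (f j).src_e, he₂, hex, hxy])
    rw [← h1, ← h2, ← (g i).src_e, ← (g j).src_e, kE i j e₁ e₂ (he₁.trans he₂.symm)]
  have kV : ∀ i j x y, (f i).v x = (f j).v y → (g i).v x = (g j).v y := by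
    intro i j x y h
    by_cases hij : i = j
    · subst hij; rw [hiv i h]
    · exact shareV f g hiv (fun j => (hc' j).2.1) kE i j x y (hkv i j hij x y h) h
  have kV' : ∀ i j x y, (g i).v x = (g j).v y → (f i).v x = (f j).v y := by
    intro i j x y h
    by_cases hij : i = j
    · subst hij; rw [hiv' i h]
    · exact shareV g f hiv' (fun j => (hqp j).1 ▸ (hd' j).2.1) kE' i j x y (hkv' i j hij x y h) h
  have tgt : ∀ j e, (∃ u, (c' j).tgt e = some u ∧ c.tgt ((f j).e e) = some ((f j).v u)) ∨
      (e = a j ∧ c.tgt ((f j).e e) = some (c.src o)) ∨ c.tgt ((f j).e e) = none := by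
    intro j e
    rcases h : (c' j).tgt e with _ | u
    · rw [← (c' j).mem_concl, (hc' j).1, List.mem_append, List.mem_singleton] at h
      rcases h with h | rfl
      · exact .inr (.inr (hcq _ ((hc' j).2.1 ▸ List.mem_map_of_mem h)))
      · exact .inr (.inl ⟨rfl, (hc' j).2.2⟩)
    · exact .inl ⟨u, rfl, (f j).tgt_e _ _ h⟩
  let fV : Option (Σ j, (c' j).V) → c.V := fun x => x.elim (c.src o) fun x => (f x.1).v x.2
  let gV : Option (Σ j, (c' j).V) → d.V := fun x => x.elim (d.src o') fun x => (g x.1).v x.2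
  let fE : Option (Σ j, (c' j).E) → c.E := fun x => x.elim o fun x => (f x.1).e x.2
  let gE : Option (Σ j, (c' j).E) → d.E := fun x => x.elim o' fun x => (g x.1).e x.2
  refine Net.iso_of_cover (fV := fV) (gV := gV) (fE := fE) (gE := gE) ?_ ?_ ?_ ?_ ?_ ?_ ?_ ?_ ?_ ?_
    ?_ ?_
  · intro v
    by_cases h : v = c.src o
    · exact ⟨none, h.symm⟩
    · have : v ∈ ⋃ j, Set.range (f j).v := by rw [hrv]; exact h
      obtain ⟨j, x, hx⟩ := Set.mem_iUnion.1 this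
      exact ⟨some ⟨j, x⟩, hx⟩
  · intro v
    by_cases h : v = d.src o'
    · exact ⟨none, h.symm⟩
    · have : v ∈ ⋃ j, Set.range (g j).v := by rw [hrv']; exact h
      obtain ⟨j, x, hx⟩ := Set.mem_iUnion.1 this
      exact ⟨some ⟨j, x⟩, hx⟩
  · intro v
    by_cases h : v = o
    · exact ⟨none, h.symm⟩
    · have : v ∈ ⋃ j, Set.range (f j).e := by rw [hre]; exact h
      obtain ⟨j, x, hx⟩ := Set.mem_iUnion.1 this
      exact ⟨some ⟨j, x⟩, hx⟩
  · intro v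
    by_cases h : v = o'
    · exact ⟨none, h.symm⟩
    · have : v ∈ ⋃ j, Set.range (g j).e := by rw [hre']; exact h
      obtain ⟨j, x, hx⟩ := Set.mem_iUnion.1 this
      exact ⟨some ⟨j, x⟩, hx⟩
  · rintro (_ | ⟨i, x⟩) (_ | ⟨j, y⟩)
    · exact iff_of_true rfl rfl
    · exact iff_of_false (fne j y).symm (gne j y).symm
    · exact iff_of_false (fne i x) (gne i x)
    · exact ⟨kV i j x y, kV' i j x y⟩
  · rintro (_ | ⟨i, x⟩) (_ | ⟨j, y⟩)
    · exact iff_of_true rfl rfl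
    · exact iff_of_false (fneE j y).symm (gneE j y).symm
    · exact iff_of_false (fneE i x) (gneE i x)
    · exact ⟨kE i j x y, kE' i j x y⟩
  · rintro (_ | ⟨i, x⟩)
    · exact ho'.trans ho.symm
    · exact ((g i).label_v x).trans ((f i).label_v x).symm
  · rintro (_ | ⟨i, x⟩)
    · exact hto
    · exact ((g i).typ_e x).trans ((f i).typ_e x).symm
  · rintro (_ | ⟨i, x⟩) (_ | ⟨j, y⟩) h
    · rfl
    · exact absurd h.symm (fne j y)
    · have h1 : c.src ((f i).e x) = c.src o := h
      rw [(f i).src_e] at h1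
      exact absurd h1 (fne i _)
    · have h1 : c.src ((f i).e x) = (f j).v y := h
      rw [(f i).src_e] at h1
      exact ((g i).src_e x).trans (kV _ _ _ _ h1)
  · rintro (_ | ⟨i, x⟩) y h
    · have h1 : c.tgt o = some (fV y) := h
      rw [hco] at h1; cases h1
    · have h1 : c.tgt ((f i).e x) = some (fV y) := h
      rcases tgt i x with ⟨u, hu, h2⟩ | ⟨rfl, h2⟩ | h2 <;> rw [h1] at h2
      · rcases y with _ | ⟨j, y⟩
        · exact absurd (Option.some.inj h2).symm (fne i u)
        · have h3 := (g i).tgt_e _ _ hu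
          rw [kV i j u y (Option.some.inj h2).symm] at h3
          exact h3
      · rcases y with _ | ⟨j, y⟩
        · have := (hd' i).2.2
          rw [← (hqp i).2] at this
          exact this
        · exact absurd (Option.some.inj h2) (fne j y)
      · cases h2
  · rintro (_ | ⟨i, x⟩) y h hb
    · have h1 : c.tgt o = some (fV y) := h
      rw [hco] at h1; cases h1
    · have h1 : c.tgt ((f i).e x) = some (fV y) := h
      rcases tgt i x with ⟨u, hu, h2⟩ | ⟨rfl, h2⟩ | h2 <;> rw [h1] at h2
      · rw [Option.some.inj h2, (f i).label_v] at hb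
        exact ((g i).first_e _ _ hu hb).trans ((f i).first_e _ _ hu hb).symm
      · rw [Option.some.inj h2, ho] at hb
        rcases hb with hb | hb <;> cases hb
      · cases h2
  · refine ⟨(q' ⟨0, hn⟩).map (fun e => some ⟨⟨0, hn⟩, e⟩) ++ [none], ?_, ?_⟩
    · rw [hc, List.map_append, List.map_map]
      exact congrArg (· ++ [o]) (hc' ⟨0, hn⟩).2.1.symm
    · rw [hd, List.map_append, List.map_map]
      refine congrArg (· ++ [o']) ?_
      rw [(hqp ⟨0, hn⟩).1]
      exact (hd' ⟨0, hn⟩).2.1.symm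

/-- Every edge is a conclusion and every cell has exactly one output, so cells, edges and positions
in the list of conclusions are the same thing; the last position is the `!`-cell. -/
theorem IsEmptyBox.iso {c d : Net} (h : IsEmptyBox c) (h' : IsEmptyBox d)
    (ht : c.type = d.type) : Net.Iso c d := by
  have key : ∀ {c : Net}, IsEmptyBox c → c.src.Bijective ∧ (∀ e, e ∈ c.concl) := by
    rintro c ⟨h1, h2, q, o, hc, ho, hq⟩
    have hm : ∀ e, e ∈ c.concl := fun e => (c.mem_concl e).2 (h1 e)
    refine ⟨⟨fun a b hab => ?_, h2⟩, hm⟩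
    refine Net.out_unique ?_ hab
    have := hm b
    rw [hc, List.mem_append, List.mem_singleton] at this
    rcases this with h | rfl
    · exact .inl (hq _ h)
    · exact .inr ho
  obtain ⟨hc, hcm⟩ := key h
  obtain ⟨hd, hdm⟩ := key h'
  obtain ⟨h1, -, q, o, hcc, ho, hq⟩ := h
  obtain ⟨-, -, p, o', hdc, ho', hp⟩ := h'
  have hlen : c.concl.length = d.concl.length := by
    simpa [Net.type] using congrArg List.length ht
  have hlq : q.length = p.length := by simpa [hcc, hdc] using hlen
  let fE : Fin c.concl.length → c.E := fun i => c.concl[i]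
  let gE : Fin c.concl.length → d.E := fun i => d.concl[i]
  have hfE : fE.Surjective := fun e => by
    obtain ⟨i, hi, h⟩ := List.mem_iff_getElem.1 (hcm e)
    exact ⟨⟨i, hi⟩, h⟩
  have hgE : gE.Surjective := fun e => by
    obtain ⟨i, hi, h⟩ := List.mem_iff_getElem.1 (hdm e)
    exact ⟨⟨i, hlen ▸ hi⟩, h⟩
  have hk : ∀ a b, fE a = fE b ↔ gE a = gE b := by
    intro a b
    simp only [fE, gE, Fin.getElem_fin]
    rw [c.concl_nodup.getElem_inj_iff, d.concl_nodup.getElem_inj_iff]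
  refine Net.iso_of_cover (fV := c.src ∘ fE) (gV := d.src ∘ gE) (hc.2.comp hfE) (hd.2.comp hgE)
    hfE hgE (fun a b => ?_) hk ?_ ?_ ?_ ?_ ?_ ⟨List.finRange _, ?_, ?_⟩
  · simp only [Function.comp, hc.1.eq_iff, hd.1.eq_iff, hk]
  · rintro ⟨i, hi⟩
    simp only [Function.comp, fE, gE, Fin.getElem_fin]
    by_cases hiq : i < q.length
    · have h1 : c.concl[i] = q[i] := by simp [hcc, List.getElem_append_left hiq]
      have h2 : d.concl[i] = p[i] := by simp [hdc, List.getElem_append_left (hlq ▸ hiq)]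
      rw [h1, h2, hq _ (List.getElem_mem _), hp _ (List.getElem_mem _)]
    · have hi' : i = q.length := by
        rw [hcc] at hi
        simp at hi; omega
      subst hi'
      have h1 : c.concl[q.length] = o := by simp [hcc]
      have h2 : d.concl[q.length] = o' := by simp [hdc, hlq]
      rw [h1, h2, ho, ho']
  · rintro ⟨i, hi⟩
    have := List.getElem_of_eq ht (i := i) (by simpa [Net.type] using hi)
    simp only [Net.type, List.getElem_map] at this
    exact this.symm
  · intro a b h
    exact congrArg d.src ((hk _ _).1 (hc.1 h))
  · intro a b h
    rw [h1] at h; cases h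
  · intro a b h
    rw [h1] at h; cases h
  · apply List.ext_getElem <;> simp [fE]
  · apply List.ext_getElem <;> simp [gE, hlen]

/-! ### Expansions of a component with one box around its content -/

section
variable {C C' : Component} {t : ThickSubtree C.tree} {c : Net} (x : Expansion C t c)
  (D : AddCell .bang C.net C'.net) {A : C'.net.E} {O : C.net.E}
  (i : C'.tree.Node → C.tree.Node)

/-- `C` is `C'` with a box around it: `D` adds a `!`-cell below the last conclusion of `C'`, and
the border of the box consists of this cell and of the sources of the other conclusions. -/
structure IsBoxing {C C' : Component} (D : AddCell .bang C.net C'.net) (A : C'.net.E)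
    (O : C.net.E) (i : C'.tree.Node → C.tree.Node) : Prop where
  as_eq : D.as = [A]
  os_eq : D.os = [O]
  label_l : ∀ e ∈ D.l, C'.net.label (C'.net.src e) = .whynot
  box_w : C.box D.w = C.tree.root
  box_l : ∀ e ∈ D.l, C.box (D.f.v (C'.net.src e)) = C.tree.root
  box_f : ∀ v, (∀ e ∈ D.l, C'.net.src e ≠ v) → C.box (D.f.v v) = i (C'.box v)

variable {D i}

theorem IsBoxing.src_o (hB : IsBoxing D A O i) : C.net.src O = D.w :=
  (D.mem_os O).1 (by rw [hB.os_eq]; simp)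

theorem IsBoxing.src_of_tgt (hB : IsBoxing D A O i) {e : C'.net.E} (he : e ∉ D.l) :
    ∀ e' ∈ D.l, C'.net.src e' ≠ C'.net.src e := by
  intro e' he' h
  exact he (Net.out_unique (.inl (hB.label_l _ he')) h.symm ▸ he')

/-- If no node of the thick subtree lies inside the box, then only the `!`-cell and the `?`-cells of
the border have copies, and the outputs of these are conclusions. -/
theorem Expansion.isEmptyBox (x : Expansion C t c) (hB : IsBoxing D A O i)
    (h : ∀ s b, t.h s ≠ i b) : IsEmptyBox c := by
  have hV : ∀ v, ∃ e, e ∈ C.net.concl ∧ C.net.src e = x.pV v := by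
    intro v
    rcases D.eq_or (x.pV v) with h' | ⟨v', hv'⟩
    · exact ⟨O, by rw [D.concl, hB.os_eq]; simp, by rw [h', hB.src_o]⟩
    · by_cases hv : ∃ e ∈ D.l, C'.net.src e = v'
      · obtain ⟨e, he, rfl⟩ := hv
        refine ⟨D.f.e e, ?_, by rw [D.f.src_e, hv']⟩
        rw [D.concl]
        exact List.mem_append_left _ (List.mem_map_of_mem he)
      · have := hB.box_f v' fun e he h => hv ⟨e, he, h⟩
        rw [hv', x.comm] at this
        exact absurd this (h _ _)
  have hlab : ∀ e ∈ C.net.concl,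
      C.net.label (C.net.src e) = .whynot ∨ C.net.label (C.net.src e) = .bang := by
    intro e he
    rw [D.concl, hB.os_eq, List.mem_append, List.mem_singleton] at he
    rcases he with he | rfl
    · obtain ⟨e, he', rfl⟩ := List.mem_map.1 he
      rw [D.f.src_e, D.f.label_v]
      exact .inl (hB.label_l _ he')
    · rw [hB.src_o, D.label_w]; exact .inr rfl
  have hc := x.concl_comm
  rw [D.concl, hB.os_eq, List.map_eq_append_iff] at hc
  obtain ⟨q, os, hc, hq, hos⟩ := hc
  rcases os with _ | ⟨o, _ | ⟨_, _⟩⟩ <;> simp at hos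
  refine ⟨?_, ?_, q, o, hc, ?_, ?_⟩
  · intro e
    obtain ⟨e', he', h⟩ := hV (c.src e)
    rw [← x.src_comm] at h
    rw [x.tgt_none, Net.out_unique (hlab _ he') h.symm]
    exact Net.tgt_of_mem he'
  · intro v
    obtain ⟨e', he', h⟩ := hV v
    obtain ⟨e, he⟩ := x.exists_root_edge (C.box_of_mem he')
    refine ⟨e, x.vertex_ext_root ?_ ?_⟩
    · rw [← x.src_comm, he, h]
    · rw [← h, C.box_of_mem he']
  · rw [x.label_comm, ← x.src_comm, hos, hB.src_o, D.label_w]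
  · intro e he
    rw [x.label_comm, ← x.src_comm]
    have : x.pE e ∈ D.l.map D.f.e := hq ▸ List.mem_map_of_mem he
    obtain ⟨e', he', h⟩ := List.mem_map.1 this
    rw [← h, D.f.src_e, D.f.label_v, hB.label_l _ he']

/-- Every node inside the box belongs to exactly one of the embedded thick subtrees, that is, to one
copy of the box. The cells of the border lie over the root of `C`, so the copies share them; nothing
else is shared, by `hdisj`. -/
theorem Expansion.mergeBox (x : Expansion C t c) (hB : IsBoxing D A O i) {n : ℕ} (hn : 0 < n)
    {t' : Fin n → ThickSubtree C'.tree} {c' : Fin n → Net} (x' : ∀ j, Expansion C' (t' j) (c' j))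
    (e : ∀ j, ThickEmbedding i (t' j) t)
    (hdisj : ∀ j k s s', (e j).J s = (e k).J s' → j = k)
    (hcov : ∀ s b, i b = t.h s → ∃ j s', (e j).J s' = s ∧ b = (t' j).h s') :
    MergeBox c c' := by
  classical
  -- The map of nodes must depend on the cell: border cells sit over the root of the content in
  -- `C'`, but over the outer root in `C`.
  let J : ∀ j, C'.net.V → (t' j).tree.Node → t.tree.Node := fun j v s =>
    if ∃ e ∈ D.l, C'.net.src e = v then t.tree.root else (e j).J s
  have J_pos : ∀ j e s, e ∈ D.l → J j (C'.net.src e) s = t.tree.root := fun j e s h =>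
    if_pos ⟨e, h, rfl⟩
  have J_neg : ∀ j v s, (∀ e ∈ D.l, C'.net.src e ≠ v) → J j v s = (e j).J s := fun j v s h =>
    if_neg fun ⟨e, he, h'⟩ => h e he h'
  have hl : ∀ e ∈ D.l, e ∈ C'.net.concl := fun e he => by
    rw [D.concl']; exact List.mem_append_left _ he
  have key : ∀ j, ∃ f : Net.Hom (c' j) c, (∀ a, x.pV (f.v a) = D.f.v ((x' j).pV a)) ∧
      (∀ a, x.pT (f.v a) = J j ((x' j).pV a) ((x' j).pT a)) ∧
      ∀ a, x.pE (f.e a) = D.f.e ((x' j).pE a) := by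
    intro j
    refine x.lift (x' j) D.f (J j) ?_ ?_
    · intro v s h
      by_cases hv : ∃ e ∈ D.l, C'.net.src e = v
      · obtain ⟨a, ha, rfl⟩ := hv
        rw [hB.box_l _ ha, J_pos _ _ _ ha, t.h_root]
      · have hv' : ∀ e ∈ D.l, C'.net.src e ≠ v := fun e he h => hv ⟨e, he, h⟩
        rw [hB.box_f _ hv', J_neg _ _ _ hv', (e j).comm, h]
    · intro a v s s' ha _ _ hs
      have ha' : a ∉ D.l := fun h => by
        rw [Net.tgt_of_mem (hl _ h)] at ha; cases ha
      rw [J_neg _ _ _ (hB.src_of_tgt ha')]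
      by_cases hv : ∃ e ∈ D.l, C'.net.src e = v
      · obtain ⟨b, hb, rfl⟩ := hv
        rw [J_pos _ _ _ hb]
        exact BoxTree.below_root _
      · have hv' : ∀ e ∈ D.l, C'.net.src e ≠ v := fun e he h => hv ⟨e, he, h⟩
        rw [J_neg _ _ _ hv']
        exact (e j).below hs
  choose f hfv hft hfe using key
  obtain ⟨o, ho⟩ := x.exists_root_edge (e := O) (by rw [hB.src_o, hB.box_w])
  have how : x.pV (c.src o) = D.w := by rw [← x.src_comm, ho, hB.src_o]
  have hw' : ∀ v, x.pV v = D.w → v = c.src o := fun v hv =>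
    x.vertex_ext_root (hv.trans how.symm) (by rw [how, hB.box_w])
  have hc := x.concl_comm
  rw [D.concl, hB.os_eq, List.map_eq_append_iff] at hc
  obtain ⟨q, os, hc, hq, hos⟩ := hc
  rcases os with _ | ⟨o', _ | ⟨_, _⟩⟩ <;> simp at hos
  have hoo : o' = o :=
    x.edge_ext_root (hos.trans ho.symm) (by rw [ho, hB.src_o, hB.box_w])
  subst hoo
  have hc' : ∀ j, ∃ (q' : List (c' j).E) (a : (c' j).E), (c' j).concl = q' ++ [a] ∧
      q'.map (x' j).pE = D.l ∧ (x' j).pE a = A := by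
    intro j
    have h := (x' j).concl_comm
    rw [D.concl', hB.as_eq, List.map_eq_append_iff] at h
    obtain ⟨q, os, h1, h2, h3⟩ := h
    rcases os with _ | ⟨o', _ | ⟨_, _⟩⟩ <;> simp at h3
    exact ⟨q, o', h1, h2, h3⟩
  choose q' a hq'a hq' ha using hc'
  have hrootl : ∀ e ∈ D.l, C.box (C.net.src (D.f.e e)) = C.tree.root := fun e he => by
    rw [D.f.src_e, hB.box_l _ he]
  have hqr : ∀ e ∈ q.map x.pE, C.box (C.net.src e) = C.tree.root := by
    intro e he
    rw [hq] at he
    obtain ⟨e', he', rfl⟩ := List.mem_map.1 he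
    exact hrootl e' he'
  have hqf : ∀ j, (q' j).map (f j).e = q := by
    intro j
    refine x.list_ext ?_ hqr
    rw [hq, ← hq' j, List.map_map, List.map_map]
    exact List.map_congr_left fun e _ => hfe j e
  have hmemq : ∀ {e : c.E} {E' : C'.net.E}, E' ∈ D.l → x.pE e = D.f.e E' → e ∈ q := by
    intro e E' hE' h
    refine x.mem_of_map ?_ (by rw [h, hrootl _ hE'])
    rw [h, hq]
    exact List.mem_map_of_mem hE'
  have hinjV : ∀ j, (f j).v.Injective := by
    intro j u v h
    have h1 : (x' j).pV u = (x' j).pV v := D.inj_v (by rw [← hfv, h, hfv])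
    by_cases hv : ∃ e ∈ D.l, C'.net.src e = (x' j).pV v
    · obtain ⟨e, he, h2⟩ := hv
      exact (x' j).vertex_ext_root h1 (by rw [← h2, C'.box_of_mem (hl _ he)])
    · have hv' : ∀ e ∈ D.l, C'.net.src e ≠ (x' j).pV v := fun e he h => hv ⟨e, he, h⟩
      refine (x' j).vertex_ext h1 ((e j).inj ?_)
      rw [← J_neg j _ _ hv', ← J_neg j _ _ hv', ← hft, ← h1, ← hft, h]
  have hcovV : ∀ v, v ≠ c.src o' → ∃ j u, (f j).v u = v := by
    intro v hv
    rcases D.eq_or (x.pV v) with h' | ⟨v', hv'⟩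
    · exact absurd (hw' v h') hv
    · by_cases hv₁ : ∃ e ∈ D.l, C'.net.src e = v'
      · obtain ⟨a, ha, rfl⟩ := hv₁
        -- Border cells occur in every copy; the copy `0` exists because `n` is positive.
        obtain ⟨u, hu⟩ := (x' ⟨0, hn⟩).exists_root_vertex (C'.box_of_mem (hl _ ha))
        refine ⟨⟨0, hn⟩, u, x.vertex_ext_root (by rw [hfv, hu, hv']) ?_⟩
        rw [← hv', hB.box_l _ ha]
      · have hv₂ : ∀ e ∈ D.l, C'.net.src e ≠ v' := fun e he h => hv₁ ⟨e, he, h⟩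
        have h := hB.box_f _ hv₂
        rw [hv', x.comm] at h
        obtain ⟨j, s, hs, hs'⟩ := hcov _ _ h.symm
        obtain ⟨u, hu, hu'⟩ := (x' j).exists_vertex hs'
        refine ⟨j, u, x.vertex_ext (by rw [hfv, hu, hv']) ?_⟩
        rw [hft, hu, J_neg _ _ _ hv₂, hu', hs]
  have hcovE : ∀ v, v ≠ o' → ∃ j u, (f j).e u = v := by
    intro v hv
    rcases D.eq_or_e (x.pE v) with h' | ⟨v', hv'⟩
    · rw [hB.os_eq, List.mem_singleton] at h'
      exact absurd (x.edge_ext_root (h'.trans ho.symm) (by rw [ho, hB.src_o, hB.box_w])) hv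
    · by_cases hv₁ : v' ∈ D.l
      · obtain ⟨u, hu⟩ := (x' ⟨0, hn⟩).exists_root_edge (C'.box_of_mem (hl _ hv₁))
        refine ⟨⟨0, hn⟩, u, x.edge_ext_root (by rw [hfe, hu, hv']) ?_⟩
        rw [← hv', hrootl _ hv₁]
      · have hv₂ := hB.src_of_tgt hv₁
        have h := hB.box_f _ hv₂
        rw [← D.f.src_e, hv', x.box_src] at h
        obtain ⟨j, s, hs, hs'⟩ := hcov _ _ h.symm
        obtain ⟨u, hu, hu'⟩ := (x' j).exists_edge hs'
        refine ⟨j, u, x.edge_ext (by rw [hfe, hu, hv']) ?_⟩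
        rw [(f j).src_e, hft, ← (x' j).src_comm, hu, J_neg _ _ _ hv₂, hu', hs]
  refine ⟨f, q, o', q', a, hc, ?_, ?_, ?_, hinjV, ?_, ?_, ?_, ?_, ?_⟩
  · rw [x.label_comm, how, D.label_w]
  · intro e he
    rw [x.label_comm, ← x.src_comm]
    have : x.pE e ∈ D.l.map D.f.e := hq ▸ List.mem_map_of_mem he
    obtain ⟨e', he', h⟩ := List.mem_map.1 this
    rw [← h, D.f.src_e, D.f.label_v, hB.label_l _ he']
  · intro j
    refine ⟨hq'a j, hqf j, ?_⟩
    apply x.tgt_of_root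
    · rw [hfe, ha, how]
      exact D.tgt_as _ (by rw [hB.as_eq]; simp)
    · rw [how, hB.box_w]
  · intro j u v h
    have h1 : (x' j).pE u = (x' j).pE v := D.inj_e (by rw [← hfe, h, hfe])
    have h2 : (c' j).src u = (c' j).src v := hinjV j (by rw [← (f j).src_e, h, (f j).src_e])
    exact (x' j).edge_ext h1 (by rw [h2])
  · ext v
    simp only [Set.mem_iUnion, Set.mem_range, Set.mem_compl_iff, Set.mem_singleton_iff]
    refine ⟨?_, hcovV v⟩
    rintro ⟨j, u, rfl⟩ h
    have := hfv j u
    rw [h, how] at this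
    exact D.f_ne_w _ this.symm
  · ext v
    simp only [Set.mem_iUnion, Set.mem_range, Set.mem_compl_iff, Set.mem_singleton_iff]
    refine ⟨?_, hcovE v⟩
    rintro ⟨j, u, rfl⟩ h
    have := hfe j u
    rw [h, ho] at this
    exact D.src_ne_w _ (by rw [← this, hB.src_o])
  · intro j k hjk u v h
    have h1 : (x' j).pV u = (x' k).pV v := D.inj_v (by rw [← hfv, h, hfv])
    by_cases hv : ∃ e ∈ D.l, C'.net.src e = (x' j).pV u
    · obtain ⟨E', hE', h2⟩ := hv
      obtain ⟨e, he⟩ := x.exists_root_edge (hrootl _ hE')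
      refine ⟨e, hmemq hE' he, ?_⟩
      refine x.vertex_ext_root ?_ ?_
      · rw [← x.src_comm, he, D.f.src_e, hfv, h2]
      · rw [hfv, ← h2, hB.box_l _ hE']
    · have hv' : ∀ e ∈ D.l, C'.net.src e ≠ (x' j).pV u := fun e he h => hv ⟨e, he, h⟩
      refine absurd (hdisj j k ((x' j).pT u) ((x' k).pT v) ?_) hjk
      rw [← J_neg j _ _ hv', ← J_neg k _ _ hv', ← hft, h, h1, ← hft]
  · intro j k hjk u v h
    have h1 : (x' j).pE u = (x' k).pE v := D.inj_e (by rw [← hfe, h, hfe])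
    by_cases hv : (x' j).pE u ∈ D.l
    · exact hmemq hv (hfe _ _)
    · have hv' := hB.src_of_tgt hv
      refine absurd (hdisj j k ((x' j).pT ((c' j).src u)) ((x' k).pT ((c' k).src v)) ?_) hjk
      rw [← J_neg j _ _ hv', ← J_neg k _ _ hv', (x' j).src_comm, ← hft, ← (x' j).src_comm, h1,
        (x' k).src_comm, ← hft, ← (f j).src_e, h, (f k).src_e]

end

end Glue

namespace Glue

/-! ## Components from nets -/

/-- The laws of box-functions. -/
structure IsBox (N : Net) (τ : BoxTree) (box : N.V → τ.Node) : Prop where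
  edge : ∀ e v, N.tgt e = some v → τ.Below (box (N.src e)) (box v)
  concl : ∀ e, N.tgt e = none → box (N.src e) = τ.root
  border : ∀ e v, N.tgt e = some v → box (N.src e) ≠ box v →
    N.label v = .bang ∨ N.label v = .whynot
  inj : ∀ e e' v v', N.tgt e = some v → N.tgt e' = some v' →
    N.label v = .bang → N.label v' = .bang →
    τ.parent (box (N.src e)) = some (box v) → τ.parent (box (N.src e')) = some (box v') →
    box (N.src e) = box (N.src e') → e = e'

/-- The component given by a net and a box-function. -/
abbrev IsBox.comp {N : Net} {τ : BoxTree} {box : N.V → τ.Node} (h : IsBox N τ box) : Component :=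
  ⟨N, τ, box, h.edge, h.concl, h.border, h.inj⟩

theorem Component.isBox (C : Component) : IsBox C.net C.tree C.box :=
  ⟨C.box_edge, C.box_concl, C.box_border, C.box_inj⟩

/-- All laws pull back except the one on conclusions, which is the hypothesis `hconcl`: a conclusion
of `N'` may be an inner edge of `N`. Injectivity on edges is needed only at edges with a target,
since contractions identify two conclusions. -/
theorem IsBox.comap {N N' : Net} {τ τ' : BoxTree} {box : N.V → τ.Node} (h : IsBox N τ box)
    (f : Net.Hom N' N) (box' : N'.V → τ'.Node) (i : τ'.Node → τ.Node)
    (hbox : ∀ v, box (f.v v) = i (box' v)) (hi : i.Injective)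
    (hbelow : ∀ a b, τ.Below (i a) (i b) → τ'.Below a b)
    (hparent : ∀ a b, τ'.parent a = some b → τ.parent (i a) = some (i b))
    (hinj : ∀ e e' v, N'.tgt e = some v → f.e e = f.e e' → e = e')
    (hconcl : ∀ e, N'.tgt e = none → box' (N'.src e) = τ'.root) : IsBox N' τ' box' where
  edge e v h' := hbelow _ _ (by
    rw [← hbox, ← hbox, ← f.src_e]
    exact h.edge _ _ (f.tgt_e _ _ h'))
  concl := hconcl
  border e v h' hne := by
    rw [← f.label_v]
    refine h.border _ _ (f.tgt_e _ _ h') fun h'' => hne (hi ?_)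
    rw [← hbox, ← hbox, ← f.src_e, h'']
  inj e e' v v' he he' hv hv' hp hp' hb := by
    refine hinj e e' v he (h.inj _ _ _ _ (f.tgt_e _ _ he) (f.tgt_e _ _ he') ?_ ?_ ?_ ?_ ?_)
    · rw [f.label_v, hv]
    · rw [f.label_v, hv']
    · rw [f.src_e, hbox, hbox]; exact hparent _ _ hp
    · rw [f.src_e, hbox, hbox]; exact hparent _ _ hp'
    · rw [f.src_e, f.src_e, hbox, hbox, hb]

/-- A morphism between two components over the same tree that is bijective outside the root, on
the `!`-cells and their inputs, and on the daimons. -/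
structure IsRootStep {N N' : Net} {τ : BoxTree} {box : N.V → τ.Node} {box' : N'.V → τ.Node}
    (h : IsBox N τ box) (h' : IsBox N' τ box') (F : Net.Hom N' N) : Prop where
  comm : ∀ v, box (F.v v) = box' v
  surj : ∀ v, box v ≠ τ.root ∨ N.label v = .bang ∨ (∃ p, N.label v = .daimon p) →
    ∃ v', F.v v' = v
  inj : ∀ v v', F.v v = F.v v' → box' v ≠ τ.root ∨ N'.label v = .bang → v = v'
  tgt : ∀ e v, N.tgt (F.e e) = some v → N.label v = .bang → N'.tgt e ≠ none
  surj_e : ∀ e v, N.tgt e = some v → N.label v = .bang → ∃ e', F.e e' = e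
  inj_e : ∀ e e' v, N'.tgt e = some v → F.e e = F.e e' → e = e'

namespace IsRootStep
theorem lift_bang {N N' : Net} {τ : BoxTree} {box : N.V → τ.Node} {box' : N'.V → τ.Node}
    {h : IsBox N τ box} {h' : IsBox N' τ box'} {F : Net.Hom N' N} (S : IsRootStep h h' F)
    {e : N.E} {v : N.V} (he : N.tgt e = some v) (hv : N.label v = .bang) :
    ∃ e' v', F.e e' = e ∧ F.v v' = v ∧ N'.tgt e' = some v' ∧ N'.label v' = .bang := by
  obtain ⟨e', rfl⟩ := S.surj_e e v he hv
  obtain ⟨v', hv'⟩ := Option.ne_none_iff_exists'.1 (S.tgt e' v he hv)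
  have := F.tgt_e _ _ hv'
  rw [he] at this
  refine ⟨e', v', rfl, (Option.some.inj this).symm, hv', ?_⟩
  rw [← F.label_v, ← Option.some.inj this, hv]

/-- The MELL conditions only see `!`-cells, their inputs, the nodes of the tree, and daimons with
the cells that share their box. A root step is bijective on all of these. -/
theorem isMELL_of {N N' : Net} {τ : BoxTree} {box : N.V → τ.Node} {box' : N'.V → τ.Node}
    {h : IsBox N τ box} {h' : IsBox N' τ box'} {F : Net.Hom N' N} (S : IsRootStep h h' F)
    (hM : h.comp.IsMELL) : h'.comp.IsMELL := by
  obtain ⟨⟨h1, h2, h3⟩, h4⟩ := hM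
  refine ⟨⟨?_, ?_, ?_⟩, ?_⟩
  · intro v hv
    obtain ⟨e, he, hu⟩ := h1 (F.v v) (by rw [← hv]; exact F.label_v v)
    obtain ⟨e', v', rfl, hv', he', hb⟩ := S.lift_bang he (by rw [← hv]; exact F.label_v v)
    have hvv := S.inj v' v hv' (.inr hb)
    subst hvv
    refine ⟨e', he', fun e₁ he₁ => ?_⟩
    exact S.inj_e _ _ _ he₁ (hu _ (F.tgt_e _ _ he₁))
  · intro e v he hv
    have := h2 _ _ (F.tgt_e _ _ he) (by rw [← hv]; exact F.label_v v)
    change τ.parent (box (N.src (F.e e))) = some (box (F.v v)) at this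
    rwa [F.src_e, S.comm, S.comm] at this
  · intro b hb
    obtain ⟨e, v, he, hv, hbox⟩ := h3 b hb
    obtain ⟨e', v', rfl, rfl, he', hb'⟩ := S.lift_bang he hv
    refine ⟨e', v', he', hb', ?_⟩
    change box (N.src (F.e e')) = b at hbox
    rwa [F.src_e, S.comm] at hbox
  · intro v p hv
    obtain ⟨h5, h6⟩ := h4 (F.v v) p (by rw [← hv]; exact F.label_v v)
    change box (F.v v) ≠ τ.root at h6
    rw [S.comm] at h6
    refine ⟨fun w hw => ?_, h6⟩
    change box' w = box' v at hw
    refine S.inj _ _ (h5 _ ?_) (.inl ?_)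
    · change box (F.v w) = box (F.v v)
      rw [S.comm, S.comm, hw]
    · rwa [hw]

theorem isMELL {N N' : Net} {τ : BoxTree} {box : N.V → τ.Node} {box' : N'.V → τ.Node}
    {h : IsBox N τ box} {h' : IsBox N' τ box'} {F : Net.Hom N' N} (S : IsRootStep h h' F)
    (hM : h'.comp.IsMELL) : h.comp.IsMELL := by
  obtain ⟨⟨h1, h2, h3⟩, h4⟩ := hM
  refine ⟨⟨?_, ?_, ?_⟩, ?_⟩
  · intro v hv
    obtain ⟨v, rfl⟩ := S.surj v (.inr (.inl hv))
    obtain ⟨e, he, hu⟩ := h1 v (by rw [← hv]; exact (F.label_v v).symm)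
    refine ⟨F.e e, F.tgt_e _ _ he, fun e₁ he₁ => ?_⟩
    obtain ⟨e', v', rfl, hv', he', hb⟩ := S.lift_bang he₁ hv
    have hvv := S.inj v' v hv' (.inr hb)
    subst hvv
    rw [hu e' he']
  · intro e v he hv
    obtain ⟨e', v', rfl, rfl, he', hb⟩ := S.lift_bang he hv
    have := h2 _ _ he' hb
    change τ.parent (box (N.src (F.e e'))) = some (box (F.v v'))
    rwa [F.src_e, S.comm, S.comm]
  · intro b hb
    obtain ⟨e, v, he, hv, hbox⟩ := h3 b hb
    refine ⟨F.e e, F.v v, F.tgt_e _ _ he, ?_, ?_⟩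
    · rw [← hv]; exact F.label_v v
    · change box (N.src (F.e e)) = b
      rwa [F.src_e, S.comm]
  · intro v p hv
    obtain ⟨v, rfl⟩ := S.surj v (.inr (.inr ⟨p, hv⟩))
    obtain ⟨h5, h6⟩ := h4 v p (by rw [← hv]; exact (F.label_v v).symm)
    change box' v ≠ τ.root at h6
    have hb : box (F.v v) ≠ τ.root := by rwa [S.comm]
    refine ⟨fun w hw => ?_, hb⟩
    change box w = box (F.v v) at hw
    obtain ⟨w, rfl⟩ := S.surj w (.inl (by rwa [hw]))
    rw [S.comm, S.comm] at hw
    rw [h5 w hw]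

end IsRootStep

/-! ## Subnets -/

/-- The part of a net on a set of cells that is closed under predecessors. -/
theorem Net.exists_restrict (c : Net) (S : c.V → Prop)
    (hS : ∀ e v, c.tgt e = some v → S v → S (c.src e)) (l : List c.E) (hnd : l.Nodup)
    (hl : ∀ e, e ∈ l ↔ S (c.src e) ∧ ∀ v, c.tgt e = some v → ¬ S v) :
    ∃ (c' : Net) (f : Net.Hom c' c), f.v.Injective ∧ f.e.Injective ∧ Set.range f.v = {v | S v} ∧
      Set.range f.e = {e | S (c.src e)} ∧ c'.concl.map f.e = l ∧
      ∀ e v, c.tgt (f.e e) = some (f.v v) → c'.tgt e = some v := by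
  have key : ∀ e : {e // S (c.src e)}, ∃ o : Option {v // S v},
      (∀ v, o = some v ↔ c.tgt e.1 = some v.1) := by
    intro e
    by_cases h : ∃ v, c.tgt e.1 = some v ∧ S v
    · obtain ⟨v, hv, hv'⟩ := h
      refine ⟨some ⟨v, hv'⟩, fun u => ?_⟩
      rw [hv, Option.some_inj, Option.some_inj, Subtype.ext_iff]
    · refine ⟨none, fun u => ⟨by simp, fun hu => absurd ⟨u.1, hu, u.2⟩ h⟩⟩
  choose tgt htgt using key
  have hmem : ∀ e ∈ l, S (c.src e) := fun e he => ((hl e).1 he).1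
  refine ⟨⟨{v // S v}, {e // S (c.src e)}, ?_, ?_, fun v => c.label v.1, fun e => c.typ e.1,
    fun e => ⟨c.src e.1, e.2⟩, tgt, fun e => c.first e.1, l.pmap Subtype.mk hmem, ?_, ?_, ?_⟩,
    ⟨Subtype.val, Subtype.val, fun _ => rfl, fun _ => rfl, fun _ => rfl,
      fun e v h => (htgt e v).1 h, fun _ _ _ _ => Iff.rfl⟩, Subtype.val_injective,
      Subtype.val_injective, Subtype.range_val, Subtype.range_val, ?_, fun e v h => (htgt e v).2 h⟩
  · have := c.finite_V; infer_instance
  · have := c.finite_E; infer_instance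
  · exact hnd.pmap (by simp)
  · rintro ⟨e, he⟩
    have : tgt ⟨e, he⟩ = none ↔ ∀ v, c.tgt e = some v → ¬ S v := by
      rw [Option.eq_none_iff_forall_ne_some]
      constructor
      · intro h v hv hv'
        exact h ⟨v, hv'⟩ ((htgt _ _).2 hv)
      · intro h v hv
        exact h v.1 ((htgt _ _).1 hv) v.2
    rw [this]
    simp [hl, he]
  · rintro ⟨v, hv⟩
    refine (c.cell_ok v).pull Subtype.val (fun _ => rfl)
      ⟨?_, Subtype.val_injective.injOn, ?_⟩ (.inl ⟨?_, Subtype.val_injective.injOn, ?_⟩)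
      (fun _ _ _ => Iff.rfl)
    · intro e he
      exact congrArg Subtype.val he
    · rintro e rfl
      exact ⟨⟨e, hv⟩, rfl, rfl⟩
    · intro e he
      exact (htgt _ _).1 he
    · intro e he
      exact ⟨⟨e, hS e v he hv⟩, (htgt _ _).2 he, rfl⟩
  · rw [List.map_pmap]; simp

/-- Removing a cell whose outputs are the last conclusions. -/
theorem Net.exists_removeCell (c : Net) {ℓ : CellType} (w : c.V) (hℓ : c.label w = ℓ)
    (l os as : List c.E) (hc : c.concl = l ++ os)
    (hos : ∀ e, e ∈ os ↔ c.src e = w) (hnd : as.Nodup) (has : ∀ e, e ∈ as ↔ c.tgt e = some w)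
    (hfirst : ℓ.IsBinary → ∃ a b, as = [a, b] ∧ c.first a ∧ ¬ c.first b) :
    ∃ (c' : Net) (D : AddCell ℓ c c'), D.w = w ∧ D.os = os ∧ D.as.map D.f.e = as ∧
      D.l.map D.f.e = l := by
  obtain ⟨hl, -, hdis⟩ := Net.nodup_of_append hc
  have hasw : ∀ e ∈ as, c.src e ≠ w := fun e he h => by
    have h1 : e ∈ c.concl := by rw [hc]; exact List.mem_append_right _ ((hos e).2 h)
    have := Net.tgt_of_mem h1
    rw [(has e).1 he] at this; cases this
  have hlw : ∀ e ∈ l, c.src e ≠ w := fun e he h => hdis he ((hos e).2 h)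
  have hlt : ∀ e ∈ l, c.tgt e = none := fun e he => Net.tgt_of_mem (by rw [hc]; simp [he])
  obtain ⟨c', f, hfv, hfe, hrv, hre, hconcl, htgt⟩ := c.exists_restrict (fun v => v ≠ w)
    (fun e v he _ h => by
      have h1 : e ∈ c.concl := by rw [hc]; exact List.mem_append_right _ ((hos e).2 h)
      rw [Net.tgt_of_mem h1] at he; cases he) (l ++ as)
    (List.nodup_append'.2 ⟨hl, hnd, fun e h1 h2 => by
      have := hlt e h1
      rw [(has e).1 h2] at this; cases this⟩) (fun e => by
      rw [List.mem_append]
      constructor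
      · rintro (h | h)
        · exact ⟨hlw e h, fun v hv => by rw [hlt e h] at hv; cases hv⟩
        · refine ⟨hasw e h, fun v hv => ?_⟩
          rw [(has e).1 h] at hv
          simp [Option.some.inj hv]
      · rintro ⟨h1, h2⟩
        rcases h : c.tgt e with _ | v
        · rw [← c.mem_concl, hc, List.mem_append, hos] at h
          exact .inl (h.resolve_right h1)
        · have := h2 v h
          rw [not_not] at this
          exact .inr ((has e).2 (by rw [h, this])))
  rw [List.map_eq_append_iff] at hconcl
  obtain ⟨l', as', hc', hl', has'⟩ := hconcl
  refine ⟨c', ⟨f, w, l', as', os, hℓ, hfv, hrv, hfe, hre, hc', by rw [hl', hc], ?_, hos, ?_⟩, rfl,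
    rfl, has', hl'⟩
  · intro a ha
    exact (has _).1 (has' ▸ List.mem_map_of_mem ha)
  · intro hb
    obtain ⟨a, b, hab, h1, h2⟩ := hfirst hb
    rw [hab] at has'
    rcases as' with _ | ⟨a', _ | ⟨b', _ | ⟨_, _⟩⟩⟩ <;> simp at has'
    exact ⟨a', b', rfl, by rwa [has'.1], by rwa [has'.2]⟩

/-! ## Adding cells -/

/-- Adding a cell of type `t` below the last conclusions `as`, with outputs of types `Os`. -/
theorem Net.exists_addCell (c : Net) (t : CellType) (l as : List c.E) (hc : c.concl = l ++ as)
    (Os : List Formula)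
    (hok : CellOK (Sum.elim c.typ fun i : Fin Os.length => Os[i])
      (fun e => ∃ e', e = .inl e' ∧ as.head? = some e') t (Sum.inl '' {e | e ∈ as})
      (Set.range Sum.inr)) :
    ∃ (N : Net) (D : AddCell t N c), D.l = l ∧ D.as = as ∧ D.os.map N.typ = Os := by
  -- Among the possible targets, `some none` is the new cell, `some (some v)` an old one, and `none`
  -- marks a conclusion.
  have key : ∀ e : c.E ⊕ Fin Os.length, ∃ o : Option (Option c.V),
      (∀ v, o = some (some v) ↔ ∃ e', e = .inl e' ∧ c.tgt e' = some v) ∧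
      (o = some none ↔ ∃ e', e = .inl e' ∧ e' ∈ as) := by
    rintro (e | i)
    · rcases h : c.tgt e with _ | v
      · by_cases h' : e ∈ as
        · exact ⟨some none, by simp [h], by simp [h']⟩
        · exact ⟨none, by simp [h], by simp [h']⟩
      · refine ⟨some (some v), fun u => by simp [h], ?_⟩
        simp only [Option.some.injEq, reduceCtorEq, Sum.inl.injEq, exists_eq_left', false_iff]
        intro h'
        rw [Net.tgt_of_mem (by rw [hc]; exact List.mem_append_right _ h')] at h; cases h
    · exact ⟨none, by simp, by simp⟩
  choose tgt htgt htgt' using key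
  have hnd := Net.nodup_of_append hc
  have hinl : ∀ e, tgt (.inl e) = none ↔ e ∈ l := by
    intro e
    constructor
    · intro h
      rcases h' : c.tgt e with _ | v
      · rw [← c.mem_concl, hc, List.mem_append] at h'
        refine h'.resolve_right fun h' => ?_
        rw [(htgt' _).2 ⟨e, rfl, h'⟩] at h; cases h
      · rw [(htgt _ v).2 ⟨e, rfl, h'⟩] at h; cases h
    · intro h
      rcases h' : tgt (.inl e) with _ | _ | v
      · rfl
      · obtain ⟨_, h1, h2⟩ := (htgt' _).1 h'
        cases h1
        exact absurd h2 (hnd.2.2 h)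
      · obtain ⟨_, h1, h2⟩ := (htgt _ v).1 h'
        cases h1
        rw [Net.tgt_of_mem (by rw [hc]; exact List.mem_append_left _ h)] at h2; cases h2
  have hinr : ∀ i, tgt (.inr i) = none := by
    intro i
    rcases h' : tgt (.inr i) with _ | _ | v
    · rfl
    · obtain ⟨_, h1, h2⟩ := (htgt' _).1 h'; cases h1
    · obtain ⟨_, h1, h2⟩ := (htgt _ v).1 h'; cases h1
  -- The head of `as` becomes the first input of the new cell, overriding any earlier mark; the
  -- other old edges keep theirs, as their targets do not change.
  refine ⟨⟨Option c.V, c.E ⊕ Fin Os.length, ?_, ?_, fun v => v.elim t c.label,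
    Sum.elim c.typ fun i => Os[i], Sum.elim (some ∘ c.src) fun _ => none, tgt,
    fun e => ∃ e', e = .inl e' ∧ ((e' ∈ as ∧ as.head? = some e') ∨ (e' ∉ as ∧ c.first e')),
    l.map .inl ++ (List.finRange _).map .inr, ?_, ?_, ?_⟩,
    ⟨⟨some, .inl, fun _ => rfl, fun _ => rfl, fun _ => rfl,
      fun e v h => (htgt _ _).2 ⟨e, rfl, h⟩, ?_⟩, none, l, as, (List.finRange _).map .inr, rfl,
      Option.some_injective _, ?_, Sum.inl_injective, ?_, hc, rfl,
      fun a ha => (htgt' _).2 ⟨a, rfl, ha⟩, ?_, ?_⟩, rfl, rfl, ?_⟩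
  · have := c.finite_V; infer_instance
  · have := c.finite_E; infer_instance
  · refine List.nodup_append'.2 ⟨hnd.1.map Sum.inl_injective,
      (List.nodup_finRange _).map Sum.inr_injective, ?_⟩
    intro e h1 h2
    obtain ⟨_, -, rfl⟩ := List.mem_map.1 h1
    simp at h2
  · rintro (e | i)
    · simp [hinl]
    · simp [hinr]
  · rintro (_ | v)
    · have h1 : {e | tgt e = some none} = Sum.inl '' {e | e ∈ as} := by
        ext e
        simp only [Set.mem_ofPred_eq, htgt', Set.mem_image]
        exact ⟨fun ⟨e', h, h'⟩ => ⟨e', h', h.symm⟩, fun ⟨e', h, h'⟩ => ⟨e', h'.symm, h⟩⟩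
      have h2 : {e : c.E ⊕ Fin Os.length | Sum.elim (some ∘ c.src) (fun _ => none) e = none} =
          Set.range Sum.inr := by
        ext (e | e) <;> simp
      rw [h1, h2]
      refine hok.push id (fun _ => rfl) Function.injective_id.injOn (by simp) (by simp) ?_
      rintro _ ⟨e, he, rfl⟩ -
      have he' : e ∈ as := he
      simp [he']
    · refine (c.cell_ok v).push Sum.inl (fun _ => rfl) Sum.inl_injective.injOn ?_ ?_ ?_
      · ext (e | e) <;> simp
      · ext e
        simp only [Set.mem_ofPred_eq, htgt, Set.mem_image]
        exact ⟨fun ⟨e', h, h'⟩ => ⟨e', h', h.symm⟩, fun ⟨e', h, h'⟩ => ⟨e', h'.symm, h⟩⟩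
      · intro e he _
        have he' : e ∉ as := fun h => by
          have h1 : c.tgt e = some v := he
          rw [Net.tgt_of_mem (by rw [hc]; exact List.mem_append_right _ h)] at h1; cases h1
        simp [he']
  · intro e v he _
    have he' : e ∉ as := fun h => by
      rw [Net.tgt_of_mem (by rw [hc]; exact List.mem_append_right _ h)] at he; cases he
    simp [he']
  · ext (_ | v) <;> simp
  · ext (e | i) <;> simp
  · rintro (e | i) <;> simp
  · intro hb
    -- The typing condition speaks of the set of inputs. Since `as` has no repetition and its head
    -- is the input marked as first, the list is determined.
    have : ∃ a b, as = [a, b] := by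
      rcases hb with rfl | rfl
      all_goals
        obtain ⟨a, b, o, h1, h2, h3, -⟩ := hok
        obtain ⟨a', rfl, ha⟩ := h2
        have hb' : b ∈ Sum.inl '' {e | e ∈ as} := by rw [h1]; simp
        obtain ⟨b', hb', rfl⟩ := hb'
        have hab : a' ≠ b' := by
          rintro rfl
          exact h3 ⟨_, rfl, ha⟩
        rcases as with _ | ⟨x, _ | ⟨y, as⟩⟩
        · simp at ha
        · simp at ha hb'
          exact absurd (ha.symm.trans hb'.symm) hab
        · obtain rfl : x = a' := by simpa using ha
          have hy : Sum.inl y ∈ (Sum.inl '' {e | e ∈ x :: y :: as} : Set (c.E ⊕ Fin Os.length)) :=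
            ⟨y, by simp, rfl⟩
          rw [h1] at hy
          have hyx : y ≠ x := by
            rintro rfl
            have := hnd.2.1
            simp at this
          simp [hyx] at hy
          subst hy
          rcases as with _ | ⟨z, as⟩
          · exact ⟨_, _, rfl⟩
          · have hz : Sum.inl z ∈
                (Sum.inl '' {e | e ∈ x :: y :: z :: as} : Set (c.E ⊕ Fin Os.length)) :=
              ⟨z, by simp, rfl⟩
            rw [h1] at hz
            have := hnd.2.1
            simp at hz this
            rcases hz with rfl | rfl <;> simp at this
    obtain ⟨a, b, rfl⟩ := this
    refine ⟨a, b, rfl, ⟨a, rfl, .inl ⟨by simp, rfl⟩⟩, ?_⟩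
    rintro ⟨e, h1, h2⟩
    cases h1
    have := hnd.2.1
    simp at h2 this
    exact this h2
  · rw [List.map_map]
    apply List.ext_getElem <;> simp

end Glue

namespace Glue

/-- The Taylor expansion of one component. -/
def Component.taylor (C : Component) : Set Net := {c | ∃ t, Nonempty (Expansion C t c)}

theorem Component.type_of_mem_taylor {C : Component} {c : Net} (h : c ∈ C.taylor) :
    c.type = C.net.type := by
  obtain ⟨t, ⟨x⟩⟩ := h
  exact x.type_eq

theorem Component.mem_taylor_of_iso {C : Component} {c d : Net} (h : c ∈ C.taylor)
    (hd : Net.Iso d c) : d ∈ C.taylor := by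
  obtain ⟨t, ⟨x⟩⟩ := h
  exact ⟨t, x.of_iso hd⟩

/-! ## The cell at the last conclusion and the elementary paths -/

theorem Net.out_unique_binary {c : Net} {e e' : c.E} (h : (c.label (c.src e)).IsBinary)
    (he : c.src e' = c.src e) : e' = e := by
  have hok := c.cell_ok (c.src e)
  have : ∃ o, {e' | c.src e' = c.src e} = {o} := by
    rcases h with h | h <;> rw [h] at hok <;> obtain ⟨_, _, o, -, -, -, ho, -⟩ := hok <;>
      exact ⟨o, ho⟩
  obtain ⟨o, ho⟩ := this
  have h1 : e ∈ ({o} : Set c.E) := ho ▸ rfl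
  have h2 : e' ∈ ({o} : Set c.E) := ho ▸ he
  exact h2.trans h1.symm

/-- The rules for `cut`, the binary cells and dereliction differ only in the label and in the
numbers of inputs and outputs; as instances of `AddCell` they share their proofs. The output list is
empty here because typing gives a `cut`-cell no output. -/
theorem RemoveCut.exists_addCell {c c' : Net} (h : RemoveCut c c') :
    ∃ D : AddCell .cut c c', D.as.length = 2 ∧ D.os = [] := by
  obtain ⟨f, w, hw, hfv, hrv, hfe, l, a, b, hc', hc, ha, hb⟩ := h
  have hout : ∀ e, c.src e ≠ w := by
    intro e he
    have hok := c.cell_ok w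
    rw [hw] at hok
    have : e ∈ {e | c.src e = w} := he
    rw [hok.1] at this
    exact this
  refine ⟨⟨f, w, l, [a, b], [], hw, hfv, hrv, hfe.1, ?_, hc', by simpa using hc, ?_, ?_, ?_⟩, rfl,
    rfl⟩
  · rw [hfe.2.range_eq]
    exact (Set.eq_univ_of_forall hout).symm
  · simp [ha, hb]
  · simp [hout]
  · rintro (h | h) <;> cases h

theorem AddCell.removeCut {c c' : Net} (D : AddCell .cut c c') (h : D.as.length = 2)
    (h' : D.os.length = 0) : RemoveCut c c' := by
  obtain ⟨a, b, hab⟩ := List.length_eq_two.1 h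
  have hos := List.length_eq_zero_iff.1 h'
  refine ⟨D.f, D.w, D.label_w, D.inj_v, D.range_v, ⟨D.inj_e, ?_⟩, D.l, a, b, ?_, ?_, ?_, ?_⟩
  · intro e
    rcases D.eq_or_e e with h | h
    · rw [hos] at h; cases h
    · exact h
  · rw [D.concl', hab]
  · rw [D.concl, hos, List.append_nil]
  · exact D.tgt_as _ (by simp [hab])
  · exact D.tgt_as _ (by simp [hab])

theorem RemoveBinary.exists_addCell {t : CellType} (ht : t.IsBinary) {c c' : Net}
    (h : RemoveBinary t c c') :
    ∃ D : AddCell t c c', D.as.length = 2 ∧ D.os.length = 1 := by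
  obtain ⟨f, l, a, b, o, hw, hfv, hrv, hfe, hre, hc', hc, ha, hb, h1, h2⟩ := h
  have hout : ∀ e, e = o ↔ c.src e = c.src o := fun e =>
    ⟨fun h => h ▸ rfl, Net.out_unique_binary (by rwa [hw])⟩
  refine ⟨⟨f, c.src o, l, [a, b], [o], hw, hfv, hrv, hfe, ?_, hc', hc, ?_, ?_, ?_⟩, rfl,
    rfl⟩
  · rw [hre]; ext e; simp [hout]
  · simp [ha, hb]
  · simp [hout]
  · exact fun _ => ⟨a, b, rfl, h1, h2⟩

theorem AddCell.removeBinary {t : CellType} (ht : t.IsBinary) {c c' : Net} (D : AddCell t c c')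
    (h' : D.os.length = 1) : RemoveBinary t c c' := by
  obtain ⟨a, b, hab, h1, h2⟩ := D.first ht
  obtain ⟨o, hos⟩ := List.length_eq_one_iff.1 h'
  have ho : c.src o = D.w := (D.mem_os o).1 (by simp [hos])
  refine ⟨D.f, D.l, a, b, o, ?_, D.inj_v, ?_, D.inj_e, ?_, ?_, ?_, ?_, ?_, h1, h2⟩
  · rw [ho, D.label_w]
  · rw [ho, D.range_v]
  · rw [D.range_e]; ext e
    have := D.mem_os e
    simp [hos] at this
    simp [this]
  · rw [D.concl', hab]
  · rw [D.concl, hos]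
  · rw [ho]; exact D.tgt_as _ (by simp [hab])
  · rw [ho]; exact D.tgt_as _ (by simp [hab])

theorem RemoveDereliction.exists_addCell {c c' : Net} (h : RemoveDereliction c c') :
    ∃ D : AddCell .whynot c c', D.as.length = 1 ∧ D.os.length = 1 := by
  obtain ⟨f, l, a, o, hw, hfv, hrv, hfe, hre, hc', hc, ha⟩ := h
  have hout : ∀ e, e = o ↔ c.src e = c.src o := fun e =>
    ⟨fun h => h ▸ rfl, Net.out_unique (.inl hw)⟩
  refine ⟨⟨f, c.src o, l, [a], [o], hw, hfv, hrv, hfe, ?_, hc', hc, ?_, ?_, ?_⟩, rfl,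
    rfl⟩
  · rw [hre]; ext e; simp [hout]
  · simp [ha]
  · simp [hout]
  · rintro (h | h) <;> cases h

theorem AddCell.removeDereliction {c c' : Net} (D : AddCell .whynot c c') (h : D.as.length = 1)
    (h' : D.os.length = 1) : RemoveDereliction c c' := by
  obtain ⟨a, hab⟩ := List.length_eq_one_iff.1 h
  obtain ⟨o, hos⟩ := List.length_eq_one_iff.1 h'
  have ho : c.src o = D.w := (D.mem_os o).1 (by simp [hos])
  refine ⟨D.f, D.l, a, o, ?_, D.inj_v, ?_, D.inj_e, ?_, ?_, ?_, ?_⟩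
  · rw [ho, D.label_w]
  · rw [ho, D.range_v]
  · rw [D.range_e]; ext e
    have := D.mem_os e
    simp [hos] at this
    simp [this]
  · rw [D.concl', hab]
  · rw [D.concl, hos]
  · rw [ho]; exact D.tgt_as _ (by simp [hab])

/-! ## Adding a cell to a component -/

section
variable {N N' : Net} {τ : BoxTree} {box : N.V → τ.Node} {box' : N'.V → τ.Node}
  {ℓ : CellType} {D : AddCell ℓ N N'}

theorem AddCell.isRootStep (h : IsBox N τ box) (h' : IsBox N' τ box')
    (hbox : ∀ v, box (D.f.v v) = box' v) (hw : box D.w = τ.root) (hb : ℓ ≠ .bang)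
    (hd : ∀ p, ℓ ≠ .daimon p) : IsRootStep h h' D.f where
  comm := hbox
  surj v hv := by
    rcases D.eq_or v with rfl | h
    · rw [D.label_w] at hv
      rcases hv with h | h | ⟨p, h⟩
      exacts [absurd hw h, absurd h hb, absurd h (hd p)]
    · exact h
  inj v v' hv _ := D.inj_v hv
  tgt e v he hv := by
    rcases D.tgt_cases e with ⟨u, hu, -⟩ | ⟨-, h⟩ | ⟨-, h⟩
    · rw [hu]; simp
    · rw [he] at h
      rw [Option.some.inj h, D.label_w] at hv
      exact absurd hv hb
    · rw [he] at h; cases h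
  surj_e e v he hv := by
    rcases D.eq_or_e e with h | h
    · rw [D.tgt_os h] at he; cases he
    · exact h
  inj_e e e' _ _ h := D.inj_e h

/-- Expanding the larger component along the same thick subtree gives a net that also becomes `c'`
when the cell is removed; `AddCell.iso` identifies it with `c`. Contraction, juxtaposition and boxes
follow the same pattern. -/
theorem AddCell.mem_taylor (h : IsBox N τ box) (h' : IsBox N' τ box')
    (hbox : ∀ v, box (D.f.v v) = box' v) (hw : box D.w = τ.root) {c c' : Net}
    (hc' : c' ∈ h'.comp.taylor) (D' : AddCell ℓ c c') (has : D'.as.length = D.as.length)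
    (hos : D'.os.map c.typ = D.os.map N.typ) : c ∈ h.comp.taylor := by
  obtain ⟨t, ⟨x'⟩⟩ := hc'
  obtain ⟨c₀, ⟨x⟩⟩ := exists_expansion h.comp t
  obtain ⟨D₀, h1, h2⟩ := x.addCell x' D id Function.bijective_id
    (fun v s => by
      change box' v = _ ↔ box (D.f.v v) = _
      rw [hbox]; rfl) (fun _ _ h => h) hw
  refine ⟨t, x.of_iso (D'.iso D₀ ?_ ?_)⟩
  · rw [has, ← h1, List.length_map]
  · rw [hos, ← h2, List.map_map]
    exact List.map_congr_left fun e _ => (x.typ_comm e).symm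

theorem AddCell.exists_mem_taylor (h : IsBox N τ box) (h' : IsBox N' τ box')
    (hbox : ∀ v, box (D.f.v v) = box' v) (hw : box D.w = τ.root) {c : Net}
    (hc : c ∈ h.comp.taylor) : ∃ c' ∈ h'.comp.taylor, ∃ D' : AddCell ℓ c c',
      D'.as.length = D.as.length ∧ D'.os.length = D.os.length := by
  obtain ⟨t, ⟨x⟩⟩ := hc
  obtain ⟨c', ⟨x'⟩⟩ := exists_expansion h'.comp t
  obtain ⟨D₀, h1, h2⟩ := x.addCell x' D id Function.bijective_id
    (fun v s => by
      change box' v = _ ↔ box (D.f.v v) = _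
      rw [hbox]; rfl) (fun _ _ h => h) hw
  exact ⟨c', ⟨t, ⟨x'⟩⟩, D₀, by rw [← h1, List.length_map], by rw [← h2, List.length_map]⟩

/-- The box-function of a net with a new cell at the root. -/
theorem AddCell.exists_box (D : AddCell ℓ N N') (h' : IsBox N' τ box') (hb : ℓ ≠ .bang) :
    ∃ box : N.V → τ.Node, IsBox N τ box ∧ (∀ v, box (D.f.v v) = box' v) ∧ box D.w = τ.root := by
  have key : ∀ v, ∃ b, (v = D.w → b = τ.root) ∧ ∀ v', D.f.v v' = v → b = box' v' := by
    intro v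
    rcases D.eq_or v with rfl | ⟨v, rfl⟩
    · exact ⟨τ.root, fun _ => rfl, fun v' h => absurd h (D.f_ne_w v')⟩
    · exact ⟨box' v, fun h => absurd h (D.f_ne_w v), fun v' h => by rw [D.inj_v h]⟩
  choose box hbw hbf using key
  have hw := hbw _ rfl
  have hf := fun v => hbf _ v rfl
  -- The inputs of the new cell were conclusions, so they start over the root and cross no border of
  -- a box.
  have has : ∀ a ∈ D.as, box' (N'.src a) = τ.root := fun a ha =>
    h'.concl _ (Net.tgt_of_mem (by rw [D.concl']; exact List.mem_append_right _ ha))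
  have hcases : ∀ e v, N.tgt e = some v → (v = D.w ∧ box (N.src e) = τ.root) ∨
      ∃ e' v', D.f.e e' = e ∧ D.f.v v' = v ∧ N'.tgt e' = some v' := by
    intro e v he
    rcases D.eq_or v with rfl | ⟨v, rfl⟩
    · obtain ⟨a, ha, rfl⟩ := D.tgt_eq_w he
      exact .inl ⟨rfl, by rw [D.f.src_e, hf, has a ha]⟩
    · obtain ⟨e', rfl, he'⟩ := D.tgt_eq_f he
      exact .inr ⟨e', v, rfl, rfl, he'⟩
  refine ⟨box, ⟨?_, ?_, ?_, ?_⟩, hf, hw⟩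
  · intro e v he
    rcases hcases e v he with ⟨rfl, h⟩ | ⟨e, v, rfl, rfl, h⟩
    · rw [h, hw]; exact .refl _
    · rw [D.f.src_e, hf, hf]; exact h'.edge _ _ h
  · intro e he
    rcases D.eq_or_e e with h | ⟨e, rfl⟩
    · rw [(D.mem_os e).1 h, hw]
    · rw [D.f.src_e, hf]
      rcases D.tgt_cases e with ⟨u, -, h⟩ | ⟨-, h⟩ | ⟨h, -⟩
      · rw [h] at he; cases he
      · rw [h] at he; cases he
      · exact h'.concl _ (Net.tgt_of_mem (by rw [D.concl']; exact List.mem_append_left _ h))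
  · intro e v he hne
    rcases hcases e v he with ⟨rfl, h⟩ | ⟨e, v, rfl, rfl, h⟩
    · rw [h, hw] at hne; exact absurd rfl hne
    · rw [D.f.src_e, hf, hf] at hne
      rw [D.f.label_v]
      exact h'.border _ _ h hne
  · intro e e' v v' he he' hv hv' hp hp' hbb
    rcases hcases e v he with ⟨rfl, h⟩ | ⟨e, v, rfl, rfl, h⟩
    · exact absurd (D.label_w.symm.trans hv) hb
    rcases hcases e' v' he' with ⟨rfl, h1⟩ | ⟨e', v', rfl, rfl, h1⟩
    · exact absurd (D.label_w.symm.trans hv') hb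
    rw [D.f.src_e, hf, hf] at hp hp'
    rw [D.f.src_e, D.f.src_e, hf, hf] at hbb
    rw [D.f.label_v] at hv hv'
    rw [h'.inj _ _ _ _ h h1 hv hv' hp hp' hbb]

end

/-- The nets without daimons of a zone belong to the Taylor expansion of a given component
(`none` stands for a component that consists of one daimon). -/
def InZone (o : Option Component) (c : Net) : Prop := c.NoDaimon → ∃ C ∈ o, c ∈ C.taylor

/-- The component of a zone of type `L` is in MELL. -/
def ZoneOK (L : List Formula) (o : Option Component) : Prop :=
  ∀ C ∈ o, C.IsMELL ∧ C.net.type = L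

/-- A daimon of `c'` is still in `c`, so `none` can be kept. Otherwise the cell is added over the
root of the component; a `!`-cell is excluded because it would need a new box. -/
theorem AddCell.exists_zone {ℓ : CellType} (hb : ℓ ≠ .bang) (hd : ∀ p, ℓ ≠ .daimon p)
    {L ins outs : List Formula}
    (hok : ∀ (E : Type) (typ : E → Formula) (as : List E), as.Nodup → as.map typ = ins →
      CellOK (Sum.elim typ fun i : Fin outs.length => outs[i])
        (fun e => ∃ e', e = .inl e' ∧ as.head? = some e') ℓ (Sum.inl '' {e | e ∈ as})
        (Set.range Sum.inr))
    {o' : Option Component} (ho' : ZoneOK (L ++ ins) o') :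
    ∃ o, ZoneOK (L ++ outs) o ∧ ∀ c c' (D : AddCell ℓ c c'), D.as.length = ins.length →
      D.os.map c.typ = outs → InZone o' c' → InZone o c := by
  rcases o' with _ | C'
  · refine ⟨none, by simp [ZoneOK], fun c c' D _ _ h hc => ?_⟩
    obtain ⟨_, ⟨⟩, -⟩ := h (D.f.noDaimon hc)
  · obtain ⟨hM, ht⟩ := ho' C' rfl
    rw [Net.type, List.map_eq_append_iff] at ht
    obtain ⟨l, as, hc, hl, has⟩ := ht
    obtain ⟨N, D, rfl, rfl, hos⟩ := C'.net.exists_addCell ℓ l as hc outs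
      (hok _ _ _ (Net.nodup_of_append hc).2.1 has)
    obtain ⟨box, h, hbox, hw⟩ := D.exists_box C'.isBox hb
    refine ⟨some h.comp, ?_, ?_⟩
    · rintro _ ⟨⟩
      refine ⟨(AddCell.isRootStep h C'.isBox hbox hw hb hd).isMELL hM, ?_⟩
      rw [Net.type, D.concl, List.map_append, hos, List.map_map, ← hl]
      congr 1
      exact List.map_congr_left fun e _ => D.f.typ_e e
    · intro c c' D' has' hos' hc' hc
      obtain ⟨_, ⟨⟩, h1⟩ := hc' (D'.f.noDaimon hc)
      refine ⟨_, rfl, AddCell.mem_taylor h C'.isBox hbox hw h1 D' ?_ ?_⟩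
      · rw [has', ← has, List.length_map]
      · rw [hos', hos]

/-! ## The size of a net -/

/-- The number of cells and of ordered pairs of distinct edges with the same target. -/
noncomputable def Net.size (c : Net) : ℕ :=
  Nat.card c.V + {p : c.E × c.E | p.1 ≠ p.2 ∧ ∃ v, c.tgt p.1 = some v ∧ c.tgt p.2 = some v}.ncard

theorem Net.Hom.size_lt {c c' : Net} (f : Net.Hom c' c) (hv : f.v.Injective) (he : f.e.Injective)
    {w : c.V} (hw : ∀ v, f.v v ≠ w) : c'.size < c.size := by
  have := c.finite_V
  have := c.finite_E
  refine Nat.add_lt_add_of_lt_of_le ?_ ?_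
  · have h := Nat.card_le_card_of_injective (fun o : Option c'.V => o.elim w f.v) ?_
    · have := Finite.of_injective f.v hv
      have := Finite.card_option (α := c'.V)
      omega
    · rintro (_ | a) (_ | b) h
      · rfl
      · exact absurd h.symm (hw b)
      · exact absurd h (hw a)
      · exact congrArg some (hv h)
  · refine Set.ncard_le_ncard_of_injOn (Prod.map f.e f.e) ?_ (he.prodMap he).injOn (Set.toFinite _)
    rintro ⟨a, b⟩ ⟨h1, v, h2, h3⟩
    exact ⟨fun h => h1 (he h), f.v v, f.tgt_e _ _ h2, f.tgt_e _ _ h3⟩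

/-- The inputs of the removed cell become conclusions, so they must start over the root, which is
`hasr`. If there is an input, its source remains and the new component still has a cell. -/
theorem Component.IsMELL.exists_removeCell {C : Component} (hM : C.IsMELL) {w : C.net.V}
    {ℓ : CellType} (hℓ : C.net.label w = ℓ)
    (hw : C.box w = C.tree.root) (hb : ℓ ≠ .bang) {l os as : List C.net.E}
    (hc : C.net.concl = l ++ os) (hos : ∀ e, e ∈ os ↔ C.net.src e = w) (hnd : as.Nodup)
    (has : ∀ e, e ∈ as ↔ C.net.tgt e = some w)
    (hasr : ∀ e ∈ as, C.box (C.net.src e) = C.tree.root)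
    (hfirst : ℓ.IsBinary → ∃ a b, as = [a, b] ∧ C.net.first a ∧ ¬ C.net.first b) :
    ∃ C' : Component, C'.IsMELL ∧ C'.net.type = (l ++ as).map C.net.typ ∧
      C'.net.size < C.net.size ∧ (as ≠ [] → Nonempty C'.net.V) ∧
      ∀ c ∈ C.taylor, ∃ c' ∈ C'.taylor, ∃ D : AddCell ℓ c c',
        D.as.length = as.length ∧ D.os.length = os.length := by
  obtain ⟨N', D, rfl, rfl, h1, h2⟩ := C.net.exists_removeCell w hℓ l os as hc hos hnd has hfirst
  have h' : IsBox N' C.tree (fun v => C.box (D.f.v v)) := by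
    refine C.isBox.comap D.f _ id (fun _ => rfl) Function.injective_id (fun _ _ h => h)
      (fun _ _ h => h) (fun _ _ _ _ h => D.inj_e h) fun e he => ?_
    rw [← D.f.src_e]
    rcases D.tgt_cases e with ⟨u, h, -⟩ | ⟨h, -⟩ | ⟨-, h⟩
    · rw [h] at he; cases he
    · exact hasr _ (h1 ▸ List.mem_map_of_mem h)
    · exact C.box_concl _ h
  have hd : ∀ p, ℓ ≠ .daimon p := fun p h => (hM.2 _ p (hℓ.trans h)).2 hw
  refine ⟨h'.comp, ?_, ?_, D.f.size_lt D.inj_v D.inj_e D.f_ne_w, ?_, ?_⟩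
  · exact (AddCell.isRootStep C.isBox h' (fun _ => rfl) hw hb hd).isMELL_of hM
  · rw [Net.type, D.concl', List.map_append, List.map_append, ← h1, ← h2, List.map_map,
      List.map_map]
    congr 1 <;> exact List.map_congr_left fun e _ => (D.f.typ_e e).symm
  · intro h
    rcases hD : D.as with _ | ⟨a, _⟩
    · rw [hD] at h1; exact absurd h1.symm h
    · exact ⟨N'.src a⟩
  · intro c hc
    obtain ⟨c', hc', D', h3, h4⟩ :=
      AddCell.exists_mem_taylor C.isBox h' (fun _ => rfl) hw hc
    exact ⟨c', hc', D', by rw [h3, ← h1, List.length_map], h4⟩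

end Glue

/-! ### Cells with an output of type `?A` -/

namespace Glue

/-- Axioms are atomic, and the label of every other cell except a daimon fixes the main connective
of its output. -/
theorem Net.label_of_typ_whynot {c : Net} {e : c.E} {A : Formula} (h : c.typ e = .whynot A) :
    c.label (c.src e) = .whynot ∨ ∃ p, c.label (c.src e) = .daimon p := by
  have hok := c.cell_ok (c.src e)
  have he : e ∈ {e' | c.src e' = c.src e} := rfl
  generalize {e' | c.src e' = c.src e} = outs at hok he
  cases hl : c.label (c.src e) <;> rw [hl] at hok
  case whynot => exact .inl rfl
  case daimon p => exact .inr ⟨p, rfl⟩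
  case ax =>
    obtain ⟨-, a, b, X, rfl, ha, hb⟩ := hok
    rcases he with rfl | rfl
    · rw [h] at ha; cases ha
    · rw [h] at hb; cases hb
  case cut =>
    obtain ⟨rfl, -⟩ := hok
    cases he
  case one =>
    obtain ⟨-, o, rfl, ho⟩ := hok
    obtain rfl := he
    rw [h] at ho; cases ho
  case bot =>
    obtain ⟨-, o, rfl, ho⟩ := hok
    obtain rfl := he
    rw [h] at ho; cases ho
  case tensor =>
    obtain ⟨_, _, o, -, -, -, rfl, ho⟩ := hok
    obtain rfl := he
    rw [h] at ho; cases ho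
  case par =>
    obtain ⟨_, _, o, -, -, -, rfl, ho⟩ := hok
    obtain rfl := he
    rw [h] at ho; cases ho
  case bang =>
    obtain ⟨o, _, rfl, ho, -⟩ := hok
    obtain rfl := he
    rw [h] at ho; cases ho

/-- Conclusions start over the root, where MELL admits no daimon. -/
theorem Component.IsMELL.label_of_typ_whynot {C : Component} (hM : C.IsMELL) {e : C.net.E}
    (he : e ∈ C.net.concl) {A : Formula} (h : C.net.typ e = .whynot A) :
    C.net.label (C.net.src e) = .whynot := by
  rcases Net.label_of_typ_whynot h with h | ⟨p, h⟩
  · exact h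
  · exact absurd (C.box_of_mem he) (hM.2 _ p h).2

/-! ## Contraction on components -/

/-- The data of `SplitContraction`. -/
structure Contraction (c c' : Net) where
  f : Net.Hom c' c
  l : List c'.E
  a : c'.E
  b : c'.E
  o : c.E
  label_a : c'.label (c'.src a) = .whynot
  label_b : c'.label (c'.src b) = .whynot
  concl' : c'.concl = l ++ [a, b]
  concl : c.concl = l.map f.e ++ [o]
  f_a : f.e a = o
  f_b : f.e b = o
  surj_v : f.v.Surjective
  surj_e : f.e.Surjective
  ker_v : ∀ x y, f.v x = f.v y → x = y ∨ (x = c'.src a ∧ y = c'.src b) ∨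
    (x = c'.src b ∧ y = c'.src a)
  ker_e : ∀ x y, f.e x = f.e y → x = y ∨ (x = a ∧ y = b) ∨ (x = b ∧ y = a)

theorem SplitContraction.exists_contraction {c c' : Net} (h : SplitContraction c c') :
    Nonempty (Contraction c c') := by
  obtain ⟨f, l, a, b, o, h1, h2, h3, h4, h5, h6, h7, h8, h9, h10⟩ := h
  exact ⟨⟨f, l, a, b, o, h1, h2, h3, h4, h5, h6, h7, h8, h9, h10⟩⟩

namespace Contraction

theorem tgt_a {c c' : Net} (D : Contraction c c') : c'.tgt D.a = none :=
  Net.tgt_of_mem (by rw [D.concl']; simp)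

theorem tgt_b {c c' : Net} (D : Contraction c c') : c'.tgt D.b = none :=
  Net.tgt_of_mem (by rw [D.concl']; simp)

theorem inj_e {c c' : Net} (D : Contraction c c') (e e' : c'.E) (v : c'.V) (h : c'.tgt e = some v)
    (h' : D.f.e e = D.f.e e') : e = e' := by
  rcases D.ker_e _ _ h' with h1 | ⟨rfl, -⟩ | ⟨rfl, -⟩
  · exact h1
  · rw [D.tgt_a] at h; cases h
  · rw [D.tgt_b] at h; cases h

theorem tgt_none {c c' : Net} (D : Contraction c c') {e : c'.E} (h : c'.tgt e = none) :
    c.tgt (D.f.e e) = none := by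
  rw [← c'.mem_concl, D.concl'] at h
  apply Net.tgt_of_mem
  rw [D.concl]
  simp only [List.mem_append, List.mem_cons, List.not_mem_nil, or_false] at h ⊢
  rcases h with h | rfl | rfl
  · exact .inl (List.mem_map_of_mem h)
  · exact .inr D.f_a
  · exact .inr D.f_b

theorem lift {c c' : Net} (D : Contraction c c') {e : c.E} {v : c.V} (h : c.tgt e = some v) :
    ∃ e' v', D.f.e e' = e ∧ D.f.v v' = v ∧ c'.tgt e' = some v' := by
  obtain ⟨e', rfl⟩ := D.surj_e e
  rcases h' : c'.tgt e' with _ | u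
  · rw [D.tgt_none h'] at h; cases h
  · have := D.f.tgt_e _ _ h'
    rw [h] at this
    exact ⟨e', u, rfl, (Option.some.inj this).symm, h'⟩

section
variable {N N' : Net} {τ : BoxTree} {box : N.V → τ.Node} {box' : N'.V → τ.Node}
  {D : Contraction N N'}

theorem isRootStep (h : IsBox N τ box) (h' : IsBox N' τ box')
    (hbox : ∀ v, box (D.f.v v) = box' v) : IsRootStep h h' D.f where
  comm := hbox
  surj v _ := D.surj_v v
  inj v v' hv h1 := by
    have ha := h'.concl _ D.tgt_a
    have hb := h'.concl _ D.tgt_b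
    rcases D.ker_v _ _ hv with h2 | ⟨rfl, rfl⟩ | ⟨rfl, rfl⟩
    · exact h2
    · rw [D.label_a, ha] at h1; simp at h1
    · rw [D.label_b, hb] at h1; simp at h1
  tgt e v he _ h' := by rw [D.tgt_none h'] at he; cases he
  surj_e e _ _ _ := D.surj_e e
  inj_e := D.inj_e

theorem mem_taylor (h : IsBox N τ box) (h' : IsBox N' τ box')
    (hbox : ∀ v, box (D.f.v v) = box' v) {c c' : Net}
    (hc' : c' ∈ h'.comp.taylor) (hD : SplitContraction c c') : c ∈ h.comp.taylor := by
  obtain ⟨t, ⟨x'⟩⟩ := hc'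
  obtain ⟨c₀, ⟨x⟩⟩ := exists_expansion h.comp t
  refine ⟨t, x.of_iso (hD.iso (x.splitContraction x' D.f D.label_a D.label_b D.concl' D.concl
    D.f_a D.f_b D.surj_v D.surj_e D.ker_v D.ker_e id Function.bijective_id (fun v s => ?_)
    (fun _ _ h => h)))⟩
  change box' v = _ ↔ box (D.f.v v) = _
  rw [hbox]; rfl

theorem exists_mem_taylor (h : IsBox N τ box) (h' : IsBox N' τ box')
    (hbox : ∀ v, box (D.f.v v) = box' v) {c : Net} (hc : c ∈ h.comp.taylor) :
    ∃ c' ∈ h'.comp.taylor, SplitContraction c c' := by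
  obtain ⟨t, ⟨x⟩⟩ := hc
  obtain ⟨c', ⟨x'⟩⟩ := exists_expansion h'.comp t
  refine ⟨c', ⟨t, ⟨x'⟩⟩, x.splitContraction x' D.f D.label_a D.label_b D.concl' D.concl
    D.f_a D.f_b D.surj_v D.surj_e D.ker_v D.ker_e id Function.bijective_id (fun v s => ?_)
    (fun _ _ h => h)⟩
  change box' v = _ ↔ box (D.f.v v) = _
  rw [hbox]; rfl

/-- The two merged cells carry conclusions, so both lie over the root and the box-function factors
through the quotient. -/
theorem exists_box (D : Contraction N N') (h' : IsBox N' τ box') :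
    ∃ box : N.V → τ.Node, IsBox N τ box ∧ ∀ v, box (D.f.v v) = box' v := by
  have hf : ∀ v, box' (Function.surjInv D.surj_v (D.f.v v)) = box' v := by
    intro v
    have ha := h'.concl _ D.tgt_a
    have hb := h'.concl _ D.tgt_b
    rcases D.ker_v _ _ (Function.surjInv_eq D.surj_v (D.f.v v)) with h | ⟨h1, h2⟩ | ⟨h1, h2⟩
    · rw [h]
    · rw [h1, h2, ha, hb]
    · rw [h1, h2, ha, hb]
  generalize hbox : (fun v => box' (Function.surjInv D.surj_v v)) = box
  replace hf : ∀ v, box (D.f.v v) = box' v := fun v => by rw [← hbox]; exact hf v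
  refine ⟨box, ⟨?_, ?_, ?_, ?_⟩, hf⟩
  · intro e v he
    obtain ⟨e, v, rfl, rfl, h⟩ := D.lift he
    rw [D.f.src_e, hf, hf]; exact h'.edge _ _ h
  · intro e he
    obtain ⟨e, rfl⟩ := D.surj_e e
    rw [D.f.src_e, hf]
    rcases h : N'.tgt e with _ | u
    · exact h'.concl _ h
    · rw [D.f.tgt_e _ _ h] at he; cases he
  · intro e v he hne
    obtain ⟨e, v, rfl, rfl, h⟩ := D.lift he
    rw [D.f.src_e, hf, hf] at hne
    rw [D.f.label_v]
    exact h'.border _ _ h hne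
  · intro e e' v v' he he' hv hv' hp hp' hbb
    obtain ⟨e, v, rfl, rfl, h⟩ := D.lift he
    obtain ⟨e', v', rfl, rfl, h1⟩ := D.lift he'
    rw [D.f.src_e, hf, hf] at hp hp'
    rw [D.f.src_e, D.f.src_e, hf, hf] at hbb
    rw [D.f.label_v] at hv hv'
    rw [h'.inj _ _ _ _ h h1 hv hv' hp hp' hbb]

end

end Contraction

/-- Merging the `?`-cells of the last two conclusions. -/
theorem Net.exists_contraction (c' : Net) {l : List c'.E} {a b : c'.E}
    (hc' : c'.concl = l ++ [a, b]) (ha : c'.label (c'.src a) = .whynot)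
    (hb : c'.label (c'.src b) = .whynot) (ht : c'.typ b = c'.typ a) :
    ∃ (c : Net) (D : Contraction c c'), D.l = l ∧ c.typ D.o = c'.typ a := by
  classical
  have hnd := Net.nodup_of_append hc'
  have hab : a ≠ b := fun h => by have := hnd.2.1; simp [h] at this
  have hs : c'.src a ≠ c'.src b := fun h => hab (Net.out_unique (.inl hb) h)
  have hal : a ∉ l := fun h => hnd.2.2 h (by simp)
  have hbl : ∀ e ∈ l ++ [a], e ≠ b := by
    rintro e he rfl
    rw [List.mem_append, List.mem_singleton] at he
    rcases he with h | h
    · exact hnd.2.2 h (by simp)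
    · exact hab h.symm
  -- The quotient is realised on the complement of `b` and of its source, which `g` and `m` send to
  -- `a` and to the source of `a`.
  let m : c'.V → {v // v ≠ c'.src b} := fun v => if h : v = c'.src b then ⟨c'.src a, hs⟩ else ⟨v, h⟩
  let g : c'.E → {e // e ≠ b} := fun e => if h : e = b then ⟨a, hab⟩ else ⟨e, h⟩
  have m_neg : ∀ v (h : v ≠ c'.src b), m v = ⟨v, h⟩ := fun v h => dif_neg h
  have m_pos : m (c'.src b) = ⟨c'.src a, hs⟩ := dif_pos rfl
  have g_neg : ∀ v (h : v ≠ b), g v = ⟨v, h⟩ := fun v h => dif_neg h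
  have g_pos : g b = ⟨a, hab⟩ := dif_pos rfl
  have m_eq : ∀ u v, (m u).1 = v ↔ (u = v ∧ u ≠ c'.src b) ∨ (u = c'.src b ∧ v = c'.src a) := by
    intro u v
    by_cases h : u = c'.src b
    · subst h; rw [m_pos]; simp [eq_comm]
    · rw [m_neg u h]; simp [h]
  have hmlab : ∀ v, c'.label (m v).1 = c'.label v := by
    intro v
    by_cases h : v = c'.src b
    · subst h; rw [m_pos, ha, hb]
    · rw [m_neg v h]
  have hsrc_ne : ∀ e, e ≠ b → c'.src e ≠ c'.src b := fun e he h =>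
    he (Net.out_unique (.inl hb) h)
  have hwa := c'.cell_ok (c'.src a)
  have hwb := c'.cell_ok (c'.src b)
  rw [ha] at hwa
  rw [hb] at hwb
  obtain ⟨oa, A, hoa, hoA, hA⟩ := hwa
  obtain ⟨ob, B, hob, hoB, hB⟩ := hwb
  have hoa' : a = oa := by
    have : a ∈ ({oa} : Set c'.E) := hoa ▸ rfl
    exact this
  have hob' : b = ob := by
    have : b ∈ ({ob} : Set c'.E) := hob ▸ rfl
    exact this
  subst hoa' hob'
  have hAB : B = A := by
    rw [hoA, hoB] at ht
    exact Formula.whynot.inj ht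
  subst hAB
  refine ⟨⟨{v // v ≠ c'.src b}, {e // e ≠ b}, ?_, ?_, fun v => c'.label v.1, fun e => c'.typ e.1,
    fun e => m (c'.src e.1), fun e => (c'.tgt e.1).map m, fun e => c'.first e.1,
    (l ++ [a]).pmap Subtype.mk hbl, ?_, ?_, ?_⟩,
    ⟨⟨m, g, hmlab, ?_, ?_, ?_, ?_⟩, l, a, b, ⟨a, hab⟩, ha, hb, hc', ?_, g_neg a hab, g_pos, ?_, ?_,
      ?_, ?_⟩, rfl, rfl⟩
  · have := c'.finite_V; infer_instance
  · have := c'.finite_E; infer_instance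
  · exact List.Nodup.pmap (by simp) (List.nodup_append'.2 ⟨hnd.1, by simp, by simpa using hal⟩)
  · rintro ⟨e, he⟩
    rw [Option.map_eq_none_iff, ← c'.mem_concl, hc']
    simp [he]
  · rintro ⟨v, hv⟩
    by_cases hva : v = c'.src a
    · subst hva
      dsimp only
      rw [ha]
      refine ⟨⟨a, hab⟩, B, ?_, hoA, ?_⟩
      · ext ⟨e, he⟩
        simp only [Set.mem_ofPred_eq, Set.mem_singleton_iff, Subtype.mk.injEq]
        rw [m_neg _ (hsrc_ne e he), Subtype.mk.injEq]
        exact ⟨fun h => Net.out_unique (.inl ha) h, fun h => by rw [h]⟩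
      · rintro ⟨e, he⟩ h
        obtain ⟨u, hu, hu'⟩ := Option.map_eq_some_iff.1 h
        rcases (m_eq u _).1 (congrArg Subtype.val hu') with ⟨rfl, -⟩ | ⟨rfl, -⟩
        · exact hA e hu
        · exact hB e hu
    · have hm : ∀ u, m u = ⟨v, hv⟩ ↔ u = v := by
        intro u
        rw [Subtype.ext_iff, m_eq]
        refine ⟨?_, fun h => .inl ⟨h, by rwa [h]⟩⟩
        rintro (h | h)
        · exact h.1
        · exact absurd h.2 hva
      have hvt : ∀ e : {e // e ≠ b},
          (c'.tgt e.1).map m = some ⟨v, hv⟩ ↔ c'.tgt e.1 = some v := by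
        intro e
        rw [Option.map_eq_some_iff]
        simp [hm]
      refine (c'.cell_ok v).pull Subtype.val (fun _ => rfl)
        ⟨?_, Subtype.val_injective.injOn, ?_⟩ (.inl ⟨?_, Subtype.val_injective.injOn, ?_⟩)
        (fun _ _ _ => Iff.rfl)
      · intro e he
        exact (hm _).1 he
      · rintro e rfl
        exact ⟨⟨e, fun h => hv (by rw [h])⟩, (hm _).2 rfl, rfl⟩
      · intro e he
        exact (hvt _).1 he
      · intro e he
        have heb : e ≠ b := by
          rintro rfl
          have h1 : c'.tgt e = some v := he
          rw [Net.tgt_of_mem (by rw [hc']; simp)] at h1; cases h1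
        exact ⟨⟨e, heb⟩, (hvt ⟨e, heb⟩).2 he, rfl⟩
  · intro e
    by_cases h : e = b
    · subst h; rw [g_pos]; exact ht.symm
    · rw [g_neg e h]
  · intro e
    by_cases h : e = b
    · subst h; rw [g_pos]; exact (m_neg _ hs).trans m_pos.symm
    · rw [g_neg e h]
  · intro e v h
    have he : e ≠ b := by
      rintro rfl
      rw [Net.tgt_of_mem (by rw [hc']; simp)] at h; cases h
    rw [g_neg e he]
    change (c'.tgt e).map m = some (m v)
    rw [h]; rfl
  · intro e v h _
    have he : e ≠ b := by
      rintro rfl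
      rw [Net.tgt_of_mem (by rw [hc']; simp)] at h; cases h
    rw [g_neg e he]
  · refine (List.pmap_append hbl).trans (congrArg₂ (· ++ ·) ?_ rfl)
    rw [← List.pmap_eq_map (p := fun e => e ≠ b) (H := fun e he => hbl e (by simp [he]))]
    exact List.pmap_congr_left _ fun e _ h _ => (g_neg e h).symm
  · rintro ⟨v, hv⟩
    exact ⟨v, m_neg v hv⟩
  · rintro ⟨v, hv⟩
    exact ⟨v, g_neg v hv⟩
  · intro u v h
    change m u = m v at h
    by_cases hu : u = c'.src b <;> by_cases hv : v = c'.src b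
    · exact .inl (hu.trans hv.symm)
    · rw [m_neg v hv, hu, m_pos, Subtype.mk.injEq] at h
      exact .inr (.inr ⟨hu, h.symm⟩)
    · rw [m_neg u hu, hv, m_pos, Subtype.mk.injEq] at h
      exact .inr (.inl ⟨h, hv⟩)
    · rw [m_neg u hu, m_neg v hv, Subtype.mk.injEq] at h
      exact .inl h
  · intro u v h
    change g u = g v at h
    by_cases hu : u = b <;> by_cases hv : v = b
    · exact .inl (hu.trans hv.symm)
    · rw [g_neg v hv, hu, g_pos, Subtype.mk.injEq] at h
      exact .inr (.inr ⟨hu, h.symm⟩)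
    · rw [g_neg u hu, hv, g_pos, Subtype.mk.injEq] at h
      exact .inr (.inl ⟨h, hv⟩)
    · rw [g_neg u hu, g_neg v hv, Subtype.mk.injEq] at h
      exact .inl h

/-- Splitting the `?`-cell of the last conclusion, in such a way that one of the two cells has only
one input. -/
theorem Net.exists_split (c : Net) {l : List c.E} {o e₁ : c.E} (hc : c.concl = l ++ [o])
    (ho : c.label (c.src o) = .whynot) (he₁ : c.tgt e₁ = some (c.src o)) :
    ∃ (c' : Net) (D : Contraction c c'), D.o = o ∧ D.l.map D.f.e = l ∧
      Nat.card c'.V = Nat.card c.V + 1 ∧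
      ∀ x y v, c'.tgt x = some v → c'.tgt y = some v → (D.f.e x = e₁ ↔ D.f.e y = e₁) := by
  classical
  have hok := c.cell_ok (c.src o)
  rw [ho] at hok
  obtain ⟨o', A, ho', hoA, hA⟩ := hok
  have hoo : o = o' := by
    have : o ∈ ({o'} : Set c.E) := ho' ▸ rfl
    exact this
  subst hoo
  have hnd := Net.nodup_of_append hc
  -- The input `e₁` alone is moved to the new cell `none`; the new edge `none` is a conclusion; all
  -- other edges keep their targets.
  let tgt : Option c.E → Option (Option c.V) := fun x =>
    x.elim none fun e => if e = e₁ then some none else (c.tgt e).map some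
  have htgt_some : ∀ e v, tgt e = some (some v) ↔ ∃ e', e = some e' ∧ e' ≠ e₁ ∧ c.tgt e' = some v := by
    rintro (_ | e) v
    · simp [tgt]
    · by_cases h : e = e₁
      · simp [tgt, h]
      · simp [tgt, h]
  have htgt_none : ∀ e, tgt e = some none ↔ e = some e₁ := by
    rintro (_ | e)
    · simp [tgt]
    · by_cases h : e = e₁
      · simp [tgt, h]
      · simp [tgt, h]
  have hsep : ∀ x y v, tgt x = some v → tgt y = some v →
      (Option.elim x o id = e₁ ↔ Option.elim y o id = e₁) := by
    rintro x y (_ | v) hx hy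
    · rw [(htgt_none x).1 hx, (htgt_none y).1 hy]
    · obtain ⟨x, rfl, hx', -⟩ := (htgt_some _ _).1 hx
      obtain ⟨y, rfl, hy', -⟩ := (htgt_some _ _).1 hy
      exact iff_of_false hx' hy'
  have hcard : Nat.card (Option c.V) = Nat.card c.V + 1 := by
    have := c.finite_V
    exact Finite.card_option
  refine ⟨⟨Option c.V, Option c.E, ?_, ?_, fun v => v.elim .whynot c.label,
    fun e => e.elim (c.typ o) c.typ, fun e => e.map c.src, tgt, fun e => e.elim False c.first,
    l.map some ++ [some o, none], ?_, ?_, ?_⟩,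
    ⟨⟨fun v => v.elim (c.src o) id, fun e => e.elim o id, ?_, ?_, ?_, ?_, ?_⟩, l.map some, some o,
      none, o, ho, rfl, rfl, ?_, rfl, rfl, fun v => ⟨some v, rfl⟩, fun e => ⟨some e, rfl⟩, ?_, ?_⟩,
    rfl, ?_, ?_, ?_⟩
  · have := c.finite_V; infer_instance
  · have := c.finite_E; infer_instance
  · refine List.nodup_append'.2 ⟨hnd.1.map (Option.some_injective _), by simp, ?_⟩
    intro e h1 h2
    obtain ⟨e, he, rfl⟩ := List.mem_map.1 h1
    have : e = o := by simpa using h2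
    subst this
    exact hnd.2.2 he (by simp)
  · rintro (_ | e)
    · simp [tgt]
    · have h1 : some e ∈ l.map some ++ [some o, none] ↔ c.tgt e = none := by
        rw [← c.mem_concl, hc]; simp
      rw [h1]
      by_cases h : e = e₁
      · simp [tgt, h, he₁]
      · simp [tgt, h]
  · rintro (_ | v)
    · refine ⟨none, A, ?_, hoA, ?_⟩
      · ext (_ | e) <;> simp
      · intro e he
        rw [(htgt_none e).1 he]
        exact hA e₁ he₁
    · refine (c.cell_ok v).pull (fun e => e.elim o id) (fun e => by cases e <;> rfl)
        ⟨?_, ?_, ?_⟩ ?_ ?_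
      · rintro (_ | e) he
        · simp at he
        · simpa using he
      · rintro (_ | e) h1 (_ | e') h2 h
        · rfl
        · simp at h1
        · simp at h2
        · exact congrArg some h
      · intro e he
        exact ⟨some e, congrArg some he, rfl⟩
      · have hm : Set.MapsTo (fun e => Option.elim e o id) {e | tgt e = some (some v)}
            {e | c.tgt e = some v} := by
          intro e he
          obtain ⟨e, rfl, -, h⟩ := (htgt_some _ _).1 he
          exact h
        by_cases hv : v = c.src o
        · subst hv
          exact .inr ⟨.inl ho, hm⟩
        · refine .inl ⟨hm, ?_, ?_⟩
          · intro e he e' he' h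
            obtain ⟨e, rfl, -, -⟩ := (htgt_some _ _).1 he
            obtain ⟨e', rfl, -, -⟩ := (htgt_some _ _).1 he'
            exact congrArg some h
          · intro e he
            refine ⟨some e, (htgt_some _ _).2 ⟨e, rfl, ?_, he⟩, rfl⟩
            rintro rfl
            have he' : c.tgt e = some v := he
            rw [he₁] at he'
            exact hv (Option.some.inj he').symm
      · intro e he _
        obtain ⟨e, rfl, -, -⟩ := (htgt_some _ _).1 he
        exact Iff.rfl
  · rintro (_ | v)
    · exact ho
    · rfl
  · rintro (_ | v) <;> rfl
  · rintro (_ | v) <;> rfl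
  · rintro e (_ | v) h
    · rw [(htgt_none e).1 h]; exact he₁
    · obtain ⟨e, rfl, -, h⟩ := (htgt_some _ _).1 h
      exact h
  · rintro e (_ | v) h hb
    · rcases hb with hb | hb <;> cases hb
    · obtain ⟨e, rfl, -, h⟩ := (htgt_some _ _).1 h
      exact Iff.rfl
  · refine hc.trans (congrArg (· ++ [o]) ?_)
    rw [List.map_map]
    exact (List.map_id l).symm
  · rintro (_ | u) (_ | v) h
    · exact .inl rfl
    · exact .inr (.inr ⟨rfl, congrArg some h.symm⟩)
    · exact .inr (.inl ⟨congrArg some h, rfl⟩)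
    · exact .inl (congrArg some h)
  · rintro (_ | u) (_ | v) h
    · exact .inl rfl
    · exact .inr (.inr ⟨rfl, congrArg some h.symm⟩)
    · exact .inr (.inl ⟨congrArg some h, rfl⟩)
    · exact .inl (congrArg some h)
  · change (l.map some).map (fun e => Option.elim e o id) = l
    rw [List.map_map]
    exact List.map_id l
  · exact hcard
  · exact hsep

theorem exists_zone_contraction {L : List Formula} {A : Formula} {o' : Option Component}
    (ho' : ZoneOK (L ++ [.whynot A, .whynot A]) o') :
    ∃ o, ZoneOK (L ++ [.whynot A]) o ∧
      ∀ c c', SplitContraction c c' → InZone o' c' → InZone o c := by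
  rcases o' with _ | C'
  · refine ⟨none, by simp [ZoneOK], fun c c' D h hc => ?_⟩
    obtain ⟨D⟩ := D.exists_contraction
    obtain ⟨_, ⟨⟩, -⟩ := h (D.f.noDaimon hc)
  · obtain ⟨hM, ht⟩ := ho' C' rfl
    rw [Net.type, List.map_eq_append_iff] at ht
    obtain ⟨l, as, hc, hl, has⟩ := ht
    rcases as with _ | ⟨a, _ | ⟨b, _ | ⟨_, _⟩⟩⟩ <;> simp at has
    obtain ⟨ha, hb⟩ := has
    obtain ⟨N, D, rfl, ho⟩ := C'.net.exists_contraction hc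
      (hM.label_of_typ_whynot (by rw [hc]; simp) ha)
      (hM.label_of_typ_whynot (by rw [hc]; simp) hb) (hb.trans ha.symm)
    obtain ⟨box, h, hbox⟩ := D.exists_box C'.isBox
    refine ⟨some h.comp, ?_, ?_⟩
    · rintro _ ⟨⟩
      refine ⟨(Contraction.isRootStep h C'.isBox hbox).isMELL hM, ?_⟩
      rw [Net.type, D.concl, List.map_append, List.map_map, ← hl, List.map_singleton, ho, ha]
      congr 1
      exact List.map_congr_left fun e _ => D.f.typ_e e
    · intro c c' hD hc' hc
      obtain ⟨D'⟩ := hD.exists_contraction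
      obtain ⟨_, ⟨⟩, h1⟩ := hc' (D'.f.noDaimon hc)
      exact ⟨_, rfl, Contraction.mem_taylor h C'.isBox hbox h1 hD⟩

/-- The split adds one cell, but `e₁` and `e₂` no longer have a common target. The ordered pairs
`(e₁, e₂)` and `(e₂, e₁)` disappear from the second summand of `Net.size`, so the size drops;
counting ordered pairs makes the gain two. -/
theorem Component.IsMELL.exists_split {C : Component} (hM : C.IsMELL) {l : List C.net.E}
    {o e₁ e₂ : C.net.E} (hc : C.net.concl = l ++ [o])
    (ho : C.net.label (C.net.src o) = .whynot) (he₁ : C.net.tgt e₁ = some (C.net.src o))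
    (he₂ : C.net.tgt e₂ = some (C.net.src o)) (hne : e₁ ≠ e₂) :
    ∃ C' : Component, C'.IsMELL ∧ C'.net.type = (l ++ [o, o]).map C.net.typ ∧
      C'.net.size < C.net.size ∧ Nonempty C'.net.V ∧
      ∀ c ∈ C.taylor, ∃ c' ∈ C'.taylor, SplitContraction c c' := by
  obtain ⟨N', D, rfl, rfl, hcard, hsep⟩ := C.net.exists_split hc ho he₁
  have h' : IsBox N' C.tree (fun v => C.box (D.f.v v)) := by
    refine C.isBox.comap D.f _ id (fun _ => rfl) Function.injective_id (fun _ _ h => h)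
      (fun _ _ h => h) D.inj_e fun e he => ?_
    rw [← D.f.src_e]
    exact C.box_concl _ (D.tgt_none he)
  refine ⟨h'.comp, (Contraction.isRootStep C.isBox h' fun _ => rfl).isMELL_of hM, ?_, ?_,
    ⟨N'.src D.a⟩, fun c hc => Contraction.exists_mem_taylor C.isBox h' (fun _ => rfl) hc⟩
  · rw [Net.type, D.concl', List.map_append, List.map_append, List.map_map]
    congr 1
    · exact List.map_congr_left fun e _ => (D.f.typ_e e).symm
    · simp only [List.map_cons, List.map_nil]
      rw [← D.f.typ_e, ← D.f.typ_e, D.f_a, D.f_b]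
  · have := C.net.finite_E
    unfold Net.size
    have key : (Prod.map D.f.e D.f.e) '' {p : N'.E × N'.E | p.1 ≠ p.2 ∧
        ∃ v, N'.tgt p.1 = some v ∧ N'.tgt p.2 = some v} ⊆
        {p : C.net.E × C.net.E | p.1 ≠ p.2 ∧ ∃ v, C.net.tgt p.1 = some v ∧ C.net.tgt p.2 = some v} \
          {(e₁, e₂), (e₂, e₁)} := by
      rintro _ ⟨⟨x, y⟩, ⟨hxy, v, hx, hy⟩, rfl⟩
      dsimp only at hxy hx hy
      refine ⟨⟨fun h => hxy (D.inj_e _ _ _ hx h), _, D.f.tgt_e _ _ hx, D.f.tgt_e _ _ hy⟩, ?_⟩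
      have hs := hsep x y v hx hy
      simp only [Prod.map_apply, Set.mem_insert_iff, Prod.mk.injEq, Set.mem_singleton_iff, not_or,
        not_and]
      constructor
      · intro h1 h2
        exact hne ((hs.1 h1).symm.trans h2)
      · intro h1 h2
        exact hne ((hs.2 h2).symm.trans h1)
    have h1 := Set.ncard_le_ncard key (Set.toFinite _)
    rw [Set.InjOn.ncard_image, Set.ncard_sdiff, Set.ncard_pair] at h1
    · have h2 : 2 ≤ {p : C.net.E × C.net.E | p.1 ≠ p.2 ∧
          ∃ v, C.net.tgt p.1 = some v ∧ C.net.tgt p.2 = some v}.ncard := by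
        rw [← Set.ncard_pair (a := (e₁, e₂)) (b := (e₂, e₁)) (by simp [hne])]
        refine Set.ncard_le_ncard ?_ (Set.toFinite _)
        rintro _ (rfl | rfl)
        · exact ⟨hne, _, he₁, he₂⟩
        · exact ⟨hne.symm, _, he₂, he₁⟩
      change Nat.card N'.V + _ < _
      rw [hcard]
      change _ + {p : N'.E × N'.E | p.1 ≠ p.2 ∧
        ∃ v, N'.tgt p.1 = some v ∧ N'.tgt p.2 = some v}.ncard < _
      omega
    · simp [hne]
    · rintro _ (rfl | rfl)
      · exact ⟨hne, _, he₁, he₂⟩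
      · exact ⟨hne.symm, _, he₂, he₁⟩
    · rintro ⟨x, y⟩ ⟨-, v, hx, hy⟩ ⟨x', y'⟩ - h
      dsimp only at hx hy
      simp only [Prod.map_apply, Prod.mk.injEq] at h ⊢
      exact ⟨D.inj_e _ _ _ hx h.1, D.inj_e _ _ _ hy h.2⟩

end Glue

namespace Glue

/-! ## Gluing two trees at their roots -/

/-- Two trees glued at their roots. -/
def BoxTree.wedge (τ₁ τ₂ : BoxTree) : BoxTree where
  Node := {p : τ₁.Node × τ₂.Node // p.1 = τ₁.root ∨ p.2 = τ₂.root}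
  finite_Node := by have := τ₁.finite_Node; have := τ₂.finite_Node; infer_instance
  root := ⟨(τ₁.root, τ₂.root), .inl rfl⟩
  parent p := match τ₁.parent p.1.1 with
    | some a => some ⟨(a, τ₂.root), .inr rfl⟩
    | none => (τ₂.parent p.1.2).map fun b => ⟨(τ₁.root, b), .inl rfl⟩
  parent_eq_none := by
    rintro ⟨⟨a, b⟩, h⟩
    rcases h' : τ₁.parent a with _ | a'
    · have ha := (τ₁.parent_eq_none _).1 h'
      subst ha
      simp [τ₂.parent_eq_none]
    · have ha := BoxTree.ne_root_of_parent h'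
      simp [ha]
  reaches_root := by
    rintro ⟨⟨a, b⟩, h⟩
    by_cases ha : a = τ₁.root
    · subst ha
      induction τ₂.reaches_root b using Relation.ReflTransGen.head_induction_on with
      | refl => exact .refl
      | head h' _ ih => exact .head (by simp [τ₁.parent_root, h']) (ih (.inl rfl))
    · have hb := h.resolve_left ha
      dsimp only at hb
      subst hb
      clear ha
      induction τ₁.reaches_root a using Relation.ReflTransGen.head_induction_on with
      | refl => exact .refl
      | head h' _ ih => exact .head (by simp [h']) (ih (.inr rfl))

namespace BoxTree
variable {τ₁ τ₂ : BoxTree}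

/-- The embedding of the first tree. -/
def wedgeInl (τ₁ τ₂ : BoxTree) (a : τ₁.Node) : (wedge τ₁ τ₂).Node := ⟨(a, τ₂.root), .inr rfl⟩

/-- The embedding of the second tree. -/
def wedgeInr (τ₁ τ₂ : BoxTree) (b : τ₂.Node) : (wedge τ₁ τ₂).Node := ⟨(τ₁.root, b), .inl rfl⟩

theorem wedgeInl_injective : (wedgeInl τ₁ τ₂).Injective :=
  fun _ _ h => congrArg (fun p => p.1.1) h

theorem wedgeInr_injective : (wedgeInr τ₁ τ₂).Injective :=
  fun _ _ h => congrArg (fun p => p.1.2) h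

theorem wedge_disjoint {a : τ₁.Node} {b : τ₂.Node} (h : wedgeInl τ₁ τ₂ a = wedgeInr τ₁ τ₂ b) :
    a = τ₁.root ∧ b = τ₂.root :=
  ⟨congrArg (fun p => p.1.1) h, (congrArg (fun p => p.1.2) h).symm⟩

theorem wedge_cases (p : (wedge τ₁ τ₂).Node) :
    (∃ a, wedgeInl τ₁ τ₂ a = p) ∨ ∃ b, wedgeInr τ₁ τ₂ b = p := by
  obtain ⟨⟨a, b⟩, h⟩ := p
  rcases h with h | h
  · dsimp only at h; subst h; exact .inr ⟨b, rfl⟩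
  · dsimp only at h; subst h; exact .inl ⟨a, rfl⟩

theorem wedge_parent_inl {a a' : τ₁.Node} (h : τ₁.parent a = some a') :
    (wedge τ₁ τ₂).parent (wedgeInl τ₁ τ₂ a) = some (wedgeInl τ₁ τ₂ a') := by
  simp [wedge, wedgeInl, h]

theorem wedge_parent_inr {b b' : τ₂.Node} (h : τ₂.parent b = some b') :
    (wedge τ₁ τ₂).parent (wedgeInr τ₁ τ₂ b) = some (wedgeInr τ₁ τ₂ b') := by
  simp [wedge, wedgeInr, h, τ₁.parent_root]

end BoxTree

theorem BoxTree.wedge_parent_inl_iff {τ₁ τ₂ : BoxTree} {a b : τ₁.Node} :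
    (wedge τ₁ τ₂).parent (wedgeInl τ₁ τ₂ a) = some (wedgeInl τ₁ τ₂ b) ↔ τ₁.parent a = some b := by
  refine ⟨fun h => ?_, wedge_parent_inl⟩
  have ha : a ≠ τ₁.root := by
    rintro rfl
    exact ne_root_of_parent h rfl
  obtain ⟨p, hp⟩ := exists_parent ha
  rw [wedge_parent_inl hp] at h
  rw [hp, wedgeInl_injective (Option.some.inj h)]

theorem BoxTree.wedge_parent_inr_iff {τ₁ τ₂ : BoxTree} {a b : τ₂.Node} :
    (wedge τ₁ τ₂).parent (wedgeInr τ₁ τ₂ a) = some (wedgeInr τ₁ τ₂ b) ↔ τ₂.parent a = some b := by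
  refine ⟨fun h => ?_, wedge_parent_inr⟩
  have ha : a ≠ τ₂.root := by
    rintro rfl
    exact ne_root_of_parent h rfl
  obtain ⟨p, hp⟩ := exists_parent ha
  rw [wedge_parent_inr hp] at h
  rw [hp, wedgeInr_injective (Option.some.inj h)]

theorem BoxTree.Below.wedgeInl {τ₁ τ₂ : BoxTree} {a b : τ₁.Node} (h : τ₁.Below a b) :
    (τ₁.wedge τ₂).Below (BoxTree.wedgeInl τ₁ τ₂ a) (BoxTree.wedgeInl τ₁ τ₂ b) :=
  Relation.ReflTransGen.lift _ (fun _ _ => BoxTree.wedge_parent_inl) _ _ h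

theorem BoxTree.Below.wedgeInr {τ₁ τ₂ : BoxTree} {a b : τ₂.Node} (h : τ₂.Below a b) :
    (τ₁.wedge τ₂).Below (BoxTree.wedgeInr τ₁ τ₂ a) (BoxTree.wedgeInr τ₁ τ₂ b) :=
  Relation.ReflTransGen.lift _ (fun _ _ => BoxTree.wedge_parent_inr) _ _ h

/-! ## Parts of components -/

/-- `C₁` is a union of connected components of `C`, the box-trees being glued at the root. -/
structure Part (C₁ C : Component) where
  F : Net.Hom C₁.net C.net
  i : C₁.tree.Node → C.tree.Node
  inj_v : F.v.Injective
  inj_e : F.e.Injective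
  inj_i : i.Injective
  root : i C₁.tree.root = C.tree.root
  parent : ∀ a b, C₁.tree.parent a = some b → C.tree.parent (i a) = some (i b)
  box : ∀ v, C.box (F.v v) = i (C₁.box v)
  edge : ∀ e v, C.net.tgt e = some (F.v v) → ∃ e', F.e e' = e ∧ C₁.net.tgt e' = some v
  src : ∀ e v, C.net.src e = F.v v → ∃ e', F.e e' = e
  vertex : ∀ v b, C.box v = i b → b ≠ C₁.tree.root → ∃ v', F.v v' = v

namespace Part
variable {C₁ C : Component} (P : Part C₁ C)

theorem parent_iff {a b : C₁.tree.Node} :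
    C.tree.parent (P.i a) = some (P.i b) ↔ C₁.tree.parent a = some b := by
  refine ⟨fun h => ?_, P.parent a b⟩
  have ha : a ≠ C₁.tree.root := by
    rintro rfl
    rw [P.root, C.tree.parent_root] at h; cases h
  obtain ⟨p, hp⟩ := BoxTree.exists_parent ha
  rw [hp]
  rw [P.parent _ _ hp] at h
  rw [P.inj_i (Option.some.inj h)]

theorem isMELL {C₁ C : Component} (P : Part C₁ C) (hM : C.IsMELL) : C₁.IsMELL := by
  obtain ⟨⟨h1, h2, h3⟩, h4⟩ := hM
  refine ⟨⟨?_, ?_, ?_⟩, ?_⟩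
  · intro v hv
    obtain ⟨e, he, hu⟩ := h1 (P.F.v v) (by rw [P.F.label_v, hv])
    obtain ⟨e, rfl, he'⟩ := P.edge e v he
    exact ⟨e, he', fun e₁ he₁ => P.inj_e (hu _ (P.F.tgt_e _ _ he₁))⟩
  · intro e v he hv
    have := h2 _ _ (P.F.tgt_e _ _ he) (by rw [P.F.label_v, hv])
    rwa [P.F.src_e, P.box, P.box, P.parent_iff] at this
  · intro b hb
    obtain ⟨e, v, he, hv, hbox⟩ := h3 (P.i b) (fun h => hb (P.inj_i (h.trans P.root.symm)))
    obtain ⟨u, hu⟩ := P.vertex _ _ hbox hb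
    obtain ⟨e, rfl⟩ := P.src e u hu.symm
    have hbox' : C₁.box (C₁.net.src e) = b := by
      rw [P.F.src_e, P.box] at hbox
      exact P.inj_i hbox
    rcases h : C₁.net.tgt e with _ | v'
    · rw [C₁.box_concl e h] at hbox'
      exact absurd hbox'.symm hb
    · have := P.F.tgt_e _ _ h
      rw [he] at this
      refine ⟨e, v', h, ?_, hbox'⟩
      rw [← P.F.label_v, ← Option.some.inj this, hv]
  · intro v p hv
    obtain ⟨h5, h6⟩ := h4 (P.F.v v) p (by rw [P.F.label_v, hv])
    refine ⟨fun w hw => P.inj_v (h5 _ (by rw [P.box, P.box, hw])), fun h => h6 ?_⟩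
    rw [P.box, h, P.root]

end Part

/-- `C` is the juxtaposition of `C₁` and `C₂`. -/
structure Mix (C C₁ C₂ : Component) where
  P₁ : Part C₁ C
  P₂ : Part C₂ C
  bij_v : (Sum.elim P₁.F.v P₂.F.v).Bijective
  bij_e : (Sum.elim P₁.F.e P₂.F.e).Bijective
  concl : C.net.concl = C₁.net.concl.map P₁.F.e ++ C₂.net.concl.map P₂.F.e
  cover : ∀ b, (∃ b₁, P₁.i b₁ = b) ∨ ∃ b₂, P₂.i b₂ = b
  disj : ∀ b₁ b₂, P₁.i b₁ = P₂.i b₂ → b₁ = C₁.tree.root ∧ b₂ = C₂.tree.root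

namespace Mix

/-- Every cell and every node comes from a part, and the inputs of a cell come from the same part
(`Part.edge`), as do the cells that share a box inside it (`Part.vertex`). -/
theorem isMELL {C C₁ C₂ : Component} (M : Mix C C₁ C₂) (h₁ : C₁.IsMELL) (h₂ : C₂.IsMELL) :
    C.IsMELL := by
  have key : ∀ v, (∃ (C' : Component) (P : Part C' C) (_ : C'.IsMELL) (v' : C'.net.V), P.F.v v' = v) := by
    intro v
    obtain ⟨v | v, rfl⟩ := M.bij_v.2 v
    exacts [⟨C₁, M.P₁, h₁, v, rfl⟩, ⟨C₂, M.P₂, h₂, v, rfl⟩]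
  have key' : ∀ b, (∃ (C' : Component) (P : Part C' C) (_ : C'.IsMELL) (b' : C'.tree.Node),
      P.i b' = b) := by
    intro b
    rcases M.cover b with ⟨b, rfl⟩ | ⟨b, rfl⟩
    exacts [⟨C₁, M.P₁, h₁, b, rfl⟩, ⟨C₂, M.P₂, h₂, b, rfl⟩]
  refine ⟨⟨?_, ?_, ?_⟩, ?_⟩
  · intro v hv
    obtain ⟨C', P, hM, v, rfl⟩ := key v
    obtain ⟨e, he, hu⟩ := hM.1.1 v (by rw [← P.F.label_v, hv])
    refine ⟨P.F.e e, P.F.tgt_e _ _ he, fun e₁ he₁ => ?_⟩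
    obtain ⟨e₁, rfl, h⟩ := P.edge _ _ he₁
    rw [hu e₁ h]
  · intro e v he hv
    obtain ⟨C', P, hM, v, rfl⟩ := key v
    obtain ⟨e, rfl, he'⟩ := P.edge _ _ he
    rw [P.F.src_e, P.box, P.box, P.parent_iff]
    exact hM.1.2.1 e v he' (by rw [← P.F.label_v, hv])
  · intro b hb
    obtain ⟨C', P, hM, b, rfl⟩ := key' b
    obtain ⟨e, v, he, hv, hbox⟩ := hM.1.2.2 b (fun h => hb (by rw [h, P.root]))
    exact ⟨P.F.e e, P.F.v v, P.F.tgt_e _ _ he, by rw [P.F.label_v, hv],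
      by rw [P.F.src_e, P.box, hbox]⟩
  · intro v p hv
    obtain ⟨C', P, hM, v, rfl⟩ := key v
    obtain ⟨h5, h6⟩ := hM.2 v p (by rw [← P.F.label_v, hv])
    refine ⟨fun w hw => ?_, fun h => h6 (P.inj_i (by rw [← P.box, h, P.root]))⟩
    rw [P.box] at hw
    obtain ⟨w, rfl⟩ := P.vertex _ _ hw h6
    rw [P.box] at hw
    rw [h5 w (P.inj_i hw)]

/-- Thick subtrees of the parts make a thick subtree. -/
theorem exists_thick {C C₁ C₂ : Component} (M : Mix C C₁ C₂) (t₁ : ThickSubtree C₁.tree)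
    (t₂ : ThickSubtree C₂.tree) : ∃ (t : ThickSubtree C.tree) (e₁ : ThickEmbedding M.P₁.i t₁ t)
      (e₂ : ThickEmbedding M.P₂.i t₂ t), (∀ s b, M.P₁.i b = t.h s → ∃ s', e₁.J s' = s ∧ b = t₁.h s') ∧
      (∀ s b, M.P₂.i b = t.h s → ∃ s', e₂.J s' = s ∧ b = t₂.h s') := by
  -- The two trees meet only in their roots, where both prescriptions for the morphism give the root
  -- of `C`.
  have key : ∀ s : (BoxTree.wedge t₁.tree t₂.tree).Node, ∃ b : C.tree.Node,
      (∀ a, BoxTree.wedgeInl _ _ a = s → b = M.P₁.i (t₁.h a)) ∧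
      (∀ a, BoxTree.wedgeInr _ _ a = s → b = M.P₂.i (t₂.h a)) := by
    intro s
    rcases BoxTree.wedge_cases s with ⟨a, rfl⟩ | ⟨a, rfl⟩
    · refine ⟨M.P₁.i (t₁.h a), fun b hb => by rw [BoxTree.wedgeInl_injective hb], fun b hb => ?_⟩
      obtain ⟨rfl, rfl⟩ := BoxTree.wedge_disjoint hb.symm
      rw [t₁.h_root, t₂.h_root, M.P₁.root, M.P₂.root]
    · refine ⟨M.P₂.i (t₂.h a), fun b hb => ?_, fun b hb => by rw [BoxTree.wedgeInr_injective hb]⟩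
      obtain ⟨rfl, rfl⟩ := BoxTree.wedge_disjoint hb
      rw [t₁.h_root, t₂.h_root, M.P₁.root, M.P₂.root]
  choose h hl hr using key
  have hl' := fun a => hl _ a rfl
  have hr' := fun a => hr _ a rfl
  refine ⟨⟨_, h, ?_, ?_⟩, ⟨BoxTree.wedgeInl _ _, hl', BoxTree.wedgeInl_injective,
    fun _ _ => BoxTree.wedge_parent_inl⟩, ⟨BoxTree.wedgeInr _ _, hr', BoxTree.wedgeInr_injective,
    fun _ _ => BoxTree.wedge_parent_inr⟩, ?_, ?_⟩
  · exact (hl' t₁.tree.root).trans (by rw [t₁.h_root, M.P₁.root])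
  · intro s s' hs
    rcases BoxTree.wedge_cases s with ⟨a, rfl⟩ | ⟨a, rfl⟩
    · have ha : a ≠ t₁.tree.root := by
        rintro rfl
        exact BoxTree.ne_root_of_parent hs rfl
      obtain ⟨p, hp⟩ := BoxTree.exists_parent ha
      rw [BoxTree.wedge_parent_inl hp] at hs
      rw [← Option.some.inj hs, hl', hl', M.P₁.parent_iff]
      exact t₁.h_parent _ _ hp
    · have ha : a ≠ t₂.tree.root := by
        rintro rfl
        exact BoxTree.ne_root_of_parent hs rfl
      obtain ⟨p, hp⟩ := BoxTree.exists_parent ha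
      rw [BoxTree.wedge_parent_inr hp] at hs
      rw [← Option.some.inj hs, hr', hr', M.P₂.parent_iff]
      exact t₂.h_parent _ _ hp
  · intro s b hb
    dsimp only at hb
    rcases BoxTree.wedge_cases s with ⟨a, rfl⟩ | ⟨a, rfl⟩
    · rw [hl'] at hb
      exact ⟨a, rfl, M.P₁.inj_i hb⟩
    · rw [hr'] at hb
      obtain ⟨rfl, h2⟩ := M.disj _ _ hb
      rw [t₂.eq_root h2]
      exact ⟨t₁.tree.root, rfl, t₁.h_root.symm⟩
  · intro s b hb
    dsimp only at hb
    rcases BoxTree.wedge_cases s with ⟨a, rfl⟩ | ⟨a, rfl⟩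
    · rw [hl'] at hb
      obtain ⟨h2, rfl⟩ := M.disj _ _ hb.symm
      rw [t₁.eq_root h2]
      exact ⟨t₂.tree.root, rfl, t₂.h_root.symm⟩
    · rw [hr'] at hb
      exact ⟨a, rfl, M.P₂.inj_i hb⟩

theorem mem_taylor {C C₁ C₂ : Component} (M : Mix C C₁ C₂) {c c₁ c₂ : Net} (h₁ : c₁ ∈ C₁.taylor)
    (h₂ : c₂ ∈ C₂.taylor) (h : Juxtapose c c₁ c₂) : c ∈ C.taylor := by
  obtain ⟨t₁, ⟨x₁⟩⟩ := h₁
  obtain ⟨t₂, ⟨x₂⟩⟩ := h₂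
  obtain ⟨t, e₁, e₂, hc₁, hc₂⟩ := M.exists_thick t₁ t₂
  obtain ⟨c₀, ⟨x⟩⟩ := exists_expansion C t
  exact ⟨t, x.of_iso (h.iso (x.juxtapose x₁ x₂ M.P₁.F M.P₂.F M.bij_v M.bij_e M.concl M.P₁.box
    M.P₂.box e₁ e₂ hc₁ hc₂))⟩

end Mix

/-- A thick subtree restricts to a part. -/
theorem Part.exists_thick {C₁ C : Component} (P : Part C₁ C) (t : ThickSubtree C.tree) :
    ∃ (t₁ : ThickSubtree C₁.tree) (e₁ : ThickEmbedding P.i t₁ t),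
      ∀ s b, P.i b = t.h s → ∃ s', e₁.J s' = s ∧ b = t₁.h s' := by
  have hN : ∀ s, (∃ b, P.i b = t.h s) → s ≠ t.tree.root →
      ∃ p, t.tree.parent s = some p ∧ ∃ b, P.i b = t.h p := by
    rintro s ⟨b, hb⟩ hs
    obtain ⟨p, hp⟩ := BoxTree.exists_parent hs
    have hbr : b ≠ C₁.tree.root := by
      rintro rfl
      rw [P.root] at hb
      exact hs (t.eq_root hb.symm)
    obtain ⟨b', hb'⟩ := BoxTree.exists_parent hbr
    have h1 := t.h_parent _ _ hp
    rw [← hb, P.parent _ _ hb'] at h1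
    exact ⟨p, hp, b', Option.some.inj h1⟩
  have hr : ∃ b, P.i b = t.h t.tree.root := ⟨_, by rw [t.h_root, P.root]⟩
  choose h hh using fun s : {s // ∃ b, P.i b = t.h s} => s.2
  have hpar : ∀ s s', (t.tree.restrict (fun s => ∃ b, P.i b = t.h s) t.tree.root hr hN).parent s =
      some s' → t.tree.parent s.1 = some s'.1 := fun _ _ hs => (BoxTree.restrict_parent.1 hs).2
  refine ⟨⟨t.tree.restrict (fun s => ∃ b, P.i b = t.h s) t.tree.root hr hN, h, ?_, ?_⟩,
    ⟨Subtype.val, fun s => (hh s).symm, Subtype.val_injective, hpar⟩, ?_⟩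
  · exact P.inj_i ((hh ⟨_, hr⟩).trans (by rw [t.h_root, P.root]))
  · intro s s' hs
    refine P.parent_iff.1 ?_
    exact (congrArg _ (hh s)).trans ((t.h_parent _ _ (hpar _ _ hs)).trans (congrArg some (hh s').symm))
  · intro s b hb
    exact ⟨⟨s, b, hb⟩, rfl, P.inj_i (hb.trans (hh ⟨s, b, hb⟩).symm)⟩

theorem Mix.exists_mem_taylor {C C₁ C₂ : Component} (M : Mix C C₁ C₂) {c : Net}
    (h : c ∈ C.taylor) : ∃ c₁ ∈ C₁.taylor, ∃ c₂ ∈ C₂.taylor, Juxtapose c c₁ c₂ := by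
  obtain ⟨t, ⟨x⟩⟩ := h
  obtain ⟨t₁, e₁, hc₁⟩ := M.P₁.exists_thick t
  obtain ⟨t₂, e₂, hc₂⟩ := M.P₂.exists_thick t
  obtain ⟨c₁, ⟨x₁⟩⟩ := exists_expansion C₁ t₁
  obtain ⟨c₂, ⟨x₂⟩⟩ := exists_expansion C₂ t₂
  exact ⟨c₁, ⟨t₁, ⟨x₁⟩⟩, c₂, ⟨t₂, ⟨x₂⟩⟩, x.juxtapose x₁ x₂ M.P₁.F M.P₂.F M.bij_v M.bij_e
    M.concl M.P₁.box M.P₂.box e₁ e₂ hc₁ hc₂⟩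

/-! ## The juxtaposition of two components -/

/-- The disjoint union of two nets. -/
def Net.sum (c₁ c₂ : Net) : Net where
  V := c₁.V ⊕ c₂.V
  E := c₁.E ⊕ c₂.E
  finite_V := by have := c₁.finite_V; have := c₂.finite_V; infer_instance
  finite_E := by have := c₁.finite_E; have := c₂.finite_E; infer_instance
  label := Sum.elim c₁.label c₂.label
  typ := Sum.elim c₁.typ c₂.typ
  src := Sum.map c₁.src c₂.src
  tgt := Sum.elim (fun e => (c₁.tgt e).map .inl) (fun e => (c₂.tgt e).map .inr)
  first := Sum.elim c₁.first c₂.first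
  concl := c₁.concl.map .inl ++ c₂.concl.map .inr
  concl_nodup := by
    refine List.nodup_append'.2 ⟨c₁.concl_nodup.map Sum.inl_injective,
      c₂.concl_nodup.map Sum.inr_injective, ?_⟩
    intro e h1 h2
    obtain ⟨_, -, rfl⟩ := List.mem_map.1 h1
    simp at h2
  mem_concl := by
    rintro (e | e) <;> simp [c₁.mem_concl, c₂.mem_concl]
  cell_ok := by
    rintro (v | v)
    · refine (c₁.cell_ok v).push Sum.inl (fun _ => rfl) Sum.inl_injective.injOn ?_ ?_
        fun _ _ _ => Iff.rfl
      · ext (e | e) <;> simp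
      · ext (e | e) <;> simp
    · refine (c₂.cell_ok v).push Sum.inr (fun _ => rfl) Sum.inr_injective.injOn ?_ ?_
        fun _ _ _ => Iff.rfl
      · ext (e | e) <;> simp
      · ext (e | e) <;> simp

/-- The first summand. -/
def Net.sumInl (c₁ c₂ : Net) : Net.Hom c₁ (c₁.sum c₂) :=
  ⟨Sum.inl, Sum.inl, fun _ => rfl, fun _ => rfl, fun _ => rfl,
    fun e v h => by simp [Net.sum, h], fun _ _ _ _ => Iff.rfl⟩

/-- The second summand. -/
def Net.sumInr (c₁ c₂ : Net) : Net.Hom c₂ (c₁.sum c₂) :=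
  ⟨Sum.inr, Sum.inr, fun _ => rfl, fun _ => rfl, fun _ => rfl,
    fun e v h => by simp [Net.sum, h], fun _ _ _ _ => Iff.rfl⟩

theorem Net.sum_tgt_inl {c₁ c₂ : Net} {e : (c₁.sum c₂).E} {v : c₁.V}
    (h : (c₁.sum c₂).tgt e = some (.inl v)) : ∃ e', .inl e' = e ∧ c₁.tgt e' = some v := by
  rcases e with e | e
  · exact ⟨e, rfl, by simpa [Net.sum] using h⟩
  · simp [Net.sum] at h

theorem Net.sum_tgt_inr {c₁ c₂ : Net} {e : (c₁.sum c₂).E} {v : c₂.V}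
    (h : (c₁.sum c₂).tgt e = some (.inr v)) : ∃ e', .inr e' = e ∧ c₂.tgt e' = some v := by
  rcases e with e | e
  · simp [Net.sum] at h
  · exact ⟨e, rfl, by simpa [Net.sum] using h⟩


theorem Net.sum_tgt_cases {c₁ c₂ : Net} {e : (c₁.sum c₂).E} {v : (c₁.sum c₂).V}
    (h : (c₁.sum c₂).tgt e = some v) :
    (∃ e' v', .inl e' = e ∧ .inl v' = v ∧ c₁.tgt e' = some v') ∨
      ∃ e' v', .inr e' = e ∧ .inr v' = v ∧ c₂.tgt e' = some v' := by
  rcases v with v | v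
  · obtain ⟨e', rfl, he⟩ := Net.sum_tgt_inl h
    exact .inl ⟨e', v, rfl, rfl, he⟩
  · obtain ⟨e', rfl, he⟩ := Net.sum_tgt_inr h
    exact .inr ⟨e', v, rfl, rfl, he⟩

theorem exists_mix (C₁ C₂ : Component) : ∃ C : Component, Nonempty (Mix C C₁ C₂) := by
  let il := BoxTree.wedgeInl C₁.tree C₂.tree
  let ir := BoxTree.wedgeInr C₁.tree C₂.tree
  let box : (C₁.net.sum C₂.net).V → (C₁.tree.wedge C₂.tree).Node :=
    Sum.elim (fun v => il (C₁.box v)) (fun v => ir (C₂.box v))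
  have h : IsBox (C₁.net.sum C₂.net) (C₁.tree.wedge C₂.tree) box := by
    refine ⟨?_, ?_, ?_, ?_⟩
    · intro e v he
      rcases Net.sum_tgt_cases he with ⟨e, v, rfl, rfl, h⟩ | ⟨e, v, rfl, rfl, h⟩
      · exact (C₁.box_edge _ _ h).wedgeInl
      · exact (C₂.box_edge _ _ h).wedgeInr
    · rintro (e | e) he
      · have h : C₁.net.tgt e = none := by simpa [Net.sum] using he
        exact congrArg il (C₁.box_concl _ h)
      · have h : C₂.net.tgt e = none := by simpa [Net.sum] using he
        exact congrArg ir (C₂.box_concl _ h)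
    · intro e v he hne
      rcases Net.sum_tgt_cases he with ⟨e, v, rfl, rfl, h⟩ | ⟨e, v, rfl, rfl, h⟩
      · exact C₁.box_border _ _ h fun h' => hne (congrArg il h')
      · exact C₂.box_border _ _ h fun h' => hne (congrArg ir h')
    · intro e e' v v' he he' hv hv' hp hp' hb
      rcases Net.sum_tgt_cases he with ⟨e, v, rfl, rfl, h⟩ | ⟨e, v, rfl, rfl, h⟩ <;>
        rcases Net.sum_tgt_cases he' with ⟨e', v', rfl, rfl, h'⟩ | ⟨e', v', rfl, rfl, h'⟩
      · exact congrArg _ (C₁.box_inj _ _ _ _ h h' hv hv' (BoxTree.wedge_parent_inl_iff.1 hp)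
          (BoxTree.wedge_parent_inl_iff.1 hp') (BoxTree.wedgeInl_injective hb))
      · have h1 : C₁.box _ = _ := (BoxTree.wedge_disjoint hb).1
        exact absurd (congrArg il h1) (BoxTree.ne_root_of_parent hp)
      · have h1 : C₁.box _ = _ := (BoxTree.wedge_disjoint hb.symm).1
        exact absurd (congrArg il h1) (BoxTree.ne_root_of_parent hp')
      · exact congrArg _ (C₂.box_inj _ _ _ _ h h' hv hv' (BoxTree.wedge_parent_inr_iff.1 hp)
          (BoxTree.wedge_parent_inr_iff.1 hp') (BoxTree.wedgeInr_injective hb))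
  refine ⟨h.comp, ⟨⟨Net.sumInl _ _, il, Sum.inl_injective, Sum.inl_injective,
    BoxTree.wedgeInl_injective, rfl, fun _ _ => BoxTree.wedge_parent_inl, fun _ => rfl,
    fun e v he => Net.sum_tgt_inl he, ?_, ?_⟩, ⟨Net.sumInr _ _, ir, Sum.inr_injective,
    Sum.inr_injective, BoxTree.wedgeInr_injective, rfl, fun _ _ => BoxTree.wedge_parent_inr,
    fun _ => rfl, fun e v he => Net.sum_tgt_inr he, ?_, ?_⟩, ?_, ?_, rfl, BoxTree.wedge_cases,
    fun _ _ => BoxTree.wedge_disjoint⟩⟩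
  · rintro (e | e) v he
    · exact ⟨e, rfl⟩
    · cases he
  · rintro (v | v) b hb hne
    · exact ⟨v, rfl⟩
    · exact absurd (BoxTree.wedge_disjoint hb.symm).1 hne
  · rintro (e | e) v he
    · cases he
    · exact ⟨e, rfl⟩
  · rintro (v | v) b hb hne
    · exact absurd (BoxTree.wedge_disjoint hb).2 hne
    · exact ⟨v, rfl⟩
  · change (Sum.elim Sum.inl Sum.inr : C₁.net.V ⊕ C₂.net.V → _).Bijective
    rw [Sum.elim_inl_inr]; exact Function.bijective_id
  · change (Sum.elim Sum.inl Sum.inr : C₁.net.E ⊕ C₂.net.E → _).Bijective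
    rw [Sum.elim_inl_inr]; exact Function.bijective_id

theorem exists_zone_mix {L₁ L₂ : List Formula} {o₁ o₂ : Option Component} (h₁ : ZoneOK L₁ o₁)
    (h₂ : ZoneOK L₂ o₂) : ∃ o, ZoneOK (L₁ ++ L₂) o ∧
      ∀ c c₁ c₂, Juxtapose c c₁ c₂ → InZone o₁ c₁ → InZone o₂ c₂ → InZone o c := by
  rcases o₁ with _ | C₁
  · refine ⟨none, by simp [ZoneOK], fun c c₁ c₂ ⟨f, _⟩ h _ hc => ?_⟩
    obtain ⟨_, ⟨⟩, -⟩ := h (f.noDaimon hc)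
  rcases o₂ with _ | C₂
  · refine ⟨none, by simp [ZoneOK], fun c c₁ c₂ ⟨_, g, _⟩ _ h hc => ?_⟩
    obtain ⟨_, ⟨⟩, -⟩ := h (g.noDaimon hc)
  obtain ⟨C, ⟨M⟩⟩ := exists_mix C₁ C₂
  obtain ⟨hM₁, rfl⟩ := h₁ C₁ rfl
  obtain ⟨hM₂, rfl⟩ := h₂ C₂ rfl
  refine ⟨some C, ?_, ?_⟩
  · rintro _ ⟨⟩
    refine ⟨M.isMELL hM₁ hM₂, ?_⟩
    rw [Net.type, M.concl, List.map_append, List.map_map, List.map_map]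
    congr 1 <;> exact List.map_congr_left fun e _ => Net.Hom.typ_e _ e
  · intro c c₁ c₂ hj hz₁ hz₂ hc
    have hj' := hj
    obtain ⟨f, g, _⟩ := hj'
    obtain ⟨_, ⟨⟩, h1⟩ := hz₁ (f.noDaimon hc)
    obtain ⟨_, ⟨⟩, h2⟩ := hz₂ (g.noDaimon hc)
    exact ⟨C, rfl, M.mem_taylor h1 h2 hj⟩

/-! ## Splitting a component -/

/-- By `hS` the set `S` is a union of connected components, and by `hb'` a box belonging to `N` has
all its cells in `S`. The net and the tree can then be cut independently. -/
theorem Component.exists_part (C : Component) (S : C.net.V → Prop) (N : C.tree.Node → Prop)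
    (hS : ∀ e v, C.net.tgt e = some v → (S (C.net.src e) ↔ S v)) (hr : N C.tree.root)
    (hN : ∀ a b, C.tree.parent a = some b → N a → N b) (hb : ∀ v, S v → N (C.box v))
    (hb' : ∀ v, N (C.box v) → C.box v ≠ C.tree.root → S v) (l : List C.net.E) (hnd : l.Nodup)
    (hl : ∀ e, e ∈ l ↔ C.net.tgt e = none ∧ S (C.net.src e)) :
    ∃ (C₁ : Component) (P : Part C₁ C), Set.range P.F.v = {v | S v} ∧
      Set.range P.F.e = {e | S (C.net.src e)} ∧ Set.range P.i = {b | N b} ∧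
      C₁.net.concl.map P.F.e = l := by
  obtain ⟨N₁, F, hv, he, hrv, hre, hc, ht⟩ := C.net.exists_restrict S
    (fun e v h => (hS e v h).2) l hnd (fun e => by
      rw [hl]
      constructor
      · rintro ⟨h1, h2⟩
        exact ⟨h2, fun v hv => by rw [h1] at hv; cases hv⟩
      · rintro ⟨h1, h2⟩
        refine ⟨?_, h1⟩
        rcases h : C.net.tgt e with _ | v
        · rfl
        · exact absurd ((hS e v h).1 h1) (h2 v h))
  have hSv : ∀ v, S (F.v v) := fun v => by
    have : F.v v ∈ Set.range F.v := ⟨v, rfl⟩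
    rwa [hrv] at this
  have hN' : ∀ b, N b → b ≠ C.tree.root → ∃ p, C.tree.parent b = some p ∧ N p := fun b h h' => by
    obtain ⟨p, hp⟩ := BoxTree.exists_parent h'
    exact ⟨p, hp, hN _ _ hp h⟩
  let τ := C.tree.restrict N C.tree.root hr hN'
  have hpar : ∀ a b : τ.Node, τ.parent a = some b → C.tree.parent a.1 = some b.1 :=
    fun _ _ h => (BoxTree.restrict_parent.1 h).2
  let box : N₁.V → τ.Node := fun v => ⟨C.box (F.v v), hb _ (hSv v)⟩
  have hbox : IsBox N₁ τ box := by
    refine C.isBox.comap F box Subtype.val (fun _ => rfl) Subtype.val_injective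
      (fun a b h => (BoxTree.restrict_below (BoxTree.below_root _)).2 h) hpar
      (fun _ _ _ _ h => he h) fun e h => Subtype.ext ?_
    change C.box (F.v (N₁.src e)) = C.tree.root
    rw [← F.src_e]
    refine C.box_concl _ ?_
    have : F.e e ∈ l := hc ▸ List.mem_map_of_mem ((N₁.mem_concl e).2 h)
    exact ((hl _).1 this).1
  refine ⟨hbox.comp, ⟨F, Subtype.val, hv, he, Subtype.val_injective, rfl, hpar, fun _ => rfl, ?_,
    ?_, ?_⟩, hrv, hre, Subtype.range_val, hc⟩
  · intro e v h
    have : e ∈ Set.range F.e := hre ▸ (hS e _ h).2 (hSv v)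
    obtain ⟨e, rfl⟩ := this
    exact ⟨e, rfl, ht _ _ h⟩
  · intro e v h
    have : e ∈ Set.range F.e := by
      rw [hre]
      change S (C.net.src e)
      rw [h]; exact hSv v
    exact this
  · rintro v ⟨b, hbN⟩ h hne
    have : v ∈ Set.range F.v := by
      rw [hrv]
      refine hb' v ?_ fun h' => hne (Subtype.ext ?_)
      · rw [h]; exact hbN
      · exact h.symm.trans h'
    exact this

/-- Each part misses a cell of the other one, by `hex₁` and `hex₂`; this makes both sizes drop. -/
theorem Component.exists_mix_of_split (C : Component) (S : C.net.V → Prop)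
    (N₁ N₂ : C.tree.Node → Prop)
    (hS : ∀ e v, C.net.tgt e = some v → (S (C.net.src e) ↔ S v))
    (hr₁ : N₁ C.tree.root) (hr₂ : N₂ C.tree.root)
    (hN₁ : ∀ a b, C.tree.parent a = some b → N₁ a → N₁ b)
    (hN₂ : ∀ a b, C.tree.parent a = some b → N₂ a → N₂ b)
    (hN : ∀ b, N₁ b ∨ N₂ b) (hN' : ∀ b, N₁ b → N₂ b → b = C.tree.root)
    (hb₁ : ∀ v, S v → N₁ (C.box v)) (hb₂ : ∀ v, ¬ S v → N₂ (C.box v))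
    {l₁ l₂ : List C.net.E} (hc : C.net.concl = l₁ ++ l₂) (hl₁ : ∀ e ∈ l₁, S (C.net.src e))
    (hl₂ : ∀ e ∈ l₂, ¬ S (C.net.src e)) (hex₁ : ∃ v, S v) (hex₂ : ∃ v, ¬ S v) :
    ∃ C₁ C₂, Nonempty (Mix C C₁ C₂) ∧ C₁.net.type = l₁.map C.net.typ ∧
      C₂.net.type = l₂.map C.net.typ ∧ C₁.net.size < C.net.size ∧ C₂.net.size < C.net.size ∧
      Nonempty C₁.net.V ∧ Nonempty C₂.net.V := by
  have hnd := Net.nodup_of_append hc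
  have hmem : ∀ e, C.net.tgt e = none ↔ e ∈ l₁ ∨ e ∈ l₂ := fun e => by
    rw [← C.net.mem_concl, hc, List.mem_append]
  obtain ⟨C₁, P₁, hv₁, he₁, hi₁, hc₁⟩ := C.exists_part S N₁ hS hr₁ hN₁ hb₁
    (fun v h1 h2 => by
      by_contra h
      exact h2 (hN' _ h1 (hb₂ v h))) l₁ hnd.1 (fun e => by
      rw [hmem]
      exact ⟨fun h => ⟨.inl h, hl₁ e h⟩, fun h => h.1.resolve_right fun h' => hl₂ e h' h.2⟩)
  obtain ⟨C₂, P₂, hv₂, he₂, hi₂, hc₂⟩ := C.exists_part (fun v => ¬ S v) N₂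
    (fun e v h => not_congr (hS e v h)) hr₂ hN₂ hb₂
    (fun v h1 h2 h => h2 (hN' _ (hb₁ v h) h1)) l₂ hnd.2.1 (fun e => by
      rw [hmem]
      exact ⟨fun h => ⟨.inr h, hl₂ e h⟩, fun h => h.1.resolve_left fun h' => h.2 (hl₁ e h')⟩)
  have hv₁' : ∀ v, S (P₁.F.v v) := fun v => by
    have : P₁.F.v v ∈ Set.range P₁.F.v := ⟨v, rfl⟩
    rwa [hv₁] at this
  have hv₂' : ∀ v, ¬ S (P₂.F.v v) := fun v => by
    have : P₂.F.v v ∈ Set.range P₂.F.v := ⟨v, rfl⟩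
    rwa [hv₂] at this
  have he₁' : ∀ e, S (C.net.src (P₁.F.e e)) := fun e => by rw [P₁.F.src_e]; exact hv₁' _
  have he₂' : ∀ e, ¬ S (C.net.src (P₂.F.e e)) := fun e => by rw [P₂.F.src_e]; exact hv₂' _
  obtain ⟨v₁, hs₁⟩ := hex₁
  obtain ⟨v₂, hs₂⟩ := hex₂
  have hx₁ : v₁ ∈ Set.range P₁.F.v := by rw [hv₁]; exact hs₁
  have hx₂ : v₂ ∈ Set.range P₂.F.v := by rw [hv₂]; exact hs₂
  refine ⟨C₁, C₂, ⟨⟨P₁, P₂, ⟨P₁.inj_v.sumElim P₂.inj_v ?_, ?_⟩, ⟨P₁.inj_e.sumElim P₂.inj_e ?_, ?_⟩,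
    ?_, ?_, ?_⟩⟩, ?_, ?_, P₁.F.size_lt P₁.inj_v P₁.inj_e (w := v₂) ?_,
    P₂.F.size_lt P₂.inj_v P₂.inj_e (w := v₁) ?_, ⟨hx₁.choose⟩, ⟨hx₂.choose⟩⟩
  · intro a b h
    exact hv₂' b (h ▸ hv₁' a)
  · intro v
    by_cases h : S v
    · have : v ∈ Set.range P₁.F.v := by rw [hv₁]; exact h
      obtain ⟨u, rfl⟩ := this
      exact ⟨.inl u, rfl⟩
    · have : v ∈ Set.range P₂.F.v := by rw [hv₂]; exact h
      obtain ⟨u, rfl⟩ := this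
      exact ⟨.inr u, rfl⟩
  · intro a b h
    exact he₂' b (h ▸ he₁' a)
  · intro e
    by_cases h : S (C.net.src e)
    · have : e ∈ Set.range P₁.F.e := by rw [he₁]; exact h
      obtain ⟨u, rfl⟩ := this
      exact ⟨.inl u, rfl⟩
    · have : e ∈ Set.range P₂.F.e := by rw [he₂]; exact h
      obtain ⟨u, rfl⟩ := this
      exact ⟨.inr u, rfl⟩
  · rw [hc, hc₁, hc₂]
  · intro b
    rcases hN b with h | h
    · have : b ∈ Set.range P₁.i := by rw [hi₁]; exact h
      exact .inl this
    · have : b ∈ Set.range P₂.i := by rw [hi₂]; exact h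
      exact .inr this
  · intro b₁ b₂ h
    have h1 : P₁.i b₁ ∈ {b | N₁ b} := hi₁ ▸ ⟨b₁, rfl⟩
    have h2 : P₂.i b₂ ∈ {b | N₂ b} := hi₂ ▸ ⟨b₂, rfl⟩
    have h3 := hN' _ h1 (h ▸ h2)
    exact ⟨P₁.inj_i (h3.trans P₁.root.symm), P₂.inj_i (h.symm.trans (h3.trans P₂.root.symm))⟩
  · rw [← hc₁, List.map_map]
    exact List.map_congr_left fun e _ => (P₁.F.typ_e e).symm
  · rw [← hc₂, List.map_map]
    exact List.map_congr_left fun e _ => (P₂.F.typ_e e).symm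
  · intro v h
    exact hs₂ (h ▸ hv₁' v)
  · intro v h
    exact hv₂' v (h ▸ hs₁)

end Glue

namespace Glue

/-! ## Grafting trees on a new root -/

/-- The trees `T j`, with edges from their roots to a new root. -/
def BoxTree.graft {ι : Type} [Finite ι] (T : ι → BoxTree) : BoxTree where
  Node := Option (Σ j, (T j).Node)
  finite_Node := by have := fun j => (T j).finite_Node; infer_instance
  root := none
  parent x := x.map fun p => ((T p.1).parent p.2).map (Sigma.mk p.1)
  parent_eq_none x := Option.map_eq_none_iff
  reaches_root := by
    rintro (_ | ⟨j, b⟩)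
    · exact .refl
    · induction (T j).reaches_root b using Relation.ReflTransGen.head_induction_on with
      | refl => exact .single (by simp [(T j).parent_root])
      | head h _ ih => exact .head (by simp [h]) ih

namespace BoxTree

/-- The embedding of a grafted tree. -/
def graftIn {ι : Type} [Finite ι] (T : ι → BoxTree) (j : ι) (b : (T j).Node) : (graft T).Node :=
  some ⟨j, b⟩

section
variable {ι : Type} [Finite ι] {T : ι → BoxTree}

theorem graftIn_injective (j : ι) : (graftIn T j).Injective := by
  intro a b h
  exact eq_of_heq (Sigma.mk.inj (Option.some.inj h)).2

theorem graftIn_ne_root (j : ι) (b : (T j).Node) : graftIn T j b ≠ (graft T).root :=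
  Option.some_ne_none _

theorem eq_of_graftIn {j k : ι} {a : (T j).Node} {b : (T k).Node}
    (h : graftIn T j a = graftIn T k b) : j = k :=
  congrArg Sigma.fst (Option.some.inj h)

theorem graft_cases (x : (graft T).Node) : x = (graft T).root ∨ ∃ j b, graftIn T j b = x := by
  rcases x with _ | ⟨j, b⟩
  exacts [.inl rfl, .inr ⟨j, b, rfl⟩]

theorem graft_parent {j : ι} {a b : (T j).Node} (h : (T j).parent a = some b) :
    (graft T).parent (graftIn T j a) = some (graftIn T j b) := by
  simp [graft, graftIn, h]

theorem graft_parent_root (j : ι) :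
    (graft T).parent (graftIn T j (T j).root) = some (graft T).root := by
  simp [graft, graftIn, (T j).parent_root]

theorem graft_parent_iff {j : ι} {a b : (T j).Node} :
    (graft T).parent (graftIn T j a) = some (graftIn T j b) ↔ (T j).parent a = some b := by
  refine ⟨fun h => ?_, graft_parent⟩
  by_cases ha : a = (T j).root
  · subst ha
    rw [graft_parent_root] at h
    exact absurd (Option.some.inj h).symm (graftIn_ne_root j b)
  · obtain ⟨p, hp⟩ := exists_parent ha
    rw [graft_parent hp] at h
    rw [hp, graftIn_injective j (Option.some.inj h)]

theorem Below.graftIn {j : ι} {a b : (T j).Node} (h : (T j).Below a b) :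
    (graft T).Below (BoxTree.graftIn T j a) (BoxTree.graftIn T j b) :=
  Relation.ReflTransGen.lift _ (fun _ _ => graft_parent) _ _ h

end

/-- The embedding `i` adds a root below the tree `τ'`. -/
structure IsGraft (τ' τ : BoxTree) (i : τ'.Node → τ.Node) : Prop where
  inj : i.Injective
  ne_root : ∀ b, i b ≠ τ.root
  parent : ∀ a b, τ'.parent a = some b → τ.parent (i a) = some (i b)
  parent_root : τ.parent (i τ'.root) = some τ.root

/-- A thick subtree may have any number of edges over the edge into the root, so the given thick
subtrees are grafted side by side on one new root. They are unrelated to each other: the copies of a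
box may differ inside. For `n = 0` only the root is left. -/
theorem IsGraft.exists_thick {τ' τ : BoxTree} {i : τ'.Node → τ.Node} (h : IsGraft τ' τ i) {n : ℕ}
    (t' : Fin n → ThickSubtree τ') : ∃ (t : ThickSubtree τ) (e : ∀ j, ThickEmbedding i (t' j) t),
      (∀ j k s s', (e j).J s = (e k).J s' → j = k) ∧
      ∀ s b, i b = t.h s → ∃ j s', (e j).J s' = s ∧ b = (t' j).h s' := by
  let T := fun j => (t' j).tree
  let g : (graft T).Node → τ.Node := fun x => x.elim τ.root fun p => i ((t' p.1).h p.2)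
  refine ⟨⟨graft T, g, rfl, ?_⟩, fun j => ⟨graftIn T j, fun _ => rfl, graftIn_injective j,
    fun _ _ h => graft_parent (T := T) h⟩, fun j k s s' h => eq_of_graftIn (T := T) h, ?_⟩
  · intro s s' hs
    rcases graft_cases s with rfl | ⟨j, a, rfl⟩
    · rw [BoxTree.parent_root] at hs; cases hs
    · by_cases ha : a = (T j).root
      · subst ha
        rw [graft_parent_root] at hs
        rw [← Option.some.inj hs]
        change τ.parent (i ((t' j).h (t' j).tree.root)) = some τ.root
        rw [(t' j).h_root, h.parent_root]
      · obtain ⟨p, hp⟩ := exists_parent ha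
        rw [graft_parent hp] at hs
        rw [← Option.some.inj hs]
        exact h.parent _ _ ((t' j).h_parent _ _ hp)
  · intro s b hb
    rcases graft_cases s with rfl | ⟨j, a, rfl⟩
    · exact absurd hb (h.ne_root b)
    · exact ⟨j, a, rfl, h.inj hb⟩

end BoxTree

/-! ## Adding a box -/

theorem CellOK.bang_of {E : Type} (typ : E → Formula) {A : Formula} {a : E} (ha : typ a = A) :
    CellOK (Sum.elim typ fun i : Fin [Formula.bang A].length => [Formula.bang A][i])
      (fun e => ∃ e', e = .inl e' ∧ [a].head? = some e') .bang (Sum.inl '' {e | e ∈ [a]})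
      (Set.range Sum.inr) := by
  refine ⟨.inr ⟨0, by simp⟩, A, ?_, rfl, ?_⟩
  · ext (e | ⟨i, hi⟩)
    · simp
    · simp at hi; simp [hi]
  · rintro _ ⟨e, he, rfl⟩
    have : e = a := by simpa using he
    simp [this, ha]

/-- A new root is grafted below the box-tree. The added `!`-cell and the `?`-cells of the other
conclusions lie over it, and the rest of `C'` is the content of the new box. Full MELL is not asked
of `C'`: a daimon may lie over its root if, by `hd`, its only companions there are border cells,
because these leave the box. -/
theorem Component.exists_boxing (C' : Component) (hM : C'.IsMELLDaimon) {l : List C'.net.E}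
    {a : C'.net.E} (hc : C'.net.concl = l ++ [a])
    (hl : ∀ e ∈ l, C'.net.label (C'.net.src e) = .whynot)
    (hd : ∀ v p, C'.net.label v = .daimon p → ∀ w, C'.box w = C'.box v →
      w = v ∨ ∃ e ∈ l, C'.net.src e = w) :
    ∃ (C : Component) (D : AddCell .bang C.net C'.net) (O : C.net.E)
      (i : C'.tree.Node → C.tree.Node), IsBoxing D a O i ∧ BoxTree.IsGraft C'.tree C.tree i ∧
      C.IsMELL ∧ C.net.type = l.map C'.net.typ ++ [.bang (C'.net.typ a)] := by
  classical
  obtain ⟨N, D, rfl, has, hos⟩ := C'.net.exists_addCell .bang l [a] hc [.bang (C'.net.typ a)]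
    (CellOK.bang_of _ rfl)
  obtain ⟨O, hO, hOA⟩ : ∃ O, D.os = [O] ∧ N.typ O = .bang (C'.net.typ a) := by
    rcases h : D.os with _ | ⟨O, _ | ⟨_, _⟩⟩ <;> rw [h] at hos <;> simp at hos
    exact ⟨O, rfl, hos⟩
  let T : Unit → BoxTree := fun _ => C'.tree
  let i : C'.tree.Node → (BoxTree.graft T).Node := BoxTree.graftIn T ()
  have hi : i.Injective := BoxTree.graftIn_injective (T := T) ()
  have hir : ∀ b, i b ≠ (BoxTree.graft T).root := BoxTree.graftIn_ne_root (T := T) ()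
  have hip : ∀ {a b : C'.tree.Node}, (BoxTree.graft T).parent (i a) = some (i b) ↔
    C'.tree.parent a = some b := BoxTree.graft_parent_iff (T := T)
  have hir' : (BoxTree.graft T).parent (i C'.tree.root) = some (BoxTree.graft T).root :=
    BoxTree.graft_parent_root (T := T) ()
  have hil : ∀ {a b : C'.tree.Node}, C'.tree.Below a b → (BoxTree.graft T).Below (i a) (i b) :=
    fun h => BoxTree.Below.graftIn (T := T) h
  have hic : ∀ x, x ≠ (BoxTree.graft T).root → ∃ b, i b = x := fun x hx => by
    obtain ⟨⟨⟩, b, h⟩ := (BoxTree.graft_cases x).resolve_left hx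
    exact ⟨b, h⟩
  have key : ∀ v, ∃ b, (v = D.w → b = (BoxTree.graft T).root) ∧
      (∀ e ∈ D.l, D.f.v (C'.net.src e) = v → b = (BoxTree.graft T).root) ∧
      ∀ u, (∀ e ∈ D.l, C'.net.src e ≠ u) → D.f.v u = v → b = i (C'.box u) := by
    intro v
    rcases D.eq_or v with rfl | ⟨v, rfl⟩
    · exact ⟨_, fun _ => rfl, fun _ _ _ => rfl, fun u _ h => absurd h (D.f_ne_w u)⟩
    · by_cases hv : ∃ e ∈ D.l, C'.net.src e = v
      · refine ⟨_, fun _ => rfl, fun _ _ _ => rfl, fun u hu h => ?_⟩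
        obtain ⟨e, he, h'⟩ := hv
        exact absurd (h'.trans (D.inj_v h).symm) (hu e he)
      · refine ⟨i (C'.box v), fun h => absurd h (D.f_ne_w v),
          fun e he h => absurd ⟨e, he, D.inj_v h⟩ hv, fun u _ h => by rw [D.inj_v h]⟩
  choose box hbw hbl hbf using key
  have hw := hbw _ rfl
  have hbl' := fun e he => hbl _ e he rfl
  have hbf' := fun u hu => hbf _ u hu rfl
  have hsrc : ∀ e, e ∉ D.l → ∀ e' ∈ D.l, C'.net.src e' ≠ C'.net.src e := fun e he e' he' h =>
    he (Net.out_unique (.inl (hl _ he')) h.symm ▸ he')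
  have htl : ∀ e v, C'.net.tgt e = some v → e ∉ D.l := fun e v he h => by
    rw [Net.tgt_of_mem (by rw [D.concl']; exact List.mem_append_left _ h)] at he; cases he
  have hbs : ∀ e, e ∉ D.l → box (D.f.v (C'.net.src e)) = i (C'.box (C'.net.src e)) :=
    fun e he => hbf' _ (hsrc e he)
  have hac : a ∉ D.l := fun h => (Net.nodup_of_append hc).2.2 h (by simp)
  have har : C'.box (C'.net.src a) = C'.tree.root := C'.box_of_mem (by rw [hc]; simp)
  have hfa : D.f.e a ∈ {e | N.tgt e = some D.w} := D.tgt_as _ (by simp [has])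
  have hwe : ∀ e, N.tgt e = some D.w → e = D.f.e a := fun e he => by
    obtain ⟨a', ha', rfl⟩ := D.tgt_eq_w he
    rw [has, List.mem_singleton] at ha'
    rw [ha']
  have hlab : ∀ v, C'.net.label v ≠ .whynot → ∀ e ∈ D.l, C'.net.src e ≠ v := by
    rintro v hv e he rfl
    exact hv (hl e he)
  have hbe : ∀ e v, C'.net.tgt e = some v →
      box (N.src (D.f.e e)) = i (C'.box (C'.net.src e)) := fun e v he => by
    rw [D.f.src_e, hbs e (htl e v he)]
  have hba : box (N.src (D.f.e a)) = i C'.tree.root := by rw [D.f.src_e, hbs a hac, har]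
  have hB : IsBox N (BoxTree.graft T) box := by
    refine ⟨?_, ?_, ?_, ?_⟩
    · intro e v he
      rcases D.eq_or v with rfl | ⟨v, rfl⟩
      · rw [hw]; exact BoxTree.below_root _
      · obtain ⟨e, rfl, he'⟩ := D.tgt_eq_f he
        by_cases hv : ∃ e ∈ D.l, C'.net.src e = v
        · obtain ⟨e', h, rfl⟩ := hv
          rw [hbl' _ h]; exact BoxTree.below_root _
        · rw [hbe _ _ he', hbf' v fun e he h => hv ⟨e, he, h⟩]
          exact hil (C'.box_edge _ _ he')
    · intro e he
      rcases D.eq_or_e e with h | ⟨e, rfl⟩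
      · rw [(D.mem_os e).1 h, hw]
      · rcases D.tgt_cases e with ⟨u, -, h⟩ | ⟨-, h⟩ | ⟨h, -⟩
        · rw [h] at he; cases he
        · rw [h] at he; cases he
        · rw [D.f.src_e, hbl' e h]
    · intro e v he hne
      rcases D.eq_or v with rfl | ⟨v, rfl⟩
      · exact .inl D.label_w
      · obtain ⟨e, rfl, he'⟩ := D.tgt_eq_f he
        rw [D.f.label_v]
        by_cases hv : ∃ e ∈ D.l, C'.net.src e = v
        · obtain ⟨e', h, rfl⟩ := hv
          exact .inr (hl _ h)
        · rw [hbe _ _ he', hbf' v fun e he h => hv ⟨e, he, h⟩] at hne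
          exact C'.box_border _ _ he' fun h => hne (congrArg i h)
    · intro e e' v v' he he' hv hv' hp hp' hb
      -- An input of an old `!`-cell cannot be mapped to the new edge of the tree: that edge ends at
      -- the new root, whereas the old `!`-cells are inside the new box.
      have hone : ∀ {e v}, C'.net.tgt e = some v → N.label (D.f.v v) = .bang →
          box (N.src (D.f.e e)) = i C'.tree.root →
          (BoxTree.graft T).parent (box (N.src (D.f.e e))) = some (box (D.f.v v)) → False := by
        intro e v he hv h1 h2
        rw [D.f.label_v] at hv
        rw [h1, hir', hbf' v (hlab v (by simp [hv]))] at h2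
        exact hir _ (Option.some.inj h2).symm
      rcases D.eq_or v with rfl | ⟨v, rfl⟩ <;> rcases D.eq_or v' with rfl | ⟨v', rfl⟩
      · rw [hwe e he, hwe e' he']
      · obtain ⟨e', rfl, h1⟩ := D.tgt_eq_f he'
        rw [hwe e he, hba] at hb
        exact (hone h1 hv' hb.symm hp').elim
      · obtain ⟨e, rfl, h1⟩ := D.tgt_eq_f he
        rw [hwe e' he', hba] at hb
        exact (hone h1 hv hb hp).elim
      · obtain ⟨e, rfl, h1⟩ := D.tgt_eq_f he
        obtain ⟨e', rfl, h2⟩ := D.tgt_eq_f he'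
        rw [D.f.label_v] at hv hv'
        rw [hbe _ _ h1, hbf' v (hlab v (by simp [hv])), hip] at hp
        rw [hbe _ _ h2, hbf' v' (hlab v' (by simp [hv'])), hip] at hp'
        rw [hbe _ _ h1, hbe _ _ h2] at hb
        rw [C'.box_inj _ _ _ _ h1 h2 hv hv' hp hp' (hi hb)]
  refine ⟨hB.comp, D, O, i, ⟨has, hO, hl, hw, hbl', hbf'⟩,
    ⟨hi, hir, fun _ _ => hip.2, hir'⟩, ⟨⟨?_, ?_, ?_⟩, ?_⟩, ?_⟩
  · intro v hv
    change N.label v = .bang at hv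
    rcases D.eq_or v with rfl | ⟨v, rfl⟩
    · exact ⟨D.f.e a, hfa, fun e he => hwe e he⟩
    · rw [D.f.label_v] at hv
      obtain ⟨e, he, hu⟩ := hM.1 v hv
      refine ⟨D.f.e e, D.f.tgt_e _ _ he, fun e' he' => ?_⟩
      obtain ⟨e', rfl, h⟩ := D.tgt_eq_f he'
      rw [hu e' h]
  · intro e v he hv
    change N.tgt e = some v at he
    change N.label v = .bang at hv
    change (BoxTree.graft T).parent (box (N.src e)) = some (box v)
    rcases D.eq_or v with rfl | ⟨v, rfl⟩
    · rw [hwe e he, hba, hw, hir']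
    · obtain ⟨e, rfl, h1⟩ := D.tgt_eq_f he
      rw [D.f.label_v] at hv
      rw [hbe _ _ h1, hbf' v (hlab v (by simp [hv])), hip]
      exact hM.2.1 e v h1 hv
  · intro b hb
    obtain ⟨b, rfl⟩ := hic b hb
    by_cases h : b = C'.tree.root
    · subst h
      exact ⟨D.f.e a, D.w, hfa, D.label_w, hba⟩
    · obtain ⟨e, v, he, hv, hbox⟩ := hM.2.2 b h
      exact ⟨D.f.e e, D.f.v v, D.f.tgt_e _ _ he, (D.f.label_v v).trans hv,
        (hbe _ _ he).trans (congrArg i hbox)⟩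
  · intro v p hv
    change N.label v = .daimon p at hv
    rcases D.eq_or v with rfl | ⟨v, rfl⟩
    · rw [D.label_w] at hv; cases hv
    · rw [D.f.label_v] at hv
      have h1 : box (D.f.v v) = i (C'.box v) := hbf' v (hlab v (by simp [hv]))
      refine ⟨fun u hu => ?_, fun h => hir _ (h1.symm.trans h)⟩
      change box u = box (D.f.v v) at hu
      rw [h1] at hu
      rcases D.eq_or u with rfl | ⟨u, rfl⟩
      · exact absurd (hu.symm.trans hw) (hir _)
      · by_cases hu' : ∃ e ∈ D.l, C'.net.src e = u
        · obtain ⟨e, he, rfl⟩ := hu'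
          exact absurd (hu.symm.trans (hbl' e he)) (hir _)
        · rw [hbf' u fun e he h => hu' ⟨e, he, h⟩] at hu
          rw [(hd v p hv u (hi hu)).resolve_right hu']
  · change N.concl.map N.typ = _
    rw [D.concl, List.map_append, List.map_map, hO, List.map_singleton, hOA]
    congr 1
    exact List.map_congr_left fun e _ => D.f.typ_e e

/-! ## Nets as components -/

/-- The tree with one node. -/
def BoxTree.single : BoxTree where
  Node := Unit
  finite_Node := inferInstance
  root := ()
  parent _ := none
  parent_eq_none _ := by simp
  reaches_root _ := .refl

/-- A net, with no boxes. -/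
def Net.toComponent (c : Net) : Component where
  net := c
  tree := .single
  box _ := ()
  box_edge _ _ _ := .refl _
  box_concl _ _ := rfl
  box_border _ _ _ h := absurd rfl h
  box_inj _ _ _ _ _ _ _ _ h := by cases h

theorem Net.toComponent_isMELLDaimon {c : Net} (h : ∀ v, c.label v ≠ .bang) :
    c.toComponent.IsMELLDaimon :=
  ⟨fun v hv => absurd hv (h v), fun _ v _ hv => absurd hv (h v), fun _ hb => absurd rfl hb⟩

theorem Net.mem_taylor_toComponent (c : Net) : c ∈ c.toComponent.taylor := by
  refine ⟨⟨.single, id, rfl, fun _ _ h => by cases h⟩, ⟨⟨id, id, fun _ => (), fun _ => rfl, ?_, ?_,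
    fun _ => rfl, fun x => ?_, fun _ _ _ => .refl _, fun _ => rfl, fun _ => rfl, List.map_id _,
    fun _ _ _ _ => Iff.rfl⟩⟩⟩
  · exact fun v _ _ => ⟨v, ⟨rfl, rfl⟩, fun _ h => h.1⟩
  · exact fun v _ _ => ⟨v, ⟨rfl, rfl⟩, fun _ h => h.1⟩
  · change c.tgt x = (c.tgt x).map id
    simp

/-- A net of `?`-cells without inputs and of a daimon at the last conclusion. -/
def Net.weakenings (L : List Formula) (A : Formula) : Net where
  V := Option (Fin L.length)
  E := Option (Fin L.length)
  finite_V := inferInstance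
  finite_E := inferInstance
  label v := v.elim (.daimon 1) fun _ => .whynot
  typ e := e.elim A fun i => .whynot L[i]
  src := id
  tgt _ := none
  first _ := False
  concl := (List.finRange _).map some ++ [none]
  concl_nodup := by
    refine List.nodup_append'.2 ⟨(List.nodup_finRange _).map (Option.some_injective _), by simp, ?_⟩
    intro e h1 h2
    obtain ⟨_, -, rfl⟩ := List.mem_map.1 h1
    simp at h2
  mem_concl := by rintro (_ | i) <;> simp
  cell_ok := by
    rintro (_ | i)
    · refine ⟨by simp, ?_⟩
      change ({none} : Set (Option (Fin L.length))).ncard = 1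
      simp
    · exact ⟨some i, L[i], rfl, rfl, by simp⟩

/-- A single component serves all members of the zone: those with empty boxes take its content zero
times, the others take it `n` times. When the inner zone carries `none`, no daimon-free member has a
non-empty box, and the content can be a daimon. -/
theorem exists_zone_box {L : List Formula} {A : Formula} {o' : Option Component}
    (ho' : ZoneOK (L.map .whynot ++ [A]) o') :
    ∃ o, ZoneOK (L.map .whynot ++ [.bang A]) o ∧
      (∀ c, c.type = L.map .whynot ++ [.bang A] → IsEmptyBox c → InZone o c) ∧
      ∀ (c : Net) (n : ℕ) (c' : Fin n → Net), c.type = L.map .whynot ++ [.bang A] → 0 < n →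
        MergeBox c c' → (∀ j, InZone o' (c' j)) → InZone o c := by
  have key : ∃ (C' : Component) (l : List C'.net.E) (a : C'.net.E), (∀ C ∈ o', C = C') ∧
      C'.IsMELLDaimon ∧ C'.net.concl = l ++ [a] ∧
      (∀ e ∈ l, C'.net.label (C'.net.src e) = .whynot) ∧
      (∀ v p, C'.net.label v = .daimon p → ∀ w, C'.box w = C'.box v →
        w = v ∨ ∃ e ∈ l, C'.net.src e = w) ∧ l.map C'.net.typ = L.map .whynot ∧
      C'.net.typ a = A := by
    rcases o' with _ | C'
    · refine ⟨(Net.weakenings L A).toComponent, (List.finRange _).map some, none, by simp,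
        Net.toComponent_isMELLDaimon ?_, rfl, ?_, ?_, ?_, rfl⟩
      · rintro (_ | i) h <;> cases h
      · intro e he
        obtain ⟨i, -, rfl⟩ := List.mem_map.1 he
        rfl
      · rintro (_ | i) p hv w -
        · rcases w with _ | j
          · exact .inl rfl
          · exact .inr ⟨some j, List.mem_map_of_mem (List.mem_finRange j), rfl⟩
        · cases hv
      · change ((List.finRange L.length).map some).map
          (fun e => Option.elim e A fun i => .whynot L[i]) = _
        rw [List.map_map]
        apply List.ext_getElem <;> simp
    · obtain ⟨hM, ht⟩ := ho' C' rfl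
      rw [Net.type, List.map_eq_append_iff] at ht
      obtain ⟨l, as, hc, hl, has⟩ := ht
      rcases as with _ | ⟨a, _ | ⟨_, _⟩⟩ <;> simp at has
      refine ⟨C', l, a, by simp, hM.1, hc, ?_, fun v p hv w hw => .inl ((hM.2 v p hv).1 w hw),
        hl, has⟩
      intro e he
      have : C'.net.typ e ∈ L.map .whynot := hl ▸ List.mem_map_of_mem he
      obtain ⟨B, -, hB⟩ := List.mem_map.1 this
      exact hM.label_of_typ_whynot (by rw [hc]; simp [he]) hB.symm
  obtain ⟨C', l, a, ho, hM, hc, hl, hd, hlt, ha⟩ := key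
  obtain ⟨C, D, O, i, hB, hG, hCM, htype⟩ := C'.exists_boxing hM hc hl hd
  rw [hlt, ha] at htype
  refine ⟨some C, ?_, ?_, ?_⟩
  · rintro _ ⟨⟩
    exact ⟨hCM, htype⟩
  · intro c hct hE _
    -- The thick subtree with no copy of the box.
    obtain ⟨t, e, -, hcov⟩ := hG.exists_thick (n := 0) (fun j => j.elim0)
    obtain ⟨c₀, ⟨x⟩⟩ := exists_expansion C t
    refine ⟨C, rfl, t, x.of_iso (hE.iso (x.isEmptyBox hB fun s b h => ?_) ?_)⟩
    · obtain ⟨j, -⟩ := hcov s b h.symm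
      exact j.elim0
    · rw [hct, x.type_eq, htype]
  · intro c n c' hct hn hm hz hcd
    have hz' : ∀ j, c' j ∈ C'.taylor := fun j => by
      obtain ⟨f, _⟩ := hm
      obtain ⟨C₁, hC₁, h1⟩ := hz j ((f j).noDaimon hcd)
      rwa [ho C₁ hC₁] at h1
    choose t' x' using hz'
    obtain ⟨t, e, hdisj, hcov⟩ := hG.exists_thick t'
    obtain ⟨c₀, ⟨x⟩⟩ := exists_expansion C t
    refine ⟨C, rfl, t, x.of_iso (hm.iso hn (x.mergeBox hB hn (fun j => (x' j).some) e hdisj hcov) ?_)⟩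
    rw [hct, x.type_eq, htype]

end Glue

namespace Glue

/-! ## Removing a box -/

/-- The parts of a thick subtree over the part of a tree above an edge `b ⟶ root`. -/
theorem ThickSubtree.exists_parts {τ τ' : BoxTree} {i : τ'.Node → τ.Node}
    (hi : i.Injective) (hp : ∀ a b, τ'.parent a = some b ↔ a ≠ τ'.root ∧ τ.parent (i a) = some (i b))
    (hr : ∀ x, x ≠ τ.root ↔ ∃ a, i a = x) (hpr : τ.parent (i τ'.root) = some τ.root)
    (t : ThickSubtree τ) :
    ∃ (n : ℕ) (t' : Fin n → ThickSubtree τ') (e : ∀ j, ThickEmbedding i (t' j) t),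
      (∀ j k s s', (e j).J s = (e k).J s' → j = k) ∧
      ∀ s b, i b = t.h s → ∃ j s', (e j).J s' = s ∧ b = (t' j).h s' := by
  have := t.tree.finite_Node
  -- The copies of the box are indexed by the children of the root of the thick subtree.
  obtain ⟨n, ⟨ε⟩⟩ := Finite.exists_equiv_fin {s // t.tree.parent s = some t.tree.root}
  have hsub : ∀ j s, t.tree.Below s (ε.symm j).1 → ∃ a, i a = t.h s := fun j s hs => by
    rw [← hr]
    intro h
    have h1 := t.eq_root h
    subst h1
    exact BoxTree.ne_root_of_parent (ε.symm j).2 hs.eq_root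
  have hN : ∀ j s, t.tree.Below s (ε.symm j).1 → s ≠ (ε.symm j).1 →
      ∃ p, t.tree.parent s = some p ∧ t.tree.Below p (ε.symm j).1 := fun j s hs hne => by
    rcases hs.cases with h | h
    exacts [absurd h hne, h]
  let T := fun j => t.tree.restrict (fun s => t.tree.Below s (ε.symm j).1) _ (.refl _) (hN j)
  choose g hg using fun j (s : (T j).Node) => hsub j s.1 s.2
  -- The root of `τ` has only one child: any other node has a parent inside the image of `i`, which
  -- avoids the root.
  have hroot : ∀ s, t.tree.parent s = some t.tree.root → t.h s = i τ'.root := by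
    intro s hs
    have h1 := t.h_parent _ _ hs
    rw [t.h_root] at h1
    obtain ⟨a, ha⟩ := (hr _).1 (BoxTree.ne_root_of_parent h1)
    rw [← ha]
    congr 1
    by_contra hne
    obtain ⟨p, hap⟩ := BoxTree.exists_parent hne
    have h2 := ((hp _ _).1 hap).2
    rw [ha, h1] at h2
    exact (hr _).2 ⟨p, rfl⟩ (Option.some.inj h2).symm
  have hTp : ∀ j (s s' : (T j).Node), (T j).parent s = some s' → t.tree.parent s.1 = some s'.1 :=
    fun j _ _ h => (BoxTree.restrict_parent.1 h).2
  refine ⟨n, fun j => ⟨T j, g j, hi ((hg j _).trans (hroot _ (ε.symm j).2)), fun s s' hs => ?_⟩,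
    fun j => ⟨Subtype.val, fun s => (hg j s).symm, Subtype.val_injective, hTp j⟩, ?_, ?_⟩
  · refine (hp _ _).2 ⟨fun h => ?_, ?_⟩
    · have h1 := t.h_parent _ _ (hTp j _ _ hs)
      rw [← hg j s, ← hg j s', h, hpr] at h1
      exact (hr _).2 ⟨_, rfl⟩ (Option.some.inj h1).symm
    · rw [hg j s, hg j s']
      exact t.h_parent _ _ (hTp j _ _ hs)
  · intro j k s s' h
    have h1 : t.tree.Below s.1 (ε.symm j).1 := s.2
    have h2 : t.tree.Below s'.1 (ε.symm k).1 := s'.2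
    have h3 : s.1 = s'.1 := h
    rw [← h3] at h2
    have h4 := t.below_unique h1 h2 (by rw [hroot _ (ε.symm j).2, hroot _ (ε.symm k).2])
    exact ε.symm.injective (Subtype.ext h4)
  · intro s b hb
    obtain ⟨u, hu, hu'⟩ := BoxTree.exists_child (x := s) (by
      rintro rfl
      rw [t.h_root] at hb
      exact (hr _).2 ⟨b, hb⟩ rfl)
    obtain ⟨j, hj⟩ := ε.symm.surjective ⟨u, hu'⟩
    have hs : t.tree.Below s (ε.symm j).1 := by rw [hj]; exact hu
    exact ⟨j, ⟨s, hs⟩, rfl, hi (hb.trans (hg j ⟨s, hs⟩).symm)⟩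

/-- This inverts boxing. By `hb` all boxes are inside the one of `e₀`, and by `hroot` only the
`!`-cell and the `?`-cells of the border lie outside it. The thick subtrees decompose into copies of
the content, and no copy means an empty box. The content need not be MELL, as a daimon that fills
the box arrives at the root. -/
theorem Component.IsMELL.exists_unbox {C : Component} (hM : C.IsMELL) {l : List C.net.E}
    {O e₀ : C.net.E} (hc : C.net.concl = l ++ [O]) (hW : C.net.label (C.net.src O) = .bang)
    (he₀ : C.net.tgt e₀ = some (C.net.src O))
    (hl : ∀ e ∈ l, C.net.label (C.net.src e) = .whynot)
    (hroot : ∀ v, C.box v = C.tree.root → v = C.net.src O ∨ ∃ e ∈ l, C.net.src e = v)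
    (hb : ∀ x, x ≠ C.tree.root → C.tree.Below x (C.box (C.net.src e₀))) :
    ∃ C' : Component, C'.net.type = l.map C.net.typ ++ [C.net.typ e₀] ∧
      C'.net.size < C.net.size ∧ Nonempty C'.net.V ∧
      (C'.IsMELL ∨ ∃ v p, C'.net.label v = .daimon p ∧ C'.box v = C'.tree.root) ∧
      ∀ c ∈ C.taylor, IsEmptyBox c ∨
        ∃ n > 0, ∃ c' : Fin n → Net, MergeBox c c' ∧ ∀ j, c' j ∈ C'.taylor := by
  classical
  have hOr : C.box (C.net.src O) = C.tree.root := C.box_of_mem (by rw [hc]; simp)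
  have hpb : C.tree.parent (C.box (C.net.src e₀)) = some C.tree.root := by
    rw [hM.1.2.1 _ _ he₀ hW, hOr]
  have hbr := BoxTree.ne_root_of_parent hpb
  have he₀u : ∀ e, C.net.tgt e = some (C.net.src O) → e = e₀ := fun e he =>
    (hM.1.1 _ hW).unique he he₀
  obtain ⟨N, D, hDw, hos, has, hDl⟩ := C.net.exists_removeCell (C.net.src O) hW l [O] [e₀] hc
    (fun e => by
      rw [List.mem_singleton]
      exact ⟨fun h => h ▸ rfl, Net.out_unique (.inr hW)⟩) (by simp)
    (fun e => by
      rw [List.mem_singleton]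
      exact ⟨fun h => h ▸ he₀, he₀u e⟩) (by rintro (h | h) <;> cases h)
  obtain ⟨A, hA, rfl⟩ : ∃ A, D.as = [A] ∧ D.f.e A = e₀ := by
    rcases h : D.as with _ | ⟨A, _ | ⟨_, _⟩⟩ <;> rw [h] at has <;> simp at has
    exact ⟨A, rfl, has⟩
  have hlN : ∀ e ∈ D.l, N.label (N.src e) = .whynot := fun e he => by
    rw [← D.f.label_v, ← D.f.src_e]
    exact hl _ (hDl ▸ List.mem_map_of_mem he)
  have hsrc : ∀ e, e ∉ D.l → ∀ e' ∈ D.l, N.src e' ≠ N.src e := fun e he e' he' h =>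
    he (Net.out_unique (.inl (hlN _ he')) h.symm ▸ he')
  have htl : ∀ e v, N.tgt e = some v → e ∉ D.l := fun e v he h => by
    rw [Net.tgt_of_mem (by rw [D.concl']; exact List.mem_append_left _ h)] at he; cases he
  have hne : ∀ v, (∀ e ∈ D.l, N.src e ≠ v) → C.box (D.f.v v) ≠ C.tree.root := by
    intro v hv h
    rcases hroot _ h with h | ⟨e, he, h⟩
    · exact D.f_ne_w v (h.trans hDw.symm)
    · rw [← hDl] at he
      obtain ⟨e', he', rfl⟩ := List.mem_map.1 he
      rw [D.f.src_e] at h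
      exact hv e' he' (D.inj_v h)
  have hbl : ∀ e ∈ D.l, C.box (D.f.v (N.src e)) = C.tree.root := fun e he => by
    rw [← D.f.src_e]
    exact C.box_concl _ (D.tgt_l he)
  have hlab : ∀ v, N.label v ≠ .whynot → ∀ e ∈ D.l, N.src e ≠ v := by
    rintro v hv e he rfl
    exact hv (hlN e he)
  have hNp : ∀ x, x ≠ C.tree.root → x ≠ C.box (C.net.src (D.f.e A)) →
      ∃ p, C.tree.parent x = some p ∧ p ≠ C.tree.root := by
    intro x hx hxb
    rcases (hb x hx).cases with h | ⟨p, hp, h⟩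
    · exact absurd h hxb
    · refine ⟨p, hp, ?_⟩
      rintro rfl
      exact hbr h.eq_root
  let τ := C.tree.restrict (fun x => x ≠ C.tree.root) _ hbr hNp
  -- The border cells move up to the root of the content; all other cells keep their box.
  let box : N.V → τ.Node := fun v => if h : ∀ e ∈ D.l, N.src e ≠ v then
    ⟨C.box (D.f.v v), hne v h⟩ else τ.root
  have box_pos : ∀ v, (∀ e ∈ D.l, N.src e ≠ v) → (box v).1 = C.box (D.f.v v) := fun v h =>
    congrArg Subtype.val (dif_pos h : box v = ⟨C.box (D.f.v v), hne v h⟩)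
  have box_neg : ∀ e ∈ D.l, box (N.src e) = τ.root := fun e he => dif_neg fun h => h e he rfl
  have box_src : ∀ e, e ∉ D.l → (box (N.src e)).1 = C.box (C.net.src (D.f.e e)) := fun e he => by
    rw [box_pos _ (hsrc e he), D.f.src_e]
  have hval : ∀ {a b : τ.Node}, a.1 = b.1 → a = b := Subtype.ext
  have hτr : τ.root.1 = C.box (C.net.src (D.f.e A)) := rfl
  have hτp : ∀ a b : τ.Node, τ.parent a = some b ↔ a ≠ τ.root ∧ C.tree.parent a.1 = some b.1 :=
    fun a b => BoxTree.restrict_parent.trans (and_congr_left fun _ => not_congr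
      ⟨fun h => hval h, fun h => congrArg Subtype.val h⟩)
  have hAl : A ∉ D.l := fun h => (Net.nodup_of_append D.concl').2.2 h (by simp [hA])
  have hparent : ∀ e v, N.tgt e = some v → N.label v = .bang →
      τ.parent (box (N.src e)) = some (box v) := by
    intro e v he hv
    have hv' := hlab v (by simp [hv])
    have h1 := hM.1.2.1 _ _ (D.f.tgt_e _ _ he) (by rw [D.f.label_v, hv])
    refine (hτp _ _).2 ⟨fun h => ?_, ?_⟩
    · have h2 := box_src e (htl e v he)
      rw [h, hτr] at h2
      rw [← h2, hpb] at h1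
      exact hne v hv' (Option.some.inj h1).symm
    · rw [box_src e (htl e v he), box_pos v hv', h1]
  have hB : IsBox N τ box := by
    refine ⟨?_, ?_, ?_, ?_⟩
    · intro e v he
      by_cases hv : ∀ e ∈ D.l, N.src e ≠ v
      · refine (BoxTree.restrict_below (hb _ (box v).2)).2 ?_
        rw [box_src e (htl e v he), box_pos v hv]
        exact C.box_edge _ _ (D.f.tgt_e _ _ he)
      · push Not at hv
        obtain ⟨e', he', rfl⟩ := hv
        rw [box_neg e' he']
        exact BoxTree.below_root _
    · intro e he
      rw [← N.mem_concl, D.concl', List.mem_append] at he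
      rcases he with he | he
      · exact box_neg e he
      · rw [hA, List.mem_singleton] at he
        subst he
        exact hval (box_src e hAl)
    · intro e v he hne'
      by_cases hv : ∀ e ∈ D.l, N.src e ≠ v
      · rw [← D.f.label_v]
        refine C.box_border _ _ (D.f.tgt_e _ _ he) fun h => hne' (hval ?_)
        rw [box_src e (htl e v he), box_pos v hv, h]
      · push Not at hv
        obtain ⟨e', he', rfl⟩ := hv
        exact .inr (hlN e' he')
    · intro e e' v v' he he' hv hv' _ _ hbb
      have h1 := D.f.tgt_e _ _ he
      have h2 := D.f.tgt_e _ _ he'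
      have h3 : C.net.label (D.f.v v) = .bang := by rw [D.f.label_v, hv]
      have h4 : C.net.label (D.f.v v') = .bang := by rw [D.f.label_v, hv']
      refine D.inj_e (C.box_inj _ _ _ _ h1 h2 h3 h4 (hM.1.2.1 _ _ h1 h3) (hM.1.2.1 _ _ h2 h4) ?_)
      rw [← box_src e (htl e v he), ← box_src e' (htl e' v' he'), hbb]
  have hBox : IsBoxing (C := C) (C' := hB.comp) D A O (Subtype.val : τ.Node → C.tree.Node) :=
    ⟨hA, hos, hlN, by rw [hDw, hOr], hbl, fun v hv => (box_pos v hv).symm⟩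
  refine ⟨hB.comp, ?_, D.f.size_lt D.inj_v D.inj_e D.f_ne_w, ⟨N.src A⟩, ?_, ?_⟩
  · rw [Net.type, D.concl', hA, List.map_append, List.map_singleton, ← D.f.typ_e A, ← hDl,
      List.map_map]
    congr 1
    exact List.map_congr_left fun e _ => (D.f.typ_e e).symm
  -- A daimon over the new root is the only obstruction to MELL. Without one, no daimon shares its
  -- box with a border cell, as these are now over the root.
  · by_cases hd : ∃ v p, N.label v = .daimon p ∧ box v = τ.root
    · exact .inr hd
    refine .inl ⟨⟨?_, hparent, ?_⟩, ?_⟩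
    · intro v hv
      change N.label v = .bang at hv
      obtain ⟨e, he, hu⟩ := hM.1.1 (D.f.v v) (by rw [D.f.label_v, hv])
      obtain ⟨e, rfl, he'⟩ := D.tgt_eq_f he
      exact ⟨e, he', fun e₁ h₁ => D.inj_e (hu _ (D.f.tgt_e _ _ h₁))⟩
    · intro x hx
      obtain ⟨e, v, he, hv, hbox⟩ := hM.1.2.2 x.1 x.2
      rcases D.eq_or v with rfl | ⟨v, rfl⟩
      · rw [hDw] at he
        rw [he₀u e he] at hbox
        exact absurd (hval hbox.symm) hx
      · obtain ⟨e, rfl, he'⟩ := D.tgt_eq_f he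
        exact ⟨e, v, he', (D.f.label_v v).symm.trans hv,
          hval ((box_src e (htl e v he')).trans hbox)⟩
    · intro v p hv
      change N.label v = .daimon p at hv
      have hv' := hlab v (by simp [hv])
      refine ⟨fun w hw => ?_, fun h => hd ⟨v, p, hv, h⟩⟩
      change box w = box v at hw
      by_cases hw' : ∀ e ∈ D.l, N.src e ≠ w
      · refine D.inj_v ((hM.2 _ p (by rw [D.f.label_v, hv])).1 _ ?_)
        rw [← box_pos v hv', ← box_pos w hw', hw]
      · push Not at hw'
        obtain ⟨e', he', rfl⟩ := hw'
        rw [box_neg e' he'] at hw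
        exact absurd ⟨v, p, hv, hw.symm⟩ hd
  · rintro c ⟨t, ⟨x⟩⟩
    obtain ⟨n, t', e, hdisj, hcov⟩ := t.exists_parts (τ' := τ) (i := Subtype.val)
      Subtype.val_injective hτp (fun x => ⟨fun h => ⟨⟨x, h⟩, rfl⟩, by rintro ⟨a, rfl⟩; exact a.2⟩)
      hpb
    rcases Nat.eq_zero_or_pos n with rfl | hn
    · refine .inl (x.isEmptyBox hBox fun s b h => ?_)
      obtain ⟨j, -⟩ := hcov s b h.symm
      exact j.elim0
    · choose c' x' using fun j => exists_expansion hB.comp (t' j)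
      exact .inr ⟨n, hn, c', x.mergeBox hBox hn (fun j => (x' j).some) e hdisj hcov,
        fun j => ⟨t' j, x' j⟩⟩

end Glue

namespace Glue

/-! ## Zones: from the end of a path to its beginning -/

theorem exists_zone_exchange {L L' : List Formula} {A B : Formula} {o' : Option Component}
    (ho' : ZoneOK (L ++ B :: A :: L') o') :
    ∃ o, ZoneOK (L ++ A :: B :: L') o ∧
      ∀ c c', Exchange L.length c c' → InZone o' c' → InZone o c := by
  rcases o' with _ | C'
  · refine ⟨none, by simp [ZoneOK], fun c c' ⟨f, _⟩ h hc => ?_⟩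
    obtain ⟨_, ⟨⟩, -⟩ := h (f.noDaimon hc)
  · obtain ⟨hM, ht⟩ := ho' C' rfl
    rw [Net.type, List.map_eq_append_iff] at ht
    obtain ⟨l, bs, hc, hl, hbs⟩ := ht
    rcases bs with _ | ⟨b, _ | ⟨a, l'⟩⟩ <;> simp at hbs
    obtain ⟨hb, ha, hl'⟩ := hbs
    refine ⟨some (C'.withConcl (l ++ a :: b :: l') (hc ▸ perm_swap l b a l')), ?_, ?_⟩
    · rintro _ ⟨⟩
      refine ⟨hM.withConcl _ _, ?_⟩
      change (l ++ a :: b :: l').map C'.net.typ = _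
      simp [hl, ha, hb, hl']
    · intro c c' hE hz hcd
      have hE' := hE
      obtain ⟨f, _⟩ := hE'
      obtain ⟨_, ⟨⟩, t, ⟨x⟩⟩ := hz (f.noDaimon hcd)
      obtain ⟨l₁, u, v, l₁', hlen, hc', hiso⟩ := hE.iso
      have h := x.concl_comm
      rw [hc', hc, List.map_append] at h
      obtain ⟨h1, h2⟩ := List.append_inj h (by
        rw [List.length_map, hlen, ← hl, List.length_map])
      simp only [List.map_cons, List.cons.injEq] at h2
      obtain ⟨x'⟩ := x.withConcl (l₁ ++ u :: v :: l₁') (hc' ▸ perm_swap l₁ v u l₁')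
        (l ++ a :: b :: l') (hc ▸ perm_swap l b a l') (by simp [h1, h2])
      exact ⟨_, rfl, t, x'.of_iso hiso.symm⟩

theorem IsLone.iso {c d : Net} {ℓ : CellType} (h : IsLone c ℓ) (h' : IsLone d ℓ)
    (ht : c.type = d.type) : Net.Iso c d := by
  obtain ⟨v, hv, hl, he⟩ := h
  obtain ⟨u, hu, hl', he'⟩ := h'
  have hlen : c.concl.length = d.concl.length := by simpa [Net.type] using congrArg List.length ht
  refine Net.iso_of_cover (α := Unit) (β := Fin c.concl.length) (fV := fun _ => v) (gV := fun _ => u)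
    (fE := fun i => c.concl[i]) (gE := fun i => d.concl[i]) (fun x => ⟨(), (hv x).symm⟩)
    (fun x => ⟨(), (hu x).symm⟩) ?_ ?_ (fun _ _ => Iff.rfl.trans (by simp)) ?_
    (fun _ => hl'.trans hl.symm) ?_ (fun e a _ => hu _) ?_ ?_ ⟨List.finRange _, ?_, ?_⟩
  · intro e
    obtain ⟨i, hi, rfl⟩ := List.mem_iff_getElem.1 ((c.mem_concl e).2 (he e))
    exact ⟨⟨i, hi⟩, rfl⟩
  · intro e
    obtain ⟨i, hi, rfl⟩ := List.mem_iff_getElem.1 ((d.mem_concl e).2 (he' e))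
    exact ⟨⟨i, hlen ▸ hi⟩, rfl⟩
  · rintro ⟨i, hi⟩ ⟨j, hj⟩
    simp [c.concl_nodup.getElem_inj_iff, d.concl_nodup.getElem_inj_iff]
  · rintro ⟨i, hi⟩
    have h1 : c.type[i]'(by simpa [Net.type] using hi) = d.type[i]'(by
      simpa [Net.type, ← hlen] using hi) := by simp only [ht]
    simpa [Net.type] using h1.symm
  · intro e a h
    rw [he] at h; cases h
  · intro e a h
    rw [he] at h; cases h
  · apply List.ext_getElem <;> simp
  · apply List.ext_getElem <;> simp [hlen]

/-- A lone cell is determined by its label and its type. There may be none of type `L`, for instance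
when the `ax` rule is used at a formula that is not a variable; then the rule can only delete
daimons and `none` is right. -/
theorem exists_zone_lone (L : List Formula) {ℓ : CellType} (hb : ℓ ≠ .bang)
    (hd : ∀ p, ℓ ≠ .daimon p) :
    ∃ o, ZoneOK L o ∧ ∀ c, c.type = L → (IsLone c ℓ ∨ IsDaimon c) → InZone o c := by
  by_cases h : ∃ c₀ : Net, c₀.type = L ∧ IsLone c₀ ℓ
  · obtain ⟨c₀, rfl, h₀⟩ := h
    refine ⟨some c₀.toComponent, ?_, fun c hc h hcd => ?_⟩
    · rintro _ ⟨⟩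
      obtain ⟨v, hv, hl, -⟩ := h₀
      refine ⟨⟨Net.toComponent_isMELLDaimon fun u h => ?_, fun u p h => ?_⟩, rfl⟩
      · rw [hv u, hl] at h; exact hb h
      · change c₀.label u = _ at h
        rw [hv u, hl] at h
        exact absurd h (hd p)
    · rcases h with h | h
      · exact ⟨_, rfl, Component.mem_taylor_of_iso c₀.mem_taylor_toComponent (h.iso h₀ hc)⟩
      · exact absurd hcd h.not_noDaimon
  · refine ⟨none, by simp [ZoneOK], fun c hc h' hcd => ?_⟩
    rcases h' with h' | h'
    · exact absurd ⟨c, hc, h'⟩ h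
    · exact absurd hcd h'.not_noDaimon

theorem CellOK.binary_of {E : Type} (typ : E → Formula) {as : List E} (hnd : as.Nodup)
    {A B : Formula} (has : as.map typ = [A, B]) :
    ∃ a b, as = [a, b] ∧ a ≠ b ∧ typ a = A ∧ typ b = B := by
  rcases as with _ | ⟨a, _ | ⟨b, _ | ⟨_, _⟩⟩⟩ <;> simp at has hnd
  exact ⟨a, b, rfl, hnd, has⟩

theorem type_os_of_addCell {ℓ : CellType} {c c' : Net} (D : AddCell ℓ c c') {L outs : List Formula}
    (h : c.type = L ++ outs) (hlen : D.os.length = outs.length) : D.os.map c.typ = outs := by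
  rw [Net.type, D.concl, List.map_append] at h
  exact (List.append_inj' h (by simpa using hlen)).2

/-- The component is chosen before any net is considered, so it is common to all nets to which the
rule is applied. Where the rule acts on a daimon there is nothing to show, since `InZone` constrains
only nets without daimons. -/
theorem Rule.exists_zone {L : List Formula} {M : Sequent} (r : Rule L M)
    {os : List (Option Component)} (h : List.Forall₂ ZoneOK M os) :
    ∃ o, ZoneOK L o ∧ ∀ c X, c.type = L → r.Act c X →
      (∀ x ∈ X, List.Forall₂ InZone os x) → InZone o c := by
  cases r with
  | exc L A B L' =>
    obtain ⟨o', rfl, h₁⟩ : ∃ o', os = [o'] ∧ ZoneOK (L ++ B :: A :: L') o' := by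
      rcases h with _ | ⟨h, ⟨⟩⟩; exact ⟨_, rfl, h⟩
    obtain ⟨o, ho, hz⟩ := exists_zone_exchange h₁
    refine ⟨o, ho, ?_⟩
    rintro c X - ⟨c', rfl, hE⟩ hX
    exact hz c c' hE (by simpa using hX)
  | mix L A B L' =>
    obtain ⟨o₁, o₂, rfl, h₁, h₂⟩ : ∃ o₁ o₂, os = [o₁, o₂] ∧ ZoneOK (L ++ [A]) o₁ ∧
        ZoneOK (B :: L') o₂ := by
      rcases h with _ | ⟨h, _ | ⟨h', ⟨⟩⟩⟩; exact ⟨_, _, rfl, h, h'⟩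
    obtain ⟨o, ho, hz⟩ := exists_zone_mix h₁ h₂
    refine ⟨o, by simpa using ho, ?_⟩
    rintro c X - ⟨c₁, c₂, rfl, hJ | ⟨hd, -⟩⟩ hX
    · have : InZone o₁ c₁ ∧ InZone o₂ c₂ := by simpa using hX
      exact hz c c₁ c₂ hJ this.1 this.2
    · exact fun hc => absurd hc hd.not_noDaimon
  | ax A =>
    obtain ⟨o, ho, hz⟩ := exists_zone_lone [A, A.dual] (ℓ := .ax) (by simp) (by simp)
    exact ⟨o, ho, fun c X hc ⟨_, hA⟩ _ => hz c hc hA⟩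
  | cut L A =>
    obtain ⟨o', rfl, h₁⟩ : ∃ o', os = [o'] ∧ ZoneOK (L ++ [A, A.dual]) o' := by
      rcases h with _ | ⟨h, ⟨⟩⟩; exact ⟨_, rfl, h⟩
    obtain ⟨o, ho, hz⟩ := AddCell.exists_zone (ℓ := .cut) (by simp) (by simp)
      (outs := []) (fun E typ as hnd has => by
      obtain ⟨a, b, rfl, hab, ha, hb⟩ := CellOK.binary_of typ hnd has
      refine ⟨?_, .inl a, .inl b, ?_, by simp [ha, hb]⟩
      · ext (e | ⟨i, hi⟩)
        · simp
        · exact absurd hi (by simp)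
      · ext (e | e) <;> simp) h₁
    refine ⟨o, by simpa using ho, ?_⟩
    rintro c X hc ⟨c', rfl, hR | ⟨hd, -⟩⟩ hX
    · obtain ⟨D, h1, h2⟩ := hR.exists_addCell
      exact hz c c' D (by simpa using h1) (by simp [h2]) (by simpa using hX)
    · exact fun hc => absurd hc hd.not_noDaimon
  | daimon L A =>
    -- This rule deletes daimons only, so no component is needed.
    refine ⟨none, by simp [ZoneOK], ?_⟩
    rintro c X - ⟨-, hd⟩ - hc
    exact absurd hc hd.not_noDaimon
  | one =>
    obtain ⟨o, ho, hz⟩ := exists_zone_lone [.one] (ℓ := .one) (by simp) (by simp)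
    exact ⟨o, ho, fun c X hc ⟨_, hA⟩ _ => hz c hc hA⟩
  | bot =>
    obtain ⟨o, ho, hz⟩ := exists_zone_lone [.bot] (ℓ := .bot) (by simp) (by simp)
    exact ⟨o, ho, fun c X hc ⟨_, hA⟩ _ => hz c hc hA⟩
  | tensor L A B =>
    obtain ⟨o', rfl, h₁⟩ : ∃ o', os = [o'] ∧ ZoneOK (L ++ [A, B]) o' := by
      rcases h with _ | ⟨h, ⟨⟩⟩; exact ⟨_, rfl, h⟩
    obtain ⟨o, ho, hz⟩ := AddCell.exists_zone (ℓ := .tensor) (by simp) (by simp)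
      (outs := [.tensor A B]) (fun E typ as hnd has => by
      obtain ⟨a, b, rfl, hab, ha, hb⟩ := CellOK.binary_of typ hnd has
      refine ⟨.inl a, .inl b, .inr ⟨0, by simp⟩, ?_, ⟨a, rfl, rfl⟩, ?_, ?_, by simp [ha, hb]⟩
      · ext (e | e) <;> simp
      · simpa using hab
      · ext (e | ⟨i, hi⟩)
        · simp
        · simp at hi; simp [hi]) h₁
    refine ⟨o, ho, ?_⟩
    rintro c X hc ⟨c', rfl, hR | ⟨hd, -⟩⟩ hX
    · obtain ⟨D, h1, h2⟩ := hR.exists_addCell (.inl rfl)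
      exact hz c c' D (by simpa using h1) (type_os_of_addCell D hc (by simpa using h2))
        (by simpa using hX)
    · exact fun hc => absurd hc hd.not_noDaimon
  | par L A B =>
    obtain ⟨o', rfl, h₁⟩ : ∃ o', os = [o'] ∧ ZoneOK (L ++ [A, B]) o' := by
      rcases h with _ | ⟨h, ⟨⟩⟩; exact ⟨_, rfl, h⟩
    obtain ⟨o, ho, hz⟩ := AddCell.exists_zone (ℓ := .par) (by simp) (by simp)
      (outs := [.par A B]) (fun E typ as hnd has => by
      obtain ⟨a, b, rfl, hab, ha, hb⟩ := CellOK.binary_of typ hnd has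
      refine ⟨.inl a, .inl b, .inr ⟨0, by simp⟩, ?_, ⟨a, rfl, rfl⟩, ?_, ?_, by simp [ha, hb]⟩
      · ext (e | e) <;> simp
      · simpa using hab
      · ext (e | ⟨i, hi⟩)
        · simp
        · simp at hi; simp [hi]) h₁
    refine ⟨o, ho, ?_⟩
    rintro c X hc ⟨c', rfl, hR | ⟨hd, -⟩⟩ hX
    · obtain ⟨D, h1, h2⟩ := hR.exists_addCell (.inr rfl)
      exact hz c c' D (by simpa using h1) (type_os_of_addCell D hc (by simpa using h2))
        (by simpa using hX)
    · exact fun hc => absurd hc hd.not_noDaimon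
  | contr L A =>
    obtain ⟨o', rfl, h₁⟩ : ∃ o', os = [o'] ∧ ZoneOK (L ++ [.whynot A, .whynot A]) o' := by
      rcases h with _ | ⟨h, ⟨⟩⟩; exact ⟨_, rfl, h⟩
    obtain ⟨o, ho, hz⟩ := exists_zone_contraction h₁
    refine ⟨o, ho, ?_⟩
    rintro c X - ⟨c', rfl, hS | ⟨hd, -⟩⟩ hX
    · exact hz c c' hS (by simpa using hX)
    · exact fun hc => absurd hc hd.not_noDaimon
  | der L A =>
    obtain ⟨o', rfl, h₁⟩ : ∃ o', os = [o'] ∧ ZoneOK (L ++ [A]) o' := by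
      rcases h with _ | ⟨h, ⟨⟩⟩; exact ⟨_, rfl, h⟩
    obtain ⟨o, ho, hz⟩ := AddCell.exists_zone (ℓ := .whynot) (by simp) (by simp)
      (outs := [.whynot A]) (fun E typ as hnd has => by
      rcases as with _ | ⟨a, _ | ⟨_, _⟩⟩ <;> simp at has
      refine ⟨.inr ⟨0, by simp⟩, A, ?_, rfl, by simp [has]⟩
      ext (e | ⟨i, hi⟩)
      · simp
      · simp at hi; simp [hi]) h₁
    refine ⟨o, ho, ?_⟩
    rintro c X hc ⟨c', rfl, hR | ⟨hd, -⟩⟩ hX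
    · obtain ⟨D, h1, h2⟩ := hR.exists_addCell
      exact hz c c' D (by simpa using h1) (type_os_of_addCell D hc (by simpa using h2))
        (by simpa using hX)
    · exact fun hc => absurd hc hd.not_noDaimon
  | weak A =>
    obtain ⟨o, ho, hz⟩ := exists_zone_lone [.whynot A] (ℓ := .whynot) (by simp) (by simp)
    exact ⟨o, ho, fun c X hc ⟨_, hA⟩ _ => hz c hc hA⟩
  | box L A =>
    obtain ⟨o', rfl, h₁⟩ : ∃ o', os = [o'] ∧ ZoneOK (L.map .whynot ++ [A]) o' := by
      rcases h with _ | ⟨h, ⟨⟩⟩; exact ⟨_, rfl, h⟩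
    obtain ⟨o, ho, hz, hz'⟩ := exists_zone_box h₁
    refine ⟨o, ho, ?_⟩
    rintro c X hc (⟨c', rfl, -, hd | hE⟩ | ⟨n, c', hn, hm, rfl⟩) hX
    · exact fun hc => absurd hc hd.not_noDaimon
    · exact hz c hc hE
    · refine hz' c n c' hc hn hm fun j => ?_
      have := hX _ ⟨j, rfl⟩
      simpa using this

/-! ### From one rule to a whole path -/

theorem Rule.Act.nonempty {L : List Formula} {M : Sequent} {r : Rule L M} {c : Net}
    {X : Set ResourceQPS} (h : r.Act c X) : X.Nonempty := by
  cases r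
  case exc => obtain ⟨_, rfl, -⟩ := h; simp
  case mix => obtain ⟨_, _, rfl, -⟩ := h; simp
  case ax => obtain ⟨rfl, -⟩ := h; simp
  case cut => obtain ⟨_, rfl, -⟩ := h; simp
  case daimon => obtain ⟨rfl, -⟩ := h; simp
  case one => obtain ⟨rfl, -⟩ := h; simp
  case bot => obtain ⟨rfl, -⟩ := h; simp
  case tensor => obtain ⟨_, rfl, -⟩ := h; simp
  case par => obtain ⟨_, rfl, -⟩ := h; simp
  case contr => obtain ⟨_, rfl, -⟩ := h; simp
  case der => obtain ⟨_, rfl, -⟩ := h; simp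
  case weak => obtain ⟨rfl, -⟩ := h; simp
  case box =>
    rcases h with ⟨_, rfl, -⟩ | ⟨n, _, hn, -, rfl⟩
    · simp
    · exact ⟨_, ⟨0, hn⟩, rfl⟩

theorem forall₂_append_left_iff {α β : Type*} {R : α → β → Prop} {l₁ l₂ : List α} {m : List β} :
    List.Forall₂ R (l₁ ++ l₂) m ↔
      ∃ m₁ m₂, m = m₁ ++ m₂ ∧ List.Forall₂ R l₁ m₁ ∧ List.Forall₂ R l₂ m₂ := by
  induction l₁ generalizing m with
  | nil => simp
  | cons a l₁ ih =>
    rw [List.cons_append, List.forall₂_cons_left_iff]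
    constructor
    · rintro ⟨b, u, hb, hu, rfl⟩
      obtain ⟨m₁, m₂, rfl, h1, h2⟩ := ih.1 hu
      exact ⟨b :: m₁, m₂, rfl, .cons hb h1, h2⟩
    · rintro ⟨m₁, m₂, rfl, h1, h2⟩
      obtain ⟨b, u, hb, hu, rfl⟩ := List.forall₂_cons_left_iff.1 h1
      exact ⟨b, u ++ m₂, hb, ih.2 ⟨u, m₂, rfl, hu, h2⟩, rfl⟩

theorem forall₂_append_iff {α β : Type*} {R : α → β → Prop} {l₁ l₂ : List α} {m₁ m₂ : List β}
    (h : l₁.length = m₁.length) :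
    List.Forall₂ R (l₁ ++ l₂) (m₁ ++ m₂) ↔ List.Forall₂ R l₁ m₁ ∧ List.Forall₂ R l₂ m₂ := by
  rw [forall₂_append_left_iff]
  constructor
  · rintro ⟨m₃, m₄, h1, h2, h3⟩
    obtain ⟨rfl, rfl⟩ := List.append_inj h1 (h.symm.trans h2.length_eq)
    exact ⟨h2, h3⟩
  · exact fun h => ⟨m₁, m₂, rfl, h⟩

theorem Elementary.exists_zones {Γ Γ' : Sequent} (a : Elementary Γ Γ')
    {os' : List (Option Component)} (h : List.Forall₂ ZoneOK Γ' os') :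
    ∃ os, List.Forall₂ ZoneOK Γ os ∧ ∀ ρ S, a.Act ρ S → (∀ σ ∈ S, List.Forall₂ InZone os' σ) →
      List.Forall₂ InZone os ρ := by
  cases a with
  | @mk Δ L M r Δ' =>
    rw [List.append_assoc] at h
    obtain ⟨os₁, os₄, rfl, h₁, h₄⟩ := forall₂_append_left_iff.1 h
    obtain ⟨os₂, os₃, rfl, h₂, h₃⟩ := forall₂_append_left_iff.1 h₄
    obtain ⟨o, ho, hz⟩ := r.exists_zone h₂
    refine ⟨os₁ ++ o :: os₃, forall₂_append_left_iff.2 ⟨_, _, rfl, h₁, .cons ho h₃⟩, ?_⟩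
    rintro ρ S ⟨P, c, Q, X, rfl, rfl, hP, hc, hQ, hX, hA⟩ hS
    have key : ∀ x ∈ X, List.Forall₂ InZone os₁ P ∧ List.Forall₂ InZone os₂ x ∧
        List.Forall₂ InZone os₃ Q := by
      intro x hx
      have h5 := hS _ ⟨x, hx, rfl⟩
      dsimp only at h5
      rwa [List.append_assoc, forall₂_append_iff, forall₂_append_iff] at h5
      · rw [← h₂.length_eq, ← hX x hx, ResourceQPS.type, List.length_map]
      · rw [← h₁.length_eq, ← hP, ResourceQPS.type, List.length_map]
    -- The untouched zones are known only through the elements of the resulting set, so one such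
    -- element is needed.
    obtain ⟨x, hx⟩ := hA.nonempty
    obtain ⟨h5, -, h6⟩ := key x hx
    exact forall₂_append_left_iff.2 ⟨_, _, rfl, h5,
      .cons (hz c X hc hA fun x hx => (key x hx).2.1) h6⟩

theorem PathAct.exists_zones {Γ Γ' : Sequent} {ξ : Quiver.Path Γ Γ'} {Φ Φ' : Set ResourceQPS}
    (h : PathAct ξ Φ Φ') {os' : List (Option Component)} (ho : List.Forall₂ ZoneOK Γ' os')
    (hΦ : ∀ σ ∈ Φ', List.Forall₂ InZone os' σ) :
    ∃ os, List.Forall₂ ZoneOK Γ os ∧ ∀ ρ ∈ Φ, List.Forall₂ InZone os ρ := by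
  induction ξ generalizing Φ' os' with
  | nil =>
    obtain ⟨-, rfl⟩ := h
    exact ⟨os', ho, hΦ⟩
  | cons ξ a ih =>
    obtain ⟨Φ₁, h₁, F, hF, rfl⟩ := h
    obtain ⟨os₁, ho₁, hz⟩ := a.exists_zones ho
    exact ih h₁ ho₁ fun ρ hρ => hz ρ _ (hF ρ hρ) fun σ hσ => hΦ σ (Set.mem_biUnion hρ hσ)

/-- The empty list of zones at `ε` is carried back to the start of the path. A member of `Φ` shows
that at most one zone arises there, and if there is one, its entry is not `none` because that member
has no daimon. -/
theorem Glueable.exists_isMELL {Φ : Set ResourceQPS} (h : Glueable Φ) (hne : Φ.Nonempty)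
    (hres : ∀ ρ ∈ Φ, ρ.IsResourceProofStructure) :
    ∃ R : QuasiProofStructure, R.IsProofStructure ∧ R.IsMELL ∧ Φ ⊆ taylor R := by
  obtain ⟨Γ, ξ, h⟩ := h
  obtain ⟨os, ho, hz⟩ := h.exists_zones (os' := []) .nil (by rintro σ rfl; exact .nil)
  obtain ⟨ρ₀, hρ₀⟩ := hne
  have hlen : ∀ ρ ∈ Φ, os.length = ρ.length := fun ρ hρ => (hz ρ hρ).length_eq
  have h1 := (hres ρ₀ hρ₀).1
  rw [← hlen ρ₀ hρ₀] at h1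
  rcases os with _ | ⟨o, _ | ⟨_, _⟩⟩
  · refine ⟨[], by simp [QuasiProofStructure.IsProofStructure],
      by simp [QuasiProofStructure.IsMELL], fun ρ hρ => ?_⟩
    have := hz ρ hρ
    rw [List.forall₂_nil_left_iff] at this
    subst this
    exact .nil
  · have key : ∀ ρ ∈ Φ, ∃ c, ρ = [c] ∧ ∃ C ∈ o, c ∈ C.taylor := by
      intro ρ hρ
      obtain ⟨c, u, hc, hu, rfl⟩ := List.forall₂_cons_left_iff.1 (hz ρ hρ)
      rw [List.forall₂_nil_left_iff] at hu
      subst hu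
      exact ⟨c, rfl, hc ((hres _ hρ).2 c (by simp))⟩
    obtain ⟨_, -, C, hC, -⟩ := key ρ₀ hρ₀
    have hM : C.IsMELL := by
      rcases ho with _ | ⟨h, -⟩
      exact (h C hC).1
    refine ⟨[C], by simp [QuasiProofStructure.IsProofStructure],
      by simpa [QuasiProofStructure.IsMELL] using hM, fun ρ hρ => ?_⟩
    obtain ⟨c, rfl, C', hC', hc⟩ := key ρ hρ
    rw [Option.mem_unique hC' hC] at hc
    exact .cons hc .nil
  · simp at h1

end Glue

namespace Glue

/-! ## Zones: from the beginning of a path to its end -/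

/-- One path rewrites to `{ε}` all non-empty subsets of `W` of type `Δ`. -/
def Eliminable (Δ : Sequent) (W : Set ResourceQPS) : Prop :=
  ∃ ξ : Quiver.Path Δ ([] : Sequent), ∀ Φ ⊆ W, Φ.Nonempty →
    (∀ ρ ∈ Φ, ResourceQPS.type ρ = Δ) → PathAct ξ Φ {[]}

/-- The quasi-proof-structures with components in given zones, followed by an element of `W`. -/
def consZones (Zs : List (Set Net)) (W : Set ResourceQPS) : Set ResourceQPS :=
  {ρ | ∃ x σ, ρ = x ++ σ ∧ List.Forall₂ (fun Z c => c ∈ Z) Zs x ∧ σ ∈ W}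

/-- The nets of type `L` of a zone `Z` can be eliminated. -/
def ZoneElim (L : List Formula) (Z : Set Net) : Prop :=
  ∀ Δ W, Eliminable Δ W → Eliminable (L :: Δ) (consZones [Z] W)

theorem Eliminable.mono {Δ : Sequent} {W W' : Set ResourceQPS} (h : Eliminable Δ W)
    (hW : W' ⊆ W) : Eliminable Δ W' :=
  h.imp fun _ hξ Φ hΦ => hξ Φ (hΦ.trans hW)

theorem Eliminable.consZones {M : Sequent} {Zs : List (Set Net)} (h : List.Forall₂ ZoneElim M Zs)
    {Δ : Sequent} {W : Set ResourceQPS} (hW : Eliminable Δ W) :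
    Eliminable (M ++ Δ) (consZones Zs W) := by
  induction h with
  | nil =>
    refine hW.mono ?_
    rintro _ ⟨x, σ, rfl, hx, hσ⟩
    cases hx
    exact hσ
  | @cons L Z M Zs hL _ ih =>
    refine (hL _ _ ih).mono ?_
    rintro _ ⟨x, σ, rfl, hx, hσ⟩
    rcases hx with _ | @⟨_, c, _, x, hc, hx⟩
    exact ⟨[c], x ++ σ, rfl, .cons hc .nil, x, σ, rfl, hx, hσ⟩

theorem PathAct.comp {Γ Γ' Γ'' : Sequent} {p : Quiver.Path Γ Γ'} {q : Quiver.Path Γ' Γ''}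
    {Φ Φ' Φ'' : Set ResourceQPS} (hp : PathAct p Φ Φ') (hq : PathAct q Φ' Φ'') :
    PathAct (p.comp q) Φ Φ'' := by
  induction q generalizing Φ'' with
  | nil =>
    obtain ⟨-, rfl⟩ := hq
    exact hp
  | cons q a ih =>
    obtain ⟨Ψ, h₁, h₂⟩ := hq
    exact ⟨Ψ, ih h₁, h₂⟩

theorem ResourceQPS.type_append (x σ : ResourceQPS) :
    ResourceQPS.type (x ++ σ) = ResourceQPS.type x ++ ResourceQPS.type σ := List.map_append

/-- The rule is put in front of a path that eliminates the resulting zones. That path is fixed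
before the set `Φ` is given, so it suits all sets at once. Non-emptiness has to be carried along,
since the empty set is rewritten to the empty set and never to `{ε}`. -/
theorem ZoneElim.of_rule {L : List Formula} {M : Sequent} (r : Rule L M) {Z : Set Net}
    {Zs : List (Set Net)} (h : List.Forall₂ ZoneElim M Zs)
    (hZ : ∀ c ∈ Z, c.type = L → ∃ X, r.Act c X ∧
      ∀ x ∈ X, ResourceQPS.type x = M ∧ List.Forall₂ (fun Z c => c ∈ Z) Zs x) : ZoneElim L Z := by
  intro Δ W hW
  obtain ⟨ξ, hξ⟩ := hW.consZones h
  let a : Elementary (L :: Δ) (M ++ Δ) := .mk [] r Δ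
  refine ⟨((Quiver.Path.nil (V := Sequent)).cons a).comp ξ, fun Φ hΦ hne htype => ?_⟩
  have key : ∀ ρ ∈ Φ, ∃ S, a.Act ρ S ∧ S.Nonempty ∧
      ∀ σ ∈ S, ResourceQPS.type σ = M ++ Δ ∧ σ ∈ Glue.consZones Zs W := by
    intro ρ hρ
    obtain ⟨x, σ, rfl, hx, hσ⟩ := hΦ hρ
    rcases hx with _ | @⟨_, c, _, x, hc, hx⟩
    cases hx
    have ht := htype _ hρ
    change c.type :: ResourceQPS.type σ = L :: Δ at ht
    obtain ⟨h1, h2⟩ := List.cons.inj ht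
    obtain ⟨X, hX, hX'⟩ := hZ c hc h1
    refine ⟨(fun x => [] ++ x ++ σ) '' X, ⟨[], c, σ, X, rfl, rfl, rfl, h1, h2,
      fun x hx => (hX' x hx).1, hX⟩, hX.nonempty.image _, ?_⟩
    rintro _ ⟨x, hx, rfl⟩
    dsimp only
    rw [List.nil_append]
    refine ⟨?_, x, σ, rfl, (hX' x hx).2, hσ⟩
    rw [ResourceQPS.type_append, (hX' x hx).1, h2]
  classical
  choose F hF hF' hF'' using key
  -- `Elementary.SetAct` takes a total function; its values outside `Φ` are irrelevant.
  refine PathAct.comp (Φ' := ⋃ ρ ∈ Φ, if h : ρ ∈ Φ then F ρ h else ∅)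
    ⟨Φ, ⟨htype, rfl⟩, _, fun ρ hρ => ?_, rfl⟩ (hξ _ ?_ ?_ ?_)
  · rw [dif_pos hρ]
    exact hF ρ hρ
  · intro σ hσ
    obtain ⟨ρ, hρ, hσ⟩ := Set.mem_iUnion₂.1 hσ
    rw [dif_pos hρ] at hσ
    exact (hF'' ρ hρ σ hσ).2
  · obtain ⟨ρ, hρ⟩ := hne
    obtain ⟨σ, hσ⟩ := hF' ρ hρ
    refine ⟨σ, Set.mem_iUnion₂.2 ⟨ρ, hρ, ?_⟩⟩
    rwa [dif_pos hρ]
  · intro σ hσ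
    obtain ⟨ρ, hρ, hσ⟩ := Set.mem_iUnion₂.1 hσ
    rw [dif_pos hρ] at hσ
    exact (hF'' ρ hρ σ hσ).1

theorem ZoneElim.mono {L : List Formula} {Z Z' : Set Net} (h : ZoneElim L Z)
    (hZ : ∀ c ∈ Z', c.type = L → c ∈ Z) : ZoneElim L Z' := by
  intro Δ W hW
  obtain ⟨ξ, hξ⟩ := h Δ W hW
  refine ⟨ξ, fun Φ hΦ hne ht => hξ Φ (fun ρ hρ => ?_) hne ht⟩
  obtain ⟨x, σ, rfl, hx, hσ⟩ := hΦ hρ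
  rcases hx with _ | @⟨_, c, _, x, hc, hx⟩
  cases hx
  have h1 := ht _ hρ
  change c.type :: ResourceQPS.type σ = L :: Δ at h1
  exact ⟨[c], σ, rfl, .cons (hZ c hc (List.cons.inj h1).1) .nil, hσ⟩

/-! ## Daimons -/

/-- The daimon with conclusions of given types. -/
def Net.daimon (L : List Formula) : Net where
  V := Unit
  E := Fin L.length
  finite_V := inferInstance
  finite_E := inferInstance
  label _ := .daimon L.length
  typ e := L[e]
  src _ := ()
  tgt _ := none
  first _ := False
  concl := List.finRange _
  concl_nodup := List.nodup_finRange _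
  mem_concl := by simp
  cell_ok v := by
    refine ⟨by simp, ?_⟩
    have : {e : Fin L.length | () = v} = Set.univ := by ext; simp
    rw [this, Set.ncard_univ, Nat.card_fin]

theorem Net.isDaimon_daimon (L : List Formula) : IsDaimon (Net.daimon L) :=
  ⟨_, (), fun _ => rfl, rfl, fun _ => rfl⟩

theorem Net.type_daimon (L : List Formula) : (Net.daimon L).type = L := by
  change (List.finRange L.length).map (fun e => L[e]) = L
  apply List.ext_getElem <;> simp

/-- The daimon rule needs a last conclusion. A daimon without conclusions first receives two of them
from a `cut`. -/
theorem zoneElim_isDaimon (L : List Formula) : ZoneElim L {c | IsDaimon c} := by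
  have key : ∀ L A, ZoneElim (L ++ [A]) {c | IsDaimon c} := fun L A =>
    .of_rule (.daimon L A) .nil fun c hc _ => ⟨{[]}, ⟨rfl, hc⟩, by rintro x rfl; exact ⟨rfl, .nil⟩⟩
  rcases L.eq_nil_or_concat with rfl | ⟨L, A, rfl⟩
  · refine .of_rule (.cut [] .one) (.cons (key [.one] .bot) .nil) fun c hc _ =>
      ⟨{[Net.daimon [.one, .bot]]}, ⟨_, rfl, .inr ⟨hc, Net.isDaimon_daimon _⟩⟩, ?_⟩
    rintro x rfl
    exact ⟨congrArg (fun L => [L]) (Net.type_daimon _), .cons (Net.isDaimon_daimon _) .nil⟩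
  · rw [List.concat_eq_append]; exact key L A

/-! ## The zone of a component -/

/-- The zone of a component: its Taylor expansion and the daimons. -/
def Component.zone (C : Component) : Set Net := {c | IsDaimon c ∨ (c.NoDaimon ∧ c ∈ C.taylor)}

/-- The zone of a component can be eliminated. -/
def Component.Elim (C : Component) : Prop := ZoneElim C.net.type C.zone

/-- The rule must act on the whole zone at once: on the daimon-free expansions by `hr`, and on the
daimons, which follow by changing their type, by `hd`. -/
theorem Component.Elim.of_unary {C C' : Component} {L L' : List Formula} (h : C'.Elim)
    (hL : C.net.type = L) (hL' : C'.net.type = L') (r : Rule L [L'])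
    (hd : ∀ c c', IsDaimon c → IsDaimon c' → r.Act c {[c']})
    (hr : ∀ c ∈ C.taylor, c.NoDaimon → ∃ c' ∈ C'.taylor, c'.NoDaimon ∧ r.Act c {[c']}) :
    C.Elim := by
  subst hL hL'
  refine .of_rule r (.cons h .nil) fun c hc _ => ?_
  rcases hc with hc | ⟨hc, hc'⟩
  · refine ⟨_, hd c (Net.daimon C'.net.type) hc (Net.isDaimon_daimon _), ?_⟩
    rintro x rfl
    exact ⟨congrArg (fun L => [L]) (Net.type_daimon _), .cons (.inl (Net.isDaimon_daimon _)) .nil⟩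
  · obtain ⟨c', h1, h2, h3⟩ := hr c hc' hc
    refine ⟨_, h3, ?_⟩
    rintro x rfl
    exact ⟨congrArg (fun L => [L]) (Component.type_of_mem_taylor h1), .cons (.inr ⟨h2, h1⟩) .nil⟩

theorem Component.Elim.of_lone {C : Component} {L : List Formula} (hL : C.net.type = L)
    (r : Rule L []) (hd : ∀ c, IsDaimon c → r.Act c {[]}) (hr : ∀ c ∈ C.taylor, r.Act c {[]}) :
    C.Elim := by
  subst hL
  refine .of_rule r .nil fun c hc _ => ⟨{[]}, ?_, by rintro x rfl; exact ⟨rfl, .nil⟩⟩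
  exact hc.elim (hd c) fun h => hr c h.2

/-- The rule `mix` cuts a zone between two formulas, so each part must have a conclusion. -/
theorem Component.Elim.of_mix {C C₁ C₂ : Component} (M : Mix C C₁ C₂) (h₁ : C₁.Elim)
    (h₂ : C₂.Elim) (hne₁ : C₁.net.type ≠ []) (hne₂ : C₂.net.type ≠ []) : C.Elim := by
  obtain ⟨L, A, hL⟩ := C₁.net.type.eq_nil_or_concat.resolve_left hne₁
  rw [List.concat_eq_append] at hL
  obtain ⟨B, L', hL'⟩ := List.exists_cons_of_ne_nil hne₂
  have ht : C.net.type = L ++ A :: B :: L' := by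
    have : C.net.type = C₁.net.type ++ C₂.net.type := by
      rw [Net.type, M.concl, List.map_append, List.map_map, List.map_map]
      congr 1 <;> exact List.map_congr_left fun e _ => Net.Hom.typ_e _ e
    rw [this, hL, hL']; simp
  unfold Component.Elim at h₁ h₂ ⊢
  rw [hL] at h₁
  rw [hL'] at h₂
  rw [ht]
  refine .of_rule (.mix L A B L') (.cons h₁ (.cons h₂ .nil)) fun c hc _ => ?_
  rcases hc with hc | ⟨hc, hc'⟩
  · refine ⟨_, ⟨Net.daimon (L ++ [A]), Net.daimon (B :: L'), rfl, .inr ⟨hc, Net.isDaimon_daimon _,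
      Net.isDaimon_daimon _⟩⟩, ?_⟩
    rintro x rfl
    refine ⟨?_, .cons (.inl (Net.isDaimon_daimon _)) (.cons (.inl (Net.isDaimon_daimon _)) .nil)⟩
    change [(Net.daimon _).type, (Net.daimon _).type] = _
    rw [Net.type_daimon, Net.type_daimon]
  · obtain ⟨c₁, hc₁, c₂, hc₂, hJ⟩ := M.exists_mem_taylor hc'
    have hJ' := hJ
    obtain ⟨f, g, -⟩ := hJ'
    refine ⟨_, ⟨c₁, c₂, rfl, .inl hJ⟩, ?_⟩
    rintro x rfl
    refine ⟨?_, .cons (.inr ⟨f.noDaimon hc, hc₁⟩) (.cons (.inr ⟨g.noDaimon hc, hc₂⟩) .nil)⟩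
    change [c₁.type, c₂.type] = _
    rw [Component.type_of_mem_taylor hc₁, Component.type_of_mem_taylor hc₂, hL, hL']

theorem Component.withConcl_self {C : Component} {l : List C.net.E} (h : l.Perm C.net.concl)
    (hl : l = C.net.concl) : C.withConcl l h = C := by
  subst hl; rfl

theorem Component.Elim.of_swap {C : Component} {l l' : List C.net.E} {x y : C.net.E}
    (hc : C.net.concl = l ++ x :: y :: l')
    (h : (C.withConcl (l ++ y :: x :: l') (hc ▸ perm_swap l x y l')).Elim) : C.Elim := by
  have ht : C.net.type =
      l.map C.net.typ ++ C.net.typ x :: C.net.typ y :: l'.map C.net.typ := by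
    rw [Net.type, hc]; simp
  have ht' : (C.withConcl (l ++ y :: x :: l') (hc ▸ perm_swap l x y l')).net.type =
      l.map C.net.typ ++ C.net.typ y :: C.net.typ x :: l'.map C.net.typ := by
    change (l ++ y :: x :: l').map C.net.typ = _
    simp
  unfold Component.Elim at h ⊢
  rw [ht'] at h
  rw [ht]
  refine .of_rule (.exc _ _ _ _) (.cons h .nil) fun c hcz hct => ?_
  have hct' := hct
  rw [Net.type, List.map_eq_append_iff] at hct'
  obtain ⟨k, us, hck, hk, hus⟩ := hct'
  rcases us with _ | ⟨u, _ | ⟨v, k'⟩⟩ <;> simp at hus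
  refine ⟨{[c.withConcl (k ++ v :: u :: k') (hck ▸ perm_swap k u v k')]}, ⟨_, rfl, ?_⟩, ?_⟩
  · have := c.exchange_withConcl hck
    rwa [← List.length_map (f := c.typ), hk] at this
  · rintro _ rfl
    refine ⟨?_, .cons ?_ .nil⟩
    · change [(k ++ v :: u :: k').map c.typ] = _
      simp [hk, hus]
    · rcases hcz with hd | ⟨hn, t, ⟨z⟩⟩
      · exact .inl hd
      · refine .inr ⟨hn, t, z.withConcl _ _ _ _ ?_⟩
        have hzc := z.concl_comm
        rw [hck, hc, List.map_append] at hzc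
        obtain ⟨h1, h2⟩ := List.append_inj hzc (by
          have := congrArg List.length hk
          simpa using this)
        simp only [List.map_cons, List.cons.injEq] at h2
        simp [h1, h2]

/-- A permutation is a sequence of exchanges of neighbours. The prefix `p` absorbs the common heads,
and writing the lists over `α` with a map `g` keeps them independent of the component, which changes
in the transitive case. -/
theorem Component.Elim.of_perm_append {α : Type} {l l' : List α} (hp : l'.Perm l) :
    ∀ (C : Component) (g : α → C.net.E) (p : List C.net.E) (hc : C.net.concl = p ++ l.map g),
      (C.withConcl (p ++ l'.map g) (hc ▸ (hp.map g).append_left p)).Elim → C.Elim := by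
  induction hp with
  | nil =>
    intro C g p hc h
    rwa [Component.withConcl_self _ hc.symm] at h
  | cons x _ ih =>
    intro C g p hc h
    refine ih C g (p ++ [g x]) (by simpa using hc) ?_
    convert h using 2
    simp
  | swap x y l =>
    intro C g p hc h
    exact .of_swap (l := p) (l' := l.map g) (x := g x) (y := g y) hc h
  | trans _ _ ih₁ ih₂ =>
    rename_i h₁ h₂
    intro C g p hc h
    refine ih₂ C g p hc ?_
    exact ih₁ (C.withConcl _ _) g p rfl h

theorem Component.Elim.of_perm {C : Component} {l : List C.net.E} (hp : l.Perm C.net.concl)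
    (h : (C.withConcl l hp).Elim) : C.Elim := by
  refine of_perm_append hp C id [] (by simp) ?_
  convert h using 2
  simp

end Glue

namespace Glue

/-! ## Eliminating the zone of a MELL component -/

theorem exists_map_whynot {l : List Formula} (h : ∀ A ∈ l, ∃ B, A = .whynot B) :
    ∃ L : List Formula, l = L.map .whynot := by
  induction l with
  | nil => exact ⟨[], rfl⟩
  | cons A l ih =>
    obtain ⟨B, rfl⟩ := h A (by simp)
    obtain ⟨L, rfl⟩ := ih fun A hA => h A (by simp [hA])
    exact ⟨B :: L, rfl⟩

theorem exists_perm_last {α : Type} {l : List α} {e : α} (h : e ∈ l) :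
    ∃ l', (l' ++ [e]).Perm l := by
  obtain ⟨s, t, rfl⟩ := List.append_of_mem h
  refine ⟨s ++ t, ?_⟩
  rw [List.append_assoc]
  exact List.Perm.append_left s (List.perm_append_singleton e t)

theorem Net.typ_of_label_whynot {c : Net} {o : c.E} (h : c.label (c.src o) = .whynot) :
    ∃ A, c.typ o = .whynot A ∧ ∀ e, c.tgt e = some (c.src o) → c.typ e = A := by
  have hok := c.cell_ok (c.src o)
  rw [h] at hok
  obtain ⟨o', A, ho, hA, he⟩ := hok
  have : o ∈ ({o'} : Set c.E) := ho ▸ rfl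
  obtain rfl := this
  exact ⟨A, hA, he⟩

theorem Net.typ_of_label_bang {c : Net} {o : c.E} (h : c.label (c.src o) = .bang) :
    ∃ A, c.typ o = .bang A ∧ ∀ e, c.tgt e = some (c.src o) → c.typ e = A := by
  have hok := c.cell_ok (c.src o)
  rw [h] at hok
  obtain ⟨o', A, ho, hA, he⟩ := hok
  have : o ∈ ({o'} : Set c.E) := ho ▸ rfl
  obtain rfl := this
  exact ⟨A, hA, he⟩

theorem Net.exists_out {c : Net} {v : c.V} (h : c.label v ≠ .cut)
    (h' : ∀ p, c.label v ≠ .daimon p) :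
    ∃ e, c.src e = v := by
  have key : ∃ e, e ∈ {e | c.src e = v} := by
    have hok := c.cell_ok v
    generalize {e | c.src e = v} = outs at hok
    cases hl : c.label v <;> rw [hl] at hok
    case ax => obtain ⟨-, a, b, X, rfl, -⟩ := hok; exact ⟨a, by simp⟩
    case cut => exact absurd hl h
    case one => obtain ⟨-, o, rfl, -⟩ := hok; exact ⟨o, rfl⟩
    case bot => obtain ⟨-, o, rfl, -⟩ := hok; exact ⟨o, rfl⟩
    case tensor => obtain ⟨_, _, o, -, -, -, rfl, -⟩ := hok; exact ⟨o, rfl⟩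
    case par => obtain ⟨_, _, o, -, -, -, rfl, -⟩ := hok; exact ⟨o, rfl⟩
    case whynot => obtain ⟨o, _, rfl, -⟩ := hok; exact ⟨o, rfl⟩
    case bang => obtain ⟨o, _, rfl, -⟩ := hok; exact ⟨o, rfl⟩
    case daimon p => exact absurd hl (h' p)
  exact key

theorem Component.box_src_of_label (C : Component) {e : C.net.E} {v : C.net.V}
    (he : C.net.tgt e = some v) (hb : C.net.label v ≠ .bang) (hw : C.net.label v ≠ .whynot)
    (hv : C.box v = C.tree.root) : C.box (C.net.src e) = C.tree.root := by
  by_contra h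
  rcases C.box_border e v he (by rwa [hv]) with h | h
  exacts [hb h, hw h]

/-- The zones of the smaller MELL components can be eliminated. -/
def Component.ElimBelow (C : Component) : Prop :=
  ∀ C' : Component, C'.IsMELL → C'.net.size < C.net.size → Nonempty C'.net.V → C'.Elim

namespace Component.IsMELL

theorem elim_of_cut {C : Component} (hM : C.IsMELL) (ih : C.ElimBelow) {w : C.net.V}
    (hl : C.net.label w = .cut) (hw : C.box w = C.tree.root) : C.Elim := by
  have hok := C.net.cell_ok w
  rw [hl] at hok
  obtain ⟨hos, a, b, has, hb⟩ := hok
  have has' : ∀ e, e ∈ [a, b] ↔ C.net.tgt e = some w := fun e => by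
    have : C.net.tgt e = some w ↔ e = a ∨ e = b := Set.ext_iff.1 has e
    simp [this]
  have hab : a ≠ b := by
    rintro rfl
    exact Formula.dual_ne _ hb.symm
  obtain ⟨C', hM', ht, hs, hne, hlift⟩ := hM.exists_removeCell hl hw (by simp) (l := C.net.concl)
    (os := []) (as := [a, b]) (by simp) (fun e => by
      have : C.net.src e = w ↔ e ∈ (∅ : Set C.net.E) := Set.ext_iff.1 hos e
      simp [this]) (by simpa using hab) has' (fun e he =>
        C.box_src_of_label ((has' e).1 he) (by simp [hl]) (by simp [hl]) hw)
      (by rintro (h | h) <;> cases h)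
  refine .of_unary (ih C' hM' hs (hne (by simp))) rfl (L' := C.net.type ++ [C.net.typ a, _]) ?_
    (.cut _ _) (fun c c' h h' => ⟨c', rfl, .inr ⟨h, h'⟩⟩) fun c hc hn => ?_
  · rw [ht, List.map_append]
    simp [hb, Net.type]
  · obtain ⟨c', hc', D, h1, h2⟩ := hlift c hc
    exact ⟨c', hc', D.f.noDaimon hn, c', rfl, .inl (D.removeCut h1 h2)⟩

theorem exists_removeBinary {C : Component} (hM : C.IsMELL) {t : CellType}
    (ht : t.IsBinary) {l : List C.net.E} {o : C.net.E} (hc : C.net.concl = l ++ [o])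
    (ho : C.net.label (C.net.src o) = t) :
    ∃ (C' : Component) (A B : Formula), C'.IsMELL ∧ C'.net.type = l.map C.net.typ ++ [A, B] ∧
      C'.net.size < C.net.size ∧ Nonempty C'.net.V ∧ (t = .tensor → C.net.typ o = .tensor A B) ∧
      (t = .par → C.net.typ o = .par A B) ∧
      ∀ c ∈ C.taylor, c.NoDaimon → ∃ c' ∈ C'.taylor, c'.NoDaimon ∧ RemoveBinary t c c' := by
  have hok := C.net.cell_ok (C.net.src o)
  have key : ∃ a b, {e | C.net.tgt e = some (C.net.src o)} = {a, b} ∧ C.net.first a ∧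
      ¬ C.net.first b ∧ (t = .tensor → C.net.typ o = .tensor (C.net.typ a) (C.net.typ b)) ∧
      (t = .par → C.net.typ o = .par (C.net.typ a) (C.net.typ b)) := by
    rcases ht with rfl | rfl
    all_goals
      rw [ho] at hok
      obtain ⟨a, b, o', h1, h2, h3, h4, h5⟩ := hok
      have : o ∈ ({o'} : Set C.net.E) := h4 ▸ rfl
      obtain rfl := this
      exact ⟨a, b, h1, h2, h3, by simp [h5], by simp [h5]⟩
  obtain ⟨a, b, has, h1, h2, h3, h4⟩ := key
  have has' : ∀ e, e ∈ [a, b] ↔ C.net.tgt e = some (C.net.src o) := fun e => by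
    have : C.net.tgt e = some (C.net.src o) ↔ e = a ∨ e = b := Set.ext_iff.1 has e
    simp [this]
  have hab : a ≠ b := by
    rintro rfl
    exact h2 h1
  have htb : t ≠ .bang ∧ t ≠ .whynot := by rcases ht with rfl | rfl <;> simp
  have hr : C.box (C.net.src o) = C.tree.root := C.box_of_mem (by rw [hc]; simp)
  obtain ⟨C', hM', htype, hs, hne, hlift⟩ := hM.exists_removeCell ho hr htb.1 hc (as := [a, b])
    (fun e => by
      rw [List.mem_singleton]
      exact ⟨fun h => h ▸ rfl, Net.out_unique_binary (by rwa [ho])⟩)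
    (by simpa using hab) has' (fun e he =>
      C.box_src_of_label ((has' e).1 he) (by rw [ho]; exact htb.1) (by rw [ho]; exact htb.2) hr)
    (fun _ => ⟨a, b, rfl, h1, h2⟩)
  refine ⟨C', _, _, hM', by rw [htype]; simp, hs, hne (by simp), h3, h4, fun c hct hn => ?_⟩
  obtain ⟨c', hc', D, -, h6⟩ := hlift c hct
  exact ⟨c', hc', D.f.noDaimon hn, D.removeBinary ht h6⟩

theorem elim_of_binary {C : Component} (hM : C.IsMELL) (ih : C.ElimBelow) {o : C.net.E}
    (ho : o ∈ C.net.concl) (hl : (C.net.label (C.net.src o)).IsBinary) : C.Elim := by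
  obtain ⟨l, hp⟩ := exists_perm_last ho
  refine .of_perm hp ?_
  obtain ⟨C', A, B, hM', ht, hs, hne, h1, h2, hlift⟩ := (hM.withConcl _ hp).exists_removeBinary
    (C := C.withConcl _ hp) hl (l := l) (o := o) rfl rfl
  have hE := ih C' hM' hs hne
  have htype : (C.withConcl _ hp).net.type = l.map C.net.typ ++ [C.net.typ o] := by
    change (l ++ [o]).map C.net.typ = _
    simp
  rcases hl with hl | hl
  · refine hE.of_unary (htype.trans (by rw [show C.net.typ o = _ from h1 hl]; rfl)) ht (.tensor _ A B)
      (fun c c' h h' => ⟨c', rfl, .inr ⟨h, h'⟩⟩) fun c hc hn => ?_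
    obtain ⟨c', hc', hn', hR⟩ := hlift c hc hn
    rw [show C.net.label (C.net.src o) = _ from hl] at hR
    exact ⟨c', hc', hn', c', rfl, .inl hR⟩
  · refine hE.of_unary (htype.trans (by rw [show C.net.typ o = _ from h2 hl]; rfl)) ht (.par _ A B)
      (fun c c' h h' => ⟨c', rfl, .inr ⟨h, h'⟩⟩) fun c hc hn => ?_
    obtain ⟨c', hc', hn', hR⟩ := hlift c hc hn
    rw [show C.net.label (C.net.src o) = _ from hl] at hR
    exact ⟨c', hc', hn', c', rfl, .inl hR⟩

theorem elim_of_contraction {C : Component} (hM : C.IsMELL) (ih : C.ElimBelow) {o e₁ e₂ : C.net.E}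
    (ho : o ∈ C.net.concl) (hl : C.net.label (C.net.src o) = .whynot)
    (h₁ : C.net.tgt e₁ = some (C.net.src o)) (h₂ : C.net.tgt e₂ = some (C.net.src o))
    (hne : e₁ ≠ e₂) : C.Elim := by
  obtain ⟨l, hp⟩ := exists_perm_last ho
  refine .of_perm hp ?_
  obtain ⟨A, hA, -⟩ := Net.typ_of_label_whynot hl
  obtain ⟨C', hM', ht, hs, hne, hlift⟩ := (hM.withConcl _ hp).exists_split
    (C := C.withConcl _ hp) (l := l) (o := o) rfl hl h₁ h₂ hne
  refine (ih C' hM' hs hne).of_unary (L := l.map C.net.typ ++ [Formula.whynot A])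
    (L' := l.map C.net.typ ++ [Formula.whynot A, Formula.whynot A]) ?_ (ht.trans ?_)
    (.contr (l.map C.net.typ) A) (fun c c' h h' => ⟨c', rfl, .inr ⟨h, h'⟩⟩) fun c hc hn => ?_
  · change (l ++ [o]).map C.net.typ = _
    simp [hA]
  · change (l ++ [o, o]).map C.net.typ = _
    simp [hA]
  · obtain ⟨c', hc', hS⟩ := hlift c hc
    have hS' := hS
    obtain ⟨f, -⟩ := hS'
    exact ⟨c', hc', f.noDaimon hn, c', rfl, .inl hS⟩

theorem elim_of_dereliction {C : Component} (hM : C.IsMELL) (ih : C.ElimBelow) {o e₁ : C.net.E}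
    (ho : o ∈ C.net.concl) (hl : C.net.label (C.net.src o) = .whynot)
    (h₁ : C.net.tgt e₁ = some (C.net.src o))
    (hu : ∀ e, C.net.tgt e = some (C.net.src o) → e = e₁)
    (hr : C.box (C.net.src e₁) = C.tree.root) : C.Elim := by
  obtain ⟨l, hp⟩ := exists_perm_last ho
  refine .of_perm hp ?_
  obtain ⟨A, hA, hA'⟩ := Net.typ_of_label_whynot hl
  have hos : ∀ e, e ∈ [o] ↔ C.net.src e = C.net.src o := fun e => by
    rw [List.mem_singleton]
    exact ⟨fun h => h ▸ rfl, Net.out_unique (.inl hl)⟩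
  have has : ∀ e, e ∈ [e₁] ↔ C.net.tgt e = some (C.net.src o) := fun e => by
    rw [List.mem_singleton]
    exact ⟨fun h => h ▸ h₁, hu e⟩
  have hasr : ∀ e ∈ [e₁], C.box (C.net.src e) = C.tree.root := fun e he => by
    rw [List.mem_singleton] at he
    exact he ▸ hr
  obtain ⟨C', hM', ht, hs, hne, hlift⟩ := (hM.withConcl _ hp).exists_removeCell
    (C := C.withConcl _ hp) (w := C.net.src o) hl (C.box_of_mem ho) (by simp) (l := l) (os := [o])
    (as := [e₁]) rfl hos (List.nodup_singleton e₁) has hasr (by rintro (h | h) <;> cases h)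
  refine (ih C' hM' hs (hne (by simp))).of_unary (L := l.map C.net.typ ++ [Formula.whynot A])
    (L' := l.map C.net.typ ++ [A]) ?_ (ht.trans ?_)
    (.der (l.map C.net.typ) A) (fun c c' h h' => ⟨c', rfl, .inr ⟨h, h'⟩⟩)
    fun c hc hn => ?_
  · change (l ++ [o]).map C.net.typ = _
    simp [hA]
  · change (l ++ [e₁]).map C.net.typ = _
    simp [hA' e₁ h₁]
  · obtain ⟨c', hc', D, h1, h2⟩ := hlift c hc
    exact ⟨c', hc', D.f.noDaimon hn, c', rfl, .inl (D.removeDereliction h1 h2)⟩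

/-- After a permutation the conclusions in `S` come first and `mix` applies; `e₁` and `e₂` are the
conclusions that it needs on the two sides. -/
theorem elim_of_split {C : Component} (hM : C.IsMELL) (ih : C.ElimBelow) (S : C.net.V → Prop)
    (N₁ N₂ : C.tree.Node → Prop)
    (hS : ∀ e v, C.net.tgt e = some v → (S (C.net.src e) ↔ S v))
    (hr₁ : N₁ C.tree.root) (hr₂ : N₂ C.tree.root)
    (hN₁ : ∀ a b, C.tree.parent a = some b → N₁ a → N₁ b)
    (hN₂ : ∀ a b, C.tree.parent a = some b → N₂ a → N₂ b)
    (hN : ∀ b, N₁ b ∨ N₂ b) (hN' : ∀ b, N₁ b → N₂ b → b = C.tree.root)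
    (hb₁ : ∀ v, S v → N₁ (C.box v)) (hb₂ : ∀ v, ¬ S v → N₂ (C.box v)) {e₁ e₂ : C.net.E}
    (he₁ : e₁ ∈ C.net.concl) (he₂ : e₂ ∈ C.net.concl) (hs₁ : S (C.net.src e₁))
    (hs₂ : ¬ S (C.net.src e₂)) : C.Elim := by
  classical
  obtain ⟨l₁, l₂, hp, hm₁, hm₂⟩ : ∃ l₁ l₂ : List C.net.E, (l₁ ++ l₂).Perm C.net.concl ∧
      (∀ e, e ∈ l₁ ↔ e ∈ C.net.concl ∧ S (C.net.src e)) ∧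
      ∀ e, e ∈ l₂ ↔ e ∈ C.net.concl ∧ ¬ S (C.net.src e) :=
    ⟨_, _, List.filter_append_perm (fun e => decide (S (C.net.src e))) C.net.concl,
      fun e => by simp, fun e => by simp⟩
  refine .of_perm hp ?_
  obtain ⟨C₁, C₂, ⟨M⟩, ht₁, ht₂, hsz₁, hsz₂, hne₁, hne₂⟩ :=
    (C.withConcl _ hp).exists_mix_of_split S N₁ N₂ hS hr₁ hr₂ hN₁ hN₂ hN hN' hb₁ hb₂
      (l₁ := l₁) (l₂ := l₂) rfl (fun e he => ((hm₁ e).1 he).2) (fun e he => ((hm₂ e).1 he).2)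
      ⟨_, hs₁⟩ ⟨_, hs₂⟩
  refine .of_mix M (ih C₁ (M.P₁.isMELL (hM.withConcl _ hp)) hsz₁ hne₁)
    (ih C₂ (M.P₂.isMELL (hM.withConcl _ hp)) hsz₂ hne₂) ?_ ?_
  · exact ht₁ ▸ fun h => List.ne_nil_of_mem ((hm₁ e₁).2 ⟨he₁, hs₁⟩) (List.map_eq_nil_iff.1 h)
  · exact ht₂ ▸ fun h => List.ne_nil_of_mem ((hm₂ e₂).2 ⟨he₂, hs₂⟩) (List.map_eq_nil_iff.1 h)

/-- One `Box` step treats all members: a non-empty box is replaced by its copies, which are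
expansions of the content, while an empty box and a daimon both give a daimon. This is why the zone
of the content has to contain the daimons. -/
theorem elim_of_box {C : Component} (hM : C.IsMELL) (ih : C.ElimBelow) {O e₀ : C.net.E}
    (hO : O ∈ C.net.concl) (hW : C.net.label (C.net.src O) = .bang)
    (he₀ : C.net.tgt e₀ = some (C.net.src O))
    (hl : ∀ e ∈ C.net.concl, e ≠ O → C.net.label (C.net.src e) = .whynot)
    (hroot : ∀ v, C.box v = C.tree.root → ∃ e ∈ C.net.concl, C.net.src e = v)
    (hb : ∀ x, x ≠ C.tree.root → C.tree.Below x (C.box (C.net.src e₀))) : C.Elim := by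
  obtain ⟨l, hp⟩ := exists_perm_last hO
  have hnd := hp.nodup_iff.2 C.net.concl_nodup
  have hlO : ∀ e ∈ l, e ∈ C.net.concl ∧ e ≠ O := fun e he =>
    ⟨hp.mem_iff.1 (by simp [he]), by
      rintro rfl
      exact (List.nodup_append'.1 hnd).2.2 he (by simp)⟩
  have hlO' : ∀ e ∈ C.net.concl, e ≠ O → e ∈ l := fun e he heO => by
    simpa [heO] using hp.mem_iff.2 he
  refine .of_perm hp ?_
  obtain ⟨C', ht, hs, hne, hC', hlift⟩ := (hM.withConcl _ hp).exists_unbox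
    (C := C.withConcl _ hp) (l := l) (O := O) (e₀ := e₀) rfl hW he₀
    (fun e he => hl e (hlO e he).1 (hlO e he).2) (fun v hv => by
      obtain ⟨e, he, rfl⟩ := hroot v hv
      by_cases heO : e = O
      · exact .inl (congrArg _ heO)
      · exact .inr ⟨e, hlO' e he heO, rfl⟩) hb
  obtain ⟨A, hA, hA'⟩ := Net.typ_of_label_bang hW
  obtain ⟨L, hL⟩ := exists_map_whynot (l := l.map C.net.typ) (fun B hB => by
    obtain ⟨e, he, rfl⟩ := List.mem_map.1 hB
    obtain ⟨B, hB, -⟩ := Net.typ_of_label_whynot (hl e (hlO e he).1 (hlO e he).2)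
    exact ⟨B, hB⟩)
  have htype : (C.withConcl _ hp).net.type = L.map .whynot ++ [.bang A] := by
    change (l ++ [O]).map C.net.typ = _
    rw [List.map_append, hL, List.map_singleton, hA]
  have htype' : C'.net.type = L.map .whynot ++ [A] := by
    rw [ht]
    change l.map C.net.typ ++ [C.net.typ e₀] = _
    rw [hL, hA' e₀ he₀]
  have hE : ZoneElim (L.map .whynot ++ [A]) C'.zone := by
    rw [← htype']
    rcases hC' with hC' | ⟨v, p, hv, hvr⟩
    · exact ih C' hC' hs hne
    -- A daimon over the root occurs in every expansion of the content, so only daimons are left in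
    -- its zone.
    · refine (zoneElim_isDaimon _).mono fun c hc _ => ?_
      rcases hc with hc | ⟨hc, t, ⟨x⟩⟩
      · exact hc
      · exact absurd hvr (x.noDaimon_root hc hv)
  unfold Component.Elim
  rw [htype]
  have hdai : ∃ c, IsDaimon c ∧ ∀ x ∈ ({[c]} : Set ResourceQPS),
      ResourceQPS.type x = [L.map .whynot ++ [A]] ∧
        List.Forall₂ (fun Z c => c ∈ Z) [C'.zone] x := by
    refine ⟨_, Net.isDaimon_daimon (L.map .whynot ++ [A]), ?_⟩
    rintro x rfl
    exact ⟨congrArg (fun L => [L]) (Net.type_daimon _), .cons (.inl (Net.isDaimon_daimon _)) .nil⟩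
  refine .of_rule (.box L A) (.cons hE .nil) fun c hc _ => ?_
  obtain ⟨d, hd, hd'⟩ := hdai
  rcases hc with hc | ⟨hn, hc⟩
  · exact ⟨_, .inl ⟨d, rfl, hd, .inl hc⟩, hd'⟩
  · rcases hlift c hc with hE | ⟨n, hn0, c', hm, hc'⟩
    · exact ⟨_, .inl ⟨d, rfl, hd, .inr hE⟩, hd'⟩
    · refine ⟨_, .inr ⟨n, c', hn0, hm, rfl⟩, ?_⟩
      obtain ⟨f, -⟩ := hm
      rintro _ ⟨j, rfl⟩
      refine ⟨congrArg (fun L => [L]) ((Component.type_of_mem_taylor (hc' j)).trans htype'),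
        .cons (.inr ⟨(f j).noDaimon hn, hc' j⟩) .nil⟩

end Component.IsMELL
end Glue

/-! ### Components to which no local rule applies, and the induction on the size -/

namespace Glue

theorem Component.isLone_of_mem_taylor {C : Component} {v : C.net.V} (hv : ∀ w, w = v)
    (hr : C.box v = C.tree.root) (ht : ∀ e, C.net.tgt e = none) {c : Net} (hc : c ∈ C.taylor) :
    IsLone c (C.net.label v) := by
  obtain ⟨t, ⟨x⟩⟩ := hc
  obtain ⟨a, rfl⟩ := x.exists_root_vertex hr
  exact ⟨a, fun y => x.vertex_ext_root (hv _) hr, x.label_comm a, fun e => x.tgt_none.2 (ht _)⟩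

namespace Component.IsMELL

/-- If no cell over the root can be removed by another rule, then the cells over the root are
joined to no edge but their outputs and the edges that enter from a box. -/
theorem tgt_eq_none {C : Component} (hM : C.IsMELL)
    (hcut : ∀ w, C.box w = C.tree.root → C.net.label w ≠ .cut)
    (hbin : ∀ o ∈ C.net.concl, ¬ (C.net.label (C.net.src o)).IsBinary)
    (hder : ∀ o ∈ C.net.concl, C.net.label (C.net.src o) = .whynot →
      ∀ e, C.net.tgt e = some (C.net.src o) → C.box (C.net.src e) ≠ C.tree.root)
    {e : C.net.E} (he : C.box (C.net.src e) = C.tree.root) : C.net.tgt e = none := by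
  by_contra hne
  have := C.net.finite_E
  -- An offending edge with the largest type is chosen. Its target has an output of larger type,
  -- which must be a conclusion by maximality, and then the target is a cell excluded by `hbin` or
  -- `hder`.
  obtain ⟨e, ⟨he, hne⟩, hmax⟩ := Set.exists_max_image
    {e | C.box (C.net.src e) = C.tree.root ∧ C.net.tgt e ≠ none} (fun e => sizeOf (C.net.typ e))
    (Set.toFinite _) ⟨e, he, hne⟩
  obtain ⟨v, hv⟩ := Option.ne_none_iff_exists'.1 hne
  have hvr : C.box v = C.tree.root := BoxTree.Below.eq_root (he ▸ C.box_edge e v hv)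
  have key : ∃ o, C.net.src o = v ∧ sizeOf (C.net.typ e) < sizeOf (C.net.typ o) ∧
      ((C.net.label v).IsBinary ∨ C.net.label v = .whynot) := by
    have hok := C.net.cell_ok v
    have hin : e ∈ {e | C.net.tgt e = some v} := hv
    have hout : ∀ o, {e | C.net.src e = v} = {o} → C.net.src o = v := fun o h =>
      (Set.ext_iff.1 h o).2 rfl
    generalize {e | C.net.tgt e = some v} = ins at hok hin
    cases hl : C.net.label v <;> rw [hl] at hok
    case cut => exact absurd hl (hcut v hvr)
    case bang =>
      have := hM.1.2.1 e v hv hl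
      rw [he, BoxTree.parent_root] at this
      cases this
    case whynot =>
      obtain ⟨o, A, ho, hA, h⟩ := hok
      exact ⟨o, hout o ho, by rw [hA, h e hin]; simp, .inr rfl⟩
    case tensor =>
      obtain ⟨a, b, o, rfl, -, -, ho, hA⟩ := hok
      refine ⟨o, hout o ho, ?_, .inl (.inl rfl)⟩
      rw [hA]
      rcases hin with rfl | rfl <;> simp +arith
    case par =>
      obtain ⟨a, b, o, rfl, -, -, ho, hA⟩ := hok
      refine ⟨o, hout o ho, ?_, .inl (.inr rfl)⟩
      rw [hA]
      rcases hin with rfl | rfl <;> simp +arith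
    all_goals
      rw [hok.1] at hin
      cases hin
  obtain ⟨o, rfl, hlt, hlab⟩ := key
  by_cases ho : C.net.tgt o = none
  · have hoc := (C.net.mem_concl o).2 ho
    rcases hlab with h | h
    · exact hbin o hoc h
    · exact hder o hoc h e hv he
  · exact absurd (hmax o ⟨hvr, ho⟩) (not_le.2 hlt)

/-- Let `S` consist of the cells inside the box of `O` and of the root cells with an input from it.
Every root cell has at most one input, so no edge joins `S` to its complement. If `S` is everything,
the component is one box with its border and can be opened; otherwise `S` and its complement are
separated. -/
theorem elim_of_root_bang {C : Component} (hM : C.IsMELL) (ih : C.ElimBelow)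
    (hout : ∀ v, C.box v = C.tree.root → ∃ e ∈ C.net.concl, C.net.src e = v)
    (htgt : ∀ e, C.box (C.net.src e) = C.tree.root → C.net.tgt e = none)
    (hcon : ∀ o ∈ C.net.concl, C.net.label (C.net.src o) = .whynot → ∀ e e',
      C.net.tgt e = some (C.net.src o) → C.net.tgt e' = some (C.net.src o) → e = e')
    {O : C.net.E} (hO : O ∈ C.net.concl) (hW : C.net.label (C.net.src O) = .bang) : C.Elim := by
  obtain ⟨e₀, he₀, -⟩ := hM.1.1 _ hW
  have hb : C.tree.parent (C.box (C.net.src e₀)) = some C.tree.root := by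
    rw [hM.1.2.1 _ _ he₀ hW, C.box_of_mem hO]
  have hinj := C.box_inj (e' := e₀) (v' := C.net.src O)
  rw [C.box_of_mem hO] at hinj
  generalize hbe : C.box (C.net.src e₀) = b at hb hinj
  have hbr := BoxTree.ne_root_of_parent hb
  have hne : ∀ e v, C.net.tgt e = some v → C.box (C.net.src e) ≠ C.tree.root := fun e v he h => by
    rw [htgt e h] at he
    cases he
  have huniq : ∀ v e e', C.box v = C.tree.root → C.net.tgt e = some v → C.net.tgt e' = some v →
      e = e' := fun v e e' hv he he' => by
    rcases C.box_border e v he (by rw [hv]; exact hne e v he) with h | h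
    · exact (hM.1.1 v h).unique he he'
    · obtain ⟨o, ho, rfl⟩ := hout v hv
      exact hcon o ho h e e' he he'
  have hroot_b : ¬ C.tree.Below C.tree.root b := fun h => hbr h.eq_root
  let S : C.net.V → Prop := fun v => (C.box v ≠ C.tree.root ∧ C.tree.Below (C.box v) b) ∨
    (C.box v = C.tree.root ∧ ∃ e, C.net.tgt e = some v ∧ C.tree.Below (C.box (C.net.src e)) b)
  have hS₁ : ∀ v, C.box v ≠ C.tree.root → (S v ↔ C.tree.Below (C.box v) b) := fun v hv => by
    simp [S, hv]
  have hS₂ : ∀ v, C.box v = C.tree.root →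
      (S v ↔ ∃ e, C.net.tgt e = some v ∧ C.tree.Below (C.box (C.net.src e)) b) := fun v hv => by
    simp [S, hv]
  have hS : ∀ e v, C.net.tgt e = some v → (S (C.net.src e) ↔ S v) := fun e v he => by
    rw [hS₁ _ (hne e v he)]
    by_cases hv : C.box v = C.tree.root
    · rw [hS₂ _ hv]
      refine ⟨fun h => ⟨e, he, h⟩, ?_⟩
      rintro ⟨e', he', h⟩
      exact huniq v e e' hv he he' ▸ h
    · rw [hS₁ _ hv]
      refine ⟨fun h => ?_, (C.box_edge e v he).trans⟩
      -- Both `b` and the box of `v` are below the source, hence comparable. If the box of `v` were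
      -- strictly below `b` it would be the root, since `b` is a child of the root.
      rcases h.total (C.box_edge e v he) with h' | h'
      · rcases h'.cases with h' | ⟨p, hp, h'⟩
        · rw [h']; exact .refl _
        · obtain rfl : C.tree.root = p := by simpa [hb] using hp
          exact absurd h'.eq_root hv
      · exact h'
  by_cases hall : ∀ v, S v
  · refine elim_of_box hM ih hO hW he₀ (fun e he heO => ?_) hout fun x hx => ?_
    · have her := C.box_of_mem he
      obtain ⟨e', he', hbel⟩ := (hS₂ _ her).1 (hall (C.net.src e))
      rcases C.box_border e' _ he' (by rw [her]; exact hne _ _ he') with h | h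
      · have hp := hM.1.2.1 _ _ he' h
        have heq : C.box (C.net.src e') = b := by
          rcases hbel.cases with h' | ⟨p, hp', h'⟩
          · exact h'
          · rw [hp, her] at hp'
            obtain rfl := Option.some.inj hp'
            exact absurd h' hroot_b
        have := hinj e' (C.net.src e) he' he₀ h hW hp hb heq
        subst this
        rw [he'] at he₀
        exact absurd (Net.out_unique (.inr hW) (Option.some.inj he₀)) heO
      · exact h
    · obtain ⟨e, v, -, -, rfl⟩ := hM.1.2.2 x hx
      rw [hbe]
      exact (hS₁ _ hx).1 (hall _)
  · obtain ⟨v, hv⟩ := not_forall.1 hall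
    -- A cell outside `S` is either the source of a conclusion or inside some outermost box; the
    -- output of the `!`-cell of that box is then the required conclusion.
    obtain ⟨e₂, he₂, hs₂⟩ : ∃ e ∈ C.net.concl, ¬ S (C.net.src e) := by
      by_cases hvr : C.box v = C.tree.root
      · obtain ⟨e, he, rfl⟩ := hout v hvr
        exact ⟨e, he, hv⟩
      · rw [hS₁ _ hvr] at hv
        obtain ⟨y, hy, hyp⟩ := BoxTree.exists_child hvr
        obtain ⟨e, W, heW, hlW, rfl⟩ := hM.1.2.2 y (BoxTree.ne_root_of_parent hyp)
        have hp := hM.1.2.1 _ _ heW hlW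
        rw [hyp] at hp
        obtain ⟨o, ho, rfl⟩ := hout W (Option.some.inj hp).symm
        refine ⟨o, ho, fun h => hv ?_⟩
        rw [← hS _ _ heW, hS₁ _ (BoxTree.ne_root_of_parent hyp)] at h
        exact hy.trans h
    refine elim_of_split hM ih S (fun x => x = C.tree.root ∨ C.tree.Below x b)
      (fun x => ¬ C.tree.Below x b) hS (.inl rfl) hroot_b ?_ (fun x y h hx hy => hx (.head h hy))
      (fun x => (em _).imp_left .inr) (fun x h h' => h.resolve_right h') ?_ ?_ hO he₂ ?_ hs₂
    · rintro x y h (rfl | hx)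
      · rw [BoxTree.parent_root] at h
        cases h
      · rcases hx.cases with rfl | ⟨p, hp, h'⟩
        · rw [hb] at h
          exact .inl (Option.some.inj h).symm
        · rw [h] at hp
          exact .inr (Option.some.inj hp ▸ h')
    · rintro v (⟨-, h⟩ | ⟨h, -⟩)
      exacts [.inr h, .inl h]
    · intro v hv h
      refine hv ((hS₁ v fun hr => ?_).2 h)
      rw [hr] at h
      exact hroot_b h
    · exact (hS₂ _ (C.box_of_mem hO)).2 ⟨e₀, he₀, hbe ▸ .refl _⟩

/-- Only axioms, units and nullary `?`-cells are left, and each has a rule that deletes it. The two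
outputs of an axiom are put in the order of the rule by a permutation. -/
theorem elim_of_forall_eq {C : Component} {v : C.net.V} (hv : ∀ w, w = v)
    (hr : C.box v = C.tree.root) (ht : ∀ e, C.net.tgt e = none)
    (hbin : ¬ (C.net.label v).IsBinary) (hcut : C.net.label v ≠ .cut)
    (hbang : C.net.label v ≠ .bang) (hdai : ∀ p, C.net.label v ≠ .daimon p) : C.Elim := by
  have hout : ∀ e, C.net.src e = v := fun e => hv _
  have hmem : ∀ e, e ∈ C.net.concl := fun e => (C.net.mem_concl e).2 (ht e)
  have hperm : ∀ l : List C.net.E, l.Nodup → (∀ e, C.net.src e = v → e ∈ l) →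
      l.Perm C.net.concl := fun l hl h =>
    (List.perm_ext_iff_of_nodup hl C.net.concl_nodup).2 fun e => by simp [hmem, h e (hout e)]
  have hone : ∀ o, {e | C.net.src e = v} = {o} → [o].Perm C.net.concl := fun o h =>
    hperm _ (by simp) fun e he => by
      have : e ∈ ({o} : Set C.net.E) := h ▸ he
      simpa using this
  have hok := C.net.cell_ok v
  cases hl : C.net.label v <;> rw [hl] at hok
  case cut => exact absurd hl hcut
  case bang => exact absurd hl hbang
  case daimon p => exact absurd hl (hdai p)
  case tensor => exact absurd (.inl hl) hbin
  case par => exact absurd (.inr hl) hbin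
  case ax =>
    obtain ⟨-, a, b, X, h, ha, hb⟩ := hok
    have hp : [a, b].Perm C.net.concl := hperm _ (by
      simp only [List.nodup_cons, List.mem_singleton, List.not_mem_nil, not_false_eq_true,
        List.nodup_nil, and_true]
      rintro rfl
      simp [ha] at hb) fun e he => by
        have : e ∈ ({a, b} : Set C.net.E) := h ▸ he
        simpa using this
    refine .of_perm hp (.of_lone (C := C.withConcl _ hp) (L := [.var X, .nvar X]) ?_
      (.ax (.var X)) (fun c hc => ⟨rfl, .inr hc⟩) fun c hc => ⟨rfl, .inl ?_⟩)
    · change [a, b].map C.net.typ = _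
      simp [ha, hb]
    · exact hl ▸ isLone_of_mem_taylor (C := C.withConcl _ hp) hv hr ht hc
  case one =>
    obtain ⟨-, o, h, ho⟩ := hok
    refine .of_perm (hone o h) (.of_lone (C := C.withConcl _ (hone o h)) (L := [.one]) ?_
      .one (fun c hc => ⟨rfl, .inr hc⟩) fun c hc => ⟨rfl, .inl ?_⟩)
    · change [o].map C.net.typ = _
      simp [ho]
    · exact hl ▸ isLone_of_mem_taylor (C := C.withConcl _ (hone o h)) hv hr ht hc
  case bot =>
    obtain ⟨-, o, h, ho⟩ := hok
    refine .of_perm (hone o h) (.of_lone (C := C.withConcl _ (hone o h)) (L := [.bot]) ?_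
      .bot (fun c hc => ⟨rfl, .inr hc⟩) fun c hc => ⟨rfl, .inl ?_⟩)
    · change [o].map C.net.typ = _
      simp [ho]
    · exact hl ▸ isLone_of_mem_taylor (C := C.withConcl _ (hone o h)) hv hr ht hc
  case whynot =>
    obtain ⟨o, A, h, ho, -⟩ := hok
    refine .of_perm (hone o h) (.of_lone (C := C.withConcl _ (hone o h)) (L := [.whynot A]) ?_
      (.weak A) (fun c hc => ⟨rfl, .inr hc⟩) fun c hc => ⟨rfl, .inl ?_⟩)
    · change [o].map C.net.typ = _
      simp [ho]
    · exact hl ▸ isLone_of_mem_taylor (C := C.withConcl _ (hone o h)) hv hr ht hc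

/-- The zone of a MELL component with at least one cell can be eliminated. -/
theorem elim {C : Component} (hM : C.IsMELL) (hne : Nonempty C.net.V) : C.Elim := by
  induction hn : C.net.size using Nat.strong_induction_on generalizing C with
  | _ n ihn =>
  have ih : C.ElimBelow := fun C' hM' hs hne' => ihn _ (hn ▸ hs) hM' hne' rfl
  by_cases hcut : ∃ w, C.net.label w = .cut ∧ C.box w = C.tree.root
  · obtain ⟨w, hl, hw⟩ := hcut
    exact elim_of_cut hM ih hl hw
  have hcut' : ∀ w, C.box w = C.tree.root → C.net.label w ≠ .cut := fun w hw hl =>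
    hcut ⟨w, hl, hw⟩
  by_cases hbin : ∃ o ∈ C.net.concl, (C.net.label (C.net.src o)).IsBinary
  · obtain ⟨o, ho, hl⟩ := hbin
    exact elim_of_binary hM ih ho hl
  have hbin' : ∀ o ∈ C.net.concl, ¬ (C.net.label (C.net.src o)).IsBinary := fun o ho hl =>
    hbin ⟨o, ho, hl⟩
  by_cases hcon : ∀ o ∈ C.net.concl, C.net.label (C.net.src o) = .whynot → ∀ e e',
      C.net.tgt e = some (C.net.src o) → C.net.tgt e' = some (C.net.src o) → e = e'
  swap
  · push Not at hcon
    obtain ⟨o, ho, hl, e, e', he, he', hee⟩ := hcon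
    exact elim_of_contraction hM ih ho hl he he' hee
  -- Contractions have been excluded already, so a `?`-cell with an input from the root has no other
  -- input and dereliction applies.
  by_cases hder : ∀ o ∈ C.net.concl, C.net.label (C.net.src o) = .whynot →
      ∀ e, C.net.tgt e = some (C.net.src o) → C.box (C.net.src e) ≠ C.tree.root
  swap
  · push Not at hder
    obtain ⟨o, ho, hl, e, he, hr⟩ := hder
    exact elim_of_dereliction hM ih ho hl he (fun e' he' => hcon o ho hl e' e he' he) hr
  have htgt : ∀ e, C.box (C.net.src e) = C.tree.root → C.net.tgt e = none := fun e he =>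
    hM.tgt_eq_none hcut' hbin' hder he
  have hout : ∀ v, C.box v = C.tree.root → ∃ e ∈ C.net.concl, C.net.src e = v := fun v hv => by
    obtain ⟨e, rfl⟩ := Net.exists_out (hcut' v hv) fun p hp => (hM.2 v p hp).2 hv
    exact ⟨e, (C.net.mem_concl e).2 (htgt e hv), rfl⟩
  by_cases hbang : ∃ O ∈ C.net.concl, C.net.label (C.net.src O) = .bang
  · obtain ⟨O, hO, hW⟩ := hbang
    exact elim_of_root_bang hM ih hout htgt hcon hO hW
  -- An outermost box belongs to a `!`-cell over the root, whose output is a conclusion; without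
  -- such a cell there is no box.
  have hnode : ∀ x, x = C.tree.root := fun x => by
    by_contra hx
    obtain ⟨y, -, hy⟩ := BoxTree.exists_child hx
    obtain ⟨e, W, heW, hlW, rfl⟩ := hM.1.2.2 y (BoxTree.ne_root_of_parent hy)
    have hp := hM.1.2.1 _ _ heW hlW
    rw [hy] at hp
    obtain ⟨o, ho, rfl⟩ := hout W (Option.some.inj hp).symm
    exact hbang ⟨o, ho, hlW⟩
  obtain ⟨v⟩ := hne
  obtain ⟨e, he, rfl⟩ := hout v (hnode _)
  by_cases hall : ∀ w, w = C.net.src e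
  · exact elim_of_forall_eq hall (hnode _) (fun e => htgt e (hnode _)) (hbin' e he)
      (hcut' _ (hnode _)) (fun h => hbang ⟨e, he, h⟩) fun p hp => (hM.2 _ p hp).2 (hnode _)
  · obtain ⟨w, hw⟩ := not_forall.1 hall
    obtain ⟨e', he', rfl⟩ := hout w (hnode _)
    -- All cells lie over the root and no edge has a target, so any cell can be split off; the tree
    -- has one node, common to both parts.
    refine elim_of_split hM ih (fun v => v = C.net.src e) (fun _ => True) (fun _ => True)
      (fun a v ha => ?_) trivial trivial (fun _ _ _ _ => trivial) (fun _ _ _ _ => trivial)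
      (fun _ => .inl trivial) (fun x _ _ => hnode x) (fun _ _ => trivial) (fun _ _ => trivial)
      he he' rfl hw
    rw [htgt a (hnode _)] at ha
    cases ha

end Component.IsMELL

/-- A non-empty set of structures without daimons and without empty components, contained in the
Taylor expansion of a MELL proof-structure, is glueable. -/
theorem Glueable.of_subset_taylor {Φ : Set ResourceQPS} (hne : Φ.Nonempty)
    (hres : ∀ ρ ∈ Φ, ρ.IsResourceProofStructure) (hcell : ∀ ρ ∈ Φ, ∀ c ∈ ρ, Nonempty c.V)
    {R : QuasiProofStructure} (hR : R.IsProofStructure) (hM : R.IsMELL) (hΦ : Φ ⊆ taylor R) :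
    Glueable Φ := by
  obtain ⟨ρ₀, h₀⟩ := hne
  have hnil : Eliminable [] {[]} := ⟨.nil, fun Ψ hΨ hΨne ht =>
    ⟨ht, ((Set.Nonempty.subset_singleton_iff hΨne).1 hΨ).symm⟩⟩
  rcases R with _ | ⟨C, _ | ⟨D, R⟩⟩
  · have hmem : ∀ ρ ∈ Φ, ρ = [] := fun ρ hρ => List.forall₂_nil_left_iff.1 (hΦ hρ)
    obtain ⟨ξ, hξ⟩ := hnil
    exact ⟨[], ξ, hξ Φ hmem ⟨ρ₀, h₀⟩ fun ρ hρ => hmem ρ hρ ▸ rfl⟩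
  · have hmem : ∀ ρ ∈ Φ, ∃ c, ρ = [c] ∧ c ∈ C.taylor := fun ρ hρ => by
      obtain ⟨c, l, hc, hl, rfl⟩ := List.forall₂_cons_left_iff.1 (hΦ hρ)
      obtain rfl := List.forall₂_nil_left_iff.1 hl
      exact ⟨c, rfl, hc⟩
    -- A cell of one member projects to a cell of `C`; the induction needs one.
    have hCne : Nonempty C.net.V := by
      obtain ⟨c, rfl, t, ⟨x⟩⟩ := hmem ρ₀ h₀
      obtain ⟨v⟩ := hcell _ h₀ c (by simp)
      exact ⟨x.pV v⟩
    obtain ⟨ξ, hξ⟩ := (hM C (by simp)).elim hCne [] {[]} hnil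
    refine ⟨_, ξ, hξ Φ (fun ρ hρ => ?_) ⟨ρ₀, h₀⟩ fun ρ hρ => ?_⟩
    · obtain ⟨c, rfl, hc⟩ := hmem ρ hρ
      exact ⟨[c], [], rfl, .cons (.inr ⟨(hres _ hρ).2 c (by simp), hc⟩) .nil, rfl⟩
    · obtain ⟨c, rfl, hc⟩ := hmem ρ hρ
      exact congrArg (fun L => [L]) (Component.type_of_mem_taylor hc)
  · simp [QuasiProofStructure.IsProofStructure] at hR

end Glue

/-- Glueability criterion: a non-empty set `Φ` of `DiLL₀` proof-structures (none of which is a root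
without cells) is glueable if and only if it is contained in the Taylor expansion of some MELL
proof-structure. -/
theorem mainTheorem1 (Φ : Set Glue.ResourceQPS) (hne : Φ.Nonempty)
    (hres : ∀ ρ ∈ Φ, ρ.IsResourceProofStructure)
    (hcell : ∀ ρ ∈ Φ, ∀ c ∈ ρ, Nonempty c.V) :
    Glue.Glueable Φ ↔
      ∃ R : Glue.QuasiProofStructure, R.IsProofStructure ∧ R.IsMELL ∧ Φ ⊆ Glue.taylor R :=
  ⟨fun h => h.exists_isMELL hne hres, fun ⟨_, hR, hM, hΦ⟩ => .of_subset_taylor hne hres hcell hR hM hΦ⟩
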